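/- **Setting.** Let $r_1,r_2,k_1,k_2,k_0\ge 1$ be fixed integers. For each sample size $n$ let $p_i=p_i(n)=r_i+v_i(n)$ with $v_i(n)>k_i$ and $p_1,p_2\to\infty$, and let $$Y_t=L\begin{pmatrix}F_t&Z_{12,t}\\ Z_{21,t}&Z_{22,t}\end{pmatrix}R',\qquad t\in\mathbb Z,$$ be a weakly stationary, mean-zero $p_1\times p_2$ matrix time series, where $L=(L_1,L_2)\in\mathbb R^{p_1\times p_1}$ and $R=(R_1,R_2)\in\mathbb R^{p_2\times p_2}$ have full rank, $L_1$ and $R_1$ have $r_1$ and $r_2$ columns, and $F_t$ is $r_1\times r_2$. Let $f_t=\mathrm{vec}(F_t)$ and let $z_t$ be the vector of all entries of $Z_{12,t},Z_{21,t},Z_{22,t}$. Both are centred, $\mathrm{Cov}(f_t)=I$, $\mathrm{Cov}(z_t)=I$, $\mathrm{Cov}(z_t,z_s)=0$ for $t\ne s$, and $\mathrm{Cov}(f_t,z_s)=0$ for all $t,s$. The model and all its laws may depend on $n$; all constants below, including those in $\asymp$, do not depend on $n$. Write $L_1=A_1W_1$ and $R_1=P_1G_1$ with $A_1,P_1$ half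 orthonormal (orthonormal columns), and let $L_2=A_2\,\mathrm{diag}(d_1,\dots,d_{v_1})U_2'$ and $R_2=P_2\,\mathrm{diag}(\gamma_1,\dots,\gamma_{v_2})V_2'$ be singular value decompositions. Let $B_i,Q_i$ be half orthonormal matrices spanning the orthogonal complements of the column spaces of $A_i,P_i$. Let $A_{22}$ ($P_{22}$) be the columns of $A_2$ ($P_2$) after the first $k_1$ ($k_2$). **Assumptions.** There are $\gamma>2$ and $\delta_1,\delta_2\in[0,1)$ such that: 1. $\{(Y_t,F_t)\}$ is $\alpha$-mixing with $\sum_{k\ge1}\alpha_n(k)^{1-2/\gamma}\le C$. 2. $E|f_{i,t}|^{2\gamma}\le C$ and $E|z_{j,t}|^{2\gamma}\le C$ for all $i,j,t$. 3. The squared Euclidean norms of the columns of $L_1$, and their squared distances to the span of the other columns of $L_1$, are $\asymp p_1^{1-\delta_1}$; the same holds for $R_1$ with $p_2^{1-\delta_1}$. 4. $d_j\asymp p_1^{(1-\delta_2)/2}$ for $j\le k_1$ and $d_j\asymp1$ for $j>k_1$; $\gamma_j\asymp p_2^{(1-\delta_2)/2}$ for $j\le k_2$ and $\gamma_j\asymp1$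 for $j>k_2$. 5. (i) For each block $Z\in\{Z_{12,t},Z_{21,t},Z_{22,t}\}$, all $t$, all half orthonormal $U,V$ of fitting sizes and all vectors $h$ with $\|h\|_2=1$, $E|h'\mathrm{vec}(U'ZV)|^{2\gamma}\le C$. (ii) There are $C_3,C_4>0$ and, for each $n$, half orthonormal matrices $\Xi_1,\Xi_2$ with $r_1,r_2$ columns such that the smallest singular values of the square matrices $\Xi_1'(A_{22},B_2)'A_1$ and $\Xi_2'(P_{22},Q_2)'P_1$ are at least $C_3$ and $C_4$. 6. (Serial dependence of the factors.) For a matrix series $X_t$ with columns $x_{j,t}$ put $M(X)=\sum_{k=1}^{k_0}\sum_{i,j}\mathrm{Cov}(x_{i,t},x_{j,t-k})\,\mathrm{Cov}(x_{i,t},x_{j,t-k})'$. The smallest eigenvalues of $M(F)$ and $M(F')$ are at least some constant $c>0$. **Population spaces.** With $y_{i,t}$ the $i$-th column of $Y_t$ and $\Omega_{y_i}=\mathrm{Cov}(y_{i,t},\mathrm{vec}(Y_t))$, let $S_1=\sum_{i=1}^{p_2}[\Omega_{y_i}(Q_1\otimes B_1)][\Omega_{y_i}(Q_1\otimes B_1)]'$,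 and let $\mathcal M(B_2^*)$ be the span of orthonormal eigenvectors of $S_1$ for its $p_1-k_1$ smallest eigenvalues. $S_2$ and $\mathcal M(Q_2^*)$ are defined in the same way from the transposed series $Y_t'$ (with $B_1\otimes Q_1$ and $p_2-k_2$). **Estimators.** From $Y_1,\dots,Y_n$, let $\widehat\Sigma_{ij}(k)=\frac1n\sum_{t=k+1}^n(y_{i,t}-\bar y_i)(y_{j,t-k}-\bar y_j)'$ and $\widehat M_1=\sum_{k=1}^{k_0}\sum_{i,j}\widehat\Sigma_{ij}(k)\widehat\Sigma_{ij}(k)'$. The columns of $\widehat A_1$ and $\widehat B_1$ are orthonormal eigenvectors of $\widehat M_1$ for its $r_1$ largest and its $v_1$ smallest eigenvalues; $\widehat P_1,\widehat Q_1$ are obtained in the same way from $Y_t'$ (with $r_2,v_2$). Let $\widehat\Omega_{y_i}$ be the sample covariance (with factor $1/n$) of $y_{i,t}$ and $\mathrm{vec}(Y_t)$, and $\widehat S_1=\sum_i[\widehat\Omega_{y_i}(\widehat Q_1\otimes\widehat B_1)][\widehat\Omega_{y_i}(\widehat Q_1\otimes\widehat B_1)]'$. The columns of $\widehat B_2^*$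 are orthonormal eigenvectors of $\widehat S_1$ for its $p_1-k_1$ smallest eigenvalues; $\widehat Q_2^*$ is obtained in the same way from $Y_t'$ (with $p_2-k_2$). Ties are broken arbitrarily. For half orthonormal $H_1,H_2$ with $r$ columns let $D(\mathcal M(H_1),\mathcal M(H_2))=\{1-\frac1r\mathrm{tr}(H_1H_1'H_2H_2')\}^{1/2}$. **Theorem.** If $p_1^{\delta_1}p_2^{\delta_1}n^{-1/2}\to0$ as $n\to\infty$, then each of $$D(\mathcal M(\widehat A_1),\mathcal M(A_1)),\quad D(\mathcal M(\widehat P_1),\mathcal M(P_1)),\quad D(\mathcal M(\widehat B_1),\mathcal M(B_1)),\quad D(\mathcal M(\widehat Q_1),\mathcal M(Q_1))$$ is $O_p(p_1^{\delta_1}p_2^{\delta_1}n^{-1/2})$, and $$D(\mathcal M(\widehat B_2^*),\mathcal M(B_2^*))=O_p\big(p_1^{\delta_2}p_2^{3\delta_2/2}n^{-1/2}+p_1^{\delta_1}p_2^{\delta_1+\delta_2}n^{-1/2}\big),$$ $$D(\mathcal M(\widehat Q_2^*),\mathcal M(Q_2^*))=O_p\big(p_1^{3\delta_2/2}p_2^{\delta_2}n^{-1/2}+p_1^{\delta_1+\delta_2}p_2^{\delta_1}n^{-1/2}\big).$$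 -/

import Mathlib

open MeasureTheory ProbabilityTheory Filter Topology
open scoped Matrix Kronecker

noncomputable section

namespace MatrixFactor

/-! ### Stochastic order and discrepancy of linear spaces -/

/-- `X n = O_p(ρ n)`, where the `n`-th variable may live on its own probability space. -/
def IsBigOP {Ω : ℕ → Type*} [∀ n, MeasurableSpace (Ω n)] (P : ∀ n, Measure (Ω n))
    (X : ∀ n, Ω n → ℝ) (ρ : ℕ → ℝ) : Prop :=
  ∀ ε : ℝ, 0 < ε → ∃ C : ℝ, ∀ᶠ n in atTop,
    P n {ω | C * ρ n < |X n ω|} ≤ ENNReal.ofReal ε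

/-- `x n i ≍ ρ n`, with constants that do not depend on `n` and `i`. -/
def SameOrder {ι : ℕ → Type*} (x : ∀ n, ι n → ℝ) (ρ : ℕ → ℝ) : Prop :=
  ∃ c C : ℝ, 0 < c ∧ ∀ n, ∀ i : ι n, c * ρ n ≤ x n i ∧ x n i ≤ C * ρ n

/-- Half orthonormal matrices: the columns are orthonormal. -/
def HalfOrthonormal {m ι : Type*} [Fintype m] [DecidableEq ι] (H : Matrix m ι ℝ) : Prop :=
  Hᵀ * H = 1

/-- `D(M(H₁), M(H₂)) = sqrt (1 - tr (H₁ H₁' H₂ H₂') / r)`, where `r` is the number of columns;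
it is used for half orthonormal matrices with the same number `r` of columns. -/
def spaceDist {m ι κ : Type*} [Fintype m] [Fintype ι] [Fintype κ]
    (H₁ : Matrix m ι ℝ) (H₂ : Matrix m κ ℝ) : ℝ :=
  Real.sqrt (1 - (1 / (Fintype.card ι : ℝ)) * Matrix.trace (H₁ * H₁ᵀ * H₂ * H₂ᵀ))

/-- The columns of `G` are orthonormal eigenvectors of `M`, in decreasing order of the
corresponding eigenvalues. -/
def IsOrderedEigenbasis {p : ℕ} (M G : Matrix (Fin p) (Fin p) ℝ) : Prop :=
  HalfOrthonormal G ∧ ∃ ev : Fin p → ℝ, Antitone ev ∧ M * G = G * Matrix.diagonal ev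

/-- The first `k` columns of a matrix. -/
def firstCols {p q : ℕ} (k : ℕ) (G : Matrix (Fin p) (Fin q) ℝ) :
    Matrix (Fin p) {j : Fin q // j.val < k} ℝ :=
  G.submatrix id Subtype.val

/-- All columns of a matrix except the first `k`. -/
def lastCols {p q : ℕ} (k : ℕ) (G : Matrix (Fin p) (Fin q) ℝ) :
    Matrix (Fin p) {j : Fin q // k ≤ j.val} ℝ :=
  G.submatrix id Subtype.val

/-! ### Population and sample second moments of a matrix-variate time series -/

section Moments

variable {Ω : Type*} [MeasurableSpace Ω] {p q : ℕ}

/-- `Cov(x_{i,t}, x_{j,t-k})`, where `x_{j,t}` is the `j`-th column of `X_t` (evaluated at `t = 0`;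
it is used for weakly stationary series). -/
def lagCov (P : Measure Ω) (X : ℤ → Ω → Matrix (Fin p) (Fin q) ℝ) (k : ℕ) (i j : Fin q) :
    Matrix (Fin p) (Fin p) ℝ :=
  Matrix.of fun a b => cov[fun ω => X 0 ω a i, fun ω => X (-(k : ℤ)) ω b j; P]

/-- `∑_{k=1}^{k₀} ∑_{i,j} Cov(x_{i,t}, x_{j,t-k}) Cov(x_{i,t}, x_{j,t-k})'`. -/
def dynCov (P : Measure Ω) (X : ℤ → Ω → Matrix (Fin p) (Fin q) ℝ) (k₀ : ℕ) :
    Matrix (Fin p) (Fin p) ℝ :=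
  ∑ k ∈ Finset.Icc 1 k₀, ∑ i, ∑ j, lagCov P X k i j * (lagCov P X k i j)ᵀ

/-- `Ω_i = Cov(x_{i,t}, vec(X_t))`; `Matrix.vec` is indexed by (column, row). -/
def colVecCov (P : Measure Ω) (X : ℤ → Ω → Matrix (Fin p) (Fin q) ℝ) (i : Fin q) :
    Matrix (Fin p) (Fin q × Fin p) ℝ :=
  Matrix.of fun a c => cov[fun ω => X 0 ω a i, fun ω => (X 0 ω).vec c; P]

/-- `S = ∑_i [Ω_i (Q ⊗ B)] [Ω_i (Q ⊗ B)]'`. -/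
def projCov (P : Measure Ω) (X : ℤ → Ω → Matrix (Fin p) (Fin q) ℝ)
    {ι κ : Type*} [Fintype ι] [Fintype κ]
    (Q : Matrix (Fin q) κ ℝ) (B : Matrix (Fin p) ι ℝ) : Matrix (Fin p) (Fin p) ℝ :=
  ∑ i, (colVecCov P X i * (Q ⊗ₖ B)) * (colVecCov P X i * (Q ⊗ₖ B))ᵀ

end Moments

section Sample

variable {p q : ℕ}

/-- Sample mean `n⁻¹ ∑_{t=1}^n x_t` of an observed path. -/
def sampleMean (n : ℕ) (x : ℤ → Matrix (Fin p) (Fin q) ℝ) : Matrix (Fin p) (Fin q) ℝ :=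
  (1 / (n : ℝ)) • ∑ t ∈ Finset.Icc (1 : ℤ) n, x t

/-- `n⁻¹ ∑_{t=k+1}^n (x_{i,t} - x̄_i) (x_{j,t-k} - x̄_j)'`. -/
def sampleLagCov (n : ℕ) (x : ℤ → Matrix (Fin p) (Fin q) ℝ) (k : ℕ) (i j : Fin q) :
    Matrix (Fin p) (Fin p) ℝ :=
  Matrix.of fun a b => (1 / (n : ℝ)) * ∑ t ∈ Finset.Icc ((k : ℤ) + 1) n,
    (x t a i - sampleMean n x a i) * (x (t - k) b j - sampleMean n x b j)

/-- The sample version of `dynCov`. -/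
def sampleDynCov (n : ℕ) (x : ℤ → Matrix (Fin p) (Fin q) ℝ) (k₀ : ℕ) :
    Matrix (Fin p) (Fin p) ℝ :=
  ∑ k ∈ Finset.Icc 1 k₀, ∑ i, ∑ j, sampleLagCov n x k i j * (sampleLagCov n x k i j)ᵀ

/-- The sample version of `colVecCov`. -/
def sampleColVecCov (n : ℕ) (x : ℤ → Matrix (Fin p) (Fin q) ℝ) (i : Fin q) :
    Matrix (Fin p) (Fin q × Fin p) ℝ :=
  Matrix.of fun a c => (1 / (n : ℝ)) * ∑ t ∈ Finset.Icc (1 : ℤ) n,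
    (x t a i - sampleMean n x a i) * ((x t).vec c - (sampleMean n x).vec c)

/-- The sample version of `projCov`. -/
def sampleProjCov (n : ℕ) (x : ℤ → Matrix (Fin p) (Fin q) ℝ)
    {ι κ : Type*} [Fintype ι] [Fintype κ]
    (Q : Matrix (Fin q) κ ℝ) (B : Matrix (Fin p) ι ℝ) : Matrix (Fin p) (Fin p) ℝ :=
  ∑ i, (sampleColVecCov n x i * (Q ⊗ₖ B)) * (sampleColVecCov n x i * (Q ⊗ₖ B))ᵀ

end Sample

/-! ### The matrix factor model -/

/-- The coordinates of the noise vector `z_t`: the entries of `Z₁₂`, `Z₂₁` and `Z₂₂`. -/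
abbrev NoiseIdx (r₁ v₁ r₂ v₂ : ℕ) : Type :=
  (Fin r₁ × Fin v₂) ⊕ (Fin v₁ × Fin r₂) ⊕ (Fin v₁ × Fin v₂)

/-- The entries of the three noise blocks, as one vector. -/
def noiseVec {Ω : Type*} {r₁ v₁ r₂ v₂ : ℕ}
    (Z₁₂ : ℤ → Ω → Matrix (Fin r₁) (Fin v₂) ℝ) (Z₂₁ : ℤ → Ω → Matrix (Fin v₁) (Fin r₂) ℝ)
    (Z₂₂ : ℤ → Ω → Matrix (Fin v₁) (Fin v₂) ℝ) (t : ℤ) (ω : Ω) : NoiseIdx r₁ v₁ r₂ v₂ → ℝ :=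
  Sum.elim (fun x => Z₁₂ t ω x.1 x.2)
    (Sum.elim (fun x => Z₂₁ t ω x.1 x.2) (fun x => Z₂₂ t ω x.1 x.2))

/-- `Y_t = L [[F_t, Z₁₂,t], [Z₂₁,t, Z₂₂,t]] R'` with `L = (L₁, L₂)`, `R = (R₁, R₂)`. -/
def observed {Ω : Type*} {r₁ v₁ r₂ v₂ : ℕ}
    (L₁ : Matrix (Fin (r₁ + v₁)) (Fin r₁) ℝ) (L₂ : Matrix (Fin (r₁ + v₁)) (Fin v₁) ℝ)
    (R₁ : Matrix (Fin (r₂ + v₂)) (Fin r₂) ℝ) (R₂ : Matrix (Fin (r₂ + v₂)) (Fin v₂) ℝ)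
    (F : ℤ → Ω → Matrix (Fin r₁) (Fin r₂) ℝ)
    (Z₁₂ : ℤ → Ω → Matrix (Fin r₁) (Fin v₂) ℝ) (Z₂₁ : ℤ → Ω → Matrix (Fin v₁) (Fin r₂) ℝ)
    (Z₂₂ : ℤ → Ω → Matrix (Fin v₁) (Fin v₂) ℝ) (t : ℤ) (ω : Ω) :
    Matrix (Fin (r₁ + v₁)) (Fin (r₂ + v₂)) ℝ :=
  Matrix.fromCols L₁ L₂ * Matrix.fromBlocks (F t ω) (Z₁₂ t ω) (Z₂₁ t ω) (Z₂₂ t ω) *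
    (Matrix.fromCols R₁ R₂)ᵀ

/-- The matrix factor model with `p₁ = r₁ + v₁` rows and `p₂ = r₂ + v₂` columns: loadings of
full rank, square integrable centred factors and noises with identity covariance matrices, noises
that are white and uncorrelated with the factors at all times, weakly stationary observations. -/
structure Model {Ω : Type*} [MeasurableSpace Ω] (P : Measure Ω) (r₁ v₁ r₂ v₂ : ℕ) where
  L₁ : Matrix (Fin (r₁ + v₁)) (Fin r₁) ℝ
  L₂ : Matrix (Fin (r₁ + v₁)) (Fin v₁) ℝ
  R₁ : Matrix (Fin (r₂ + v₂)) (Fin r₂) ℝ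
  R₂ : Matrix (Fin (r₂ + v₂)) (Fin v₂) ℝ
  F : ℤ → Ω → Matrix (Fin r₁) (Fin r₂) ℝ
  Z₁₂ : ℤ → Ω → Matrix (Fin r₁) (Fin v₂) ℝ
  Z₂₁ : ℤ → Ω → Matrix (Fin v₁) (Fin r₂) ℝ
  Z₂₂ : ℤ → Ω → Matrix (Fin v₁) (Fin v₂) ℝ
  L_full : (Matrix.fromCols L₁ L₂).rank = r₁ + v₁
  R_full : (Matrix.fromCols R₁ R₂).rank = r₂ + v₂
  F_meas : ∀ t i j, Measurable fun ω => F t ω i j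
  Z_meas : ∀ t x, Measurable fun ω => noiseVec Z₁₂ Z₂₁ Z₂₂ t ω x
  F_sq : ∀ t i j, MemLp (fun ω => F t ω i j) 2 P
  Z_sq : ∀ t x, MemLp (fun ω => noiseVec Z₁₂ Z₂₁ Z₂₂ t ω x) 2 P
  F_mean : ∀ t i j, ∫ ω, F t ω i j ∂P = 0
  Z_mean : ∀ t x, ∫ ω, noiseVec Z₁₂ Z₂₁ Z₂₂ t ω x ∂P = 0
  F_cov : ∀ t i j i' j', cov[fun ω => F t ω i j, fun ω => F t ω i' j'; P] =
    if i = i' ∧ j = j' then 1 else 0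
  Z_cov : ∀ t x y, cov[fun ω => noiseVec Z₁₂ Z₂₁ Z₂₂ t ω x,
    fun ω => noiseVec Z₁₂ Z₂₁ Z₂₂ t ω y; P] = if x = y then 1 else 0
  Z_white : ∀ t s, t ≠ s → ∀ x y, cov[fun ω => noiseVec Z₁₂ Z₂₁ Z₂₂ t ω x,
    fun ω => noiseVec Z₁₂ Z₂₁ Z₂₂ s ω y; P] = 0
  FZ_uncorr : ∀ t s i j x, cov[fun ω => F t ω i j,
    fun ω => noiseVec Z₁₂ Z₂₁ Z₂₂ s ω x; P] = 0
  Y_stationary : ∀ t s h : ℤ, ∀ a b a' b',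
    cov[fun ω => observed L₁ L₂ R₁ R₂ F Z₁₂ Z₂₁ Z₂₂ (t + h) ω a b,
        fun ω => observed L₁ L₂ R₁ R₂ F Z₁₂ Z₂₁ Z₂₂ (s + h) ω a' b'; P] =
    cov[fun ω => observed L₁ L₂ R₁ R₂ F Z₁₂ Z₂₁ Z₂₂ t ω a b,
        fun ω => observed L₁ L₂ R₁ R₂ F Z₁₂ Z₂₁ Z₂₂ s ω a' b'; P]

namespace Model

variable {Ω : Type*} [MeasurableSpace Ω] {P : Measure Ω} {r₁ v₁ r₂ v₂ : ℕ}

/-- The noise vector `z_t`. -/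
def z (M : Model P r₁ v₁ r₂ v₂) : ℤ → Ω → NoiseIdx r₁ v₁ r₂ v₂ → ℝ :=
  noiseVec M.Z₁₂ M.Z₂₁ M.Z₂₂

/-- The observed series `Y_t`. -/
def Y (M : Model P r₁ v₁ r₂ v₂) : ℤ → Ω → Matrix (Fin (r₁ + v₁)) (Fin (r₂ + v₂)) ℝ :=
  observed M.L₁ M.L₂ M.R₁ M.R₂ M.F M.Z₁₂ M.Z₂₁ M.Z₂₂

/-- The series of transposes `Y_t'`. -/
def Yt (M : Model P r₁ v₁ r₂ v₂) : ℤ → Ω → Matrix (Fin (r₂ + v₂)) (Fin (r₁ + v₁)) ℝ :=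
  fun t ω => (M.Y t ω)ᵀ

/-- The series of transposes `F_t'`. -/
def Ft (M : Model P r₁ v₁ r₂ v₂) : ℤ → Ω → Matrix (Fin r₂) (Fin r₁) ℝ :=
  fun t ω => (M.F t ω)ᵀ

end Model

/-- Orthonormal factors of one pair of loadings: `L₁ = A₁ W₁` with `A₁` half orthonormal, a singular
value decomposition `L₂ = A₂ diag(d) U₂'`, and the orthonormal complements `B₁`, `B₂` of
`A₁`, `A₂`. -/
structure Decomposition {p r v : ℕ} (L₁ : Matrix (Fin p) (Fin r) ℝ)
    (L₂ : Matrix (Fin p) (Fin v) ℝ) where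
  A₁ : Matrix (Fin p) (Fin r) ℝ
  W₁ : Matrix (Fin r) (Fin r) ℝ
  A₂ : Matrix (Fin p) (Fin v) ℝ
  d : Fin v → ℝ
  U₂ : Matrix (Fin v) (Fin v) ℝ
  B₁ : Matrix (Fin p) (Fin v) ℝ
  B₂ : Matrix (Fin p) (Fin r) ℝ
  A₁_orth : HalfOrthonormal A₁
  A₂_orth : HalfOrthonormal A₂
  U₂_orth : HalfOrthonormal U₂
  B₁_orth : HalfOrthonormal B₁
  B₂_orth : HalfOrthonormal B₂
  d_nonneg : ∀ j, 0 ≤ d j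
  L₁_eq : L₁ = A₁ * W₁
  L₂_eq : L₂ = A₂ * Matrix.diagonal d * U₂ᵀ
  B₁_compl : B₁ᵀ * A₁ = 0
  B₂_compl : B₂ᵀ * A₂ = 0

/-- `(A₂₂, B₂)`, where `A₂₂` consists of the columns of `A₂` after the first `k`. -/
def Decomposition.starBasis {p r v : ℕ} {L₁ : Matrix (Fin p) (Fin r) ℝ}
    {L₂ : Matrix (Fin p) (Fin v) ℝ} (D : Decomposition L₁ L₂) (k : ℕ) :
    Matrix (Fin p) ({j : Fin v // k ≤ j.val} ⊕ Fin r) ℝ :=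
  Matrix.fromCols (lastCols k D.A₂) D.B₂

/-! ### Conditions on mixing, moments and loadings -/

/-- The σ-field generated by `(Y_t, F_t)`, `t ∈ T`. -/
def sigmaField {Ω : Type*} {a b c d : ℕ} (Y : ℤ → Ω → Matrix (Fin a) (Fin b) ℝ)
    (F : ℤ → Ω → Matrix (Fin c) (Fin d) ℝ) (T : Set ℤ) : MeasurableSpace Ω :=
  ⨆ t ∈ T, (MeasurableSpace.comap (fun ω (i : Fin a) (j : Fin b) => Y t ω i j) inferInstance ⊔
    MeasurableSpace.comap (fun ω (i : Fin c) (j : Fin d) => F t ω i j) inferInstance)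

/-- The α-mixing coefficient of `(Y_t, F_t)` at lag `k`. -/
def mixingCoeff {Ω : Type*} [MeasurableSpace Ω] (P : Measure Ω) {a b c d : ℕ}
    (Y : ℤ → Ω → Matrix (Fin a) (Fin b) ℝ) (F : ℤ → Ω → Matrix (Fin c) (Fin d) ℝ) (k : ℕ) : ℝ :=
  sSup {x : ℝ | ∃ (i : ℤ) (A B : Set Ω), MeasurableSet[sigmaField Y F (Set.Iic i)] A ∧
    MeasurableSet[sigmaField Y F (Set.Ici (i + k))] B ∧
    x = |P.real (A ∩ B) - P.real A * P.real B|}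

/-- `E|X|^s` is finite and at most `C`. -/
def MomentBound {Ω : Type*} [MeasurableSpace Ω] (P : Measure Ω) (X : Ω → ℝ) (s C : ℝ) : Prop :=
  Integrable (fun ω => |X ω| ^ s) P ∧ ∫ ω, |X ω| ^ s ∂P ≤ C

/-- `E|h' vec(U' Z V)|^s ≤ C` for all half orthonormal `U`, `V` and all `h` of unit length. -/
def ProjMomentBound {Ω : Type*} [MeasurableSpace Ω] (P : Measure Ω) {a b : ℕ}
    (Z : Ω → Matrix (Fin a) (Fin b) ℝ) (s C : ℝ) : Prop :=
  ∀ (l₁ l₂ : ℕ) (h : Fin l₂ × Fin l₁ → ℝ) (U : Matrix (Fin a) (Fin l₁) ℝ)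
    (V : Matrix (Fin b) (Fin l₂) ℝ), h ⬝ᵥ h = 1 → HalfOrthonormal U → HalfOrthonormal V →
    MomentBound P (fun ω => h ⬝ᵥ (Uᵀ * Z ω * V).vec) s C

/-- The squared distance from the `i`-th column of `L` to the span of the other columns. -/
def colGap {p r : ℕ} (L : Matrix (Fin p) (Fin r) ℝ) (i : Fin r) : ℝ :=
  ⨅ θ : Fin r → ℝ, ∑ a, (L a i - ∑ k ∈ Finset.univ.erase i, θ k * L a k) ^ 2

/-- All columns of `L n` have squared length `≍ p^(1-δ)`, and so has the component of each column
that is orthogonal to the other columns. -/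
def FactorStrength {r : ℕ} (p : ℕ → ℕ) (L : ∀ n, Matrix (Fin (p n)) (Fin r) ℝ) (δ : ℝ) : Prop :=
  SameOrder (ι := fun _ => Fin r) (fun n i => ∑ a, (L n a i) ^ 2)
    (fun n => (p n : ℝ) ^ (1 - δ)) ∧
  SameOrder (ι := fun _ => Fin r) (fun n i => colGap (L n) i) (fun n => (p n : ℝ) ^ (1 - δ))

/-- The first `k` singular values are `≍ p^((1-δ)/2)`, the others are `≍ 1`. -/
def NoiseStrength (p v : ℕ → ℕ) (k : ℕ) (d : ∀ n, Fin (v n) → ℝ) (δ : ℝ) : Prop :=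
  SameOrder (ι := fun n => {j : Fin (v n) // j.val < k}) (fun n j => d n j.val)
    (fun n => (p n : ℝ) ^ ((1 - δ) / 2)) ∧
  SameOrder (ι := fun n => {j : Fin (v n) // k ≤ j.val}) (fun n j => d n j.val) (fun _ => 1)

/-- There is a half orthonormal `Ξ` with as many columns as `A` such that the square matrix
`Ξ' B' A` has smallest singular value at least `c`. -/
def WellProjected {p r : ℕ} {ι : Type*} [Fintype ι] (B : Matrix (Fin p) ι ℝ)
    (A : Matrix (Fin p) (Fin r) ℝ) (c : ℝ) : Prop :=
  ∃ Ξ : Matrix ι (Fin r) ℝ, HalfOrthonormal Ξ ∧ ∀ x : Fin r → ℝ,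
    c ^ 2 * (x ⬝ᵥ x) ≤ ((Ξᵀ * Bᵀ * A) *ᵥ x) ⬝ᵥ ((Ξᵀ * Bᵀ * A) *ᵥ x)

/-- The sequence `p₁^a p₂^b n^(-1/2)`. -/
def rate (p₁ p₂ : ℕ → ℕ) (a b : ℝ) (n : ℕ) : ℝ :=
  (p₁ n : ℝ) ^ a * (p₂ n : ℝ) ^ b * (n : ℝ) ^ (-(1 / 2) : ℝ)

end MatrixFactor

end

/-! The proof combines one stochastic estimate with one deterministic perturbation bound.

Stochastic part. The loadings `(L₁, A₂ diag(d))` turn the rotated factors and noises `Model.rot`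
into `Y_t`. Since `L` and `R` have full rank, the rotated entries are linear functions of `Y_t`;
they inherit its mixing and stationarity, and their moments of order `2γ` are bounded because the
rotations are orthogonal. Davydov's covariance inequality (`abs_covariance_le_rpow`) then makes the
mean squared error of every sample second moment of these entries `O(1/n)`. The errors pass to `Y_t`
through weights `w` with `VᵀV ≤ diag w` (`ColBound`). The total weight is `O(p₁ p₂)`, because a
bounded number of directions has strength at most `p` on each side and the remaining ones have
bounded strength. Hence the summed squared errors of all sample autocovariances, lag zero included,
are `O_p((p₁ p₂)² / n)` (`exists_sum_lagErr_tight`). One event controls all six distances.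

Deterministic part. All matrices involved have the form `T Tᵀ`, with `T` a row of blocks (`stack`).
The leading eigenprojection of `T' T'ᵀ` maximizes the trace over projections of its rank. If `T Tᵀ`
has gap `g` and the difference `X` of the two projections satisfies `‖X T‖² ≤ c g ‖X‖²`, expanding
the trace and absorbing the cross term gives `‖X‖² ≤ const ‖T' - T‖² / g`, with no smallness
condition (`frob_proj_sub_le`).

Factor spaces. At positive lags the autocovariances are `L₁ Φ L₁'`, so `T` has range in the span of
`A₁`, and both the gap and `‖T‖²` are of order `(p₁ p₂)^(2(1-δ₁))`. Dividing the error by the gap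
gives `(p₁^δ₁ p₂^δ₁)² / n`; orthogonal complements have the same distance.

Projected analysis. `Cov(vec Y_t)` is the Kronecker product of `R R'` and `L L'`, and `B₁' L₁ = 0`;
hence `S₁ = τ L₂ L₂' B₁ B₁' L₂ L₂'` with the scalar `τ = ‖R R' Q₁ Q₁'‖²`. Separation of the strong
noise directions from the factor space puts `k₁` eigenvalues above a multiple of `τ p₁^(2(1-δ₂))`,
while the others are `O(τ)`. The error of `T` has three sources: the sample covariances, the
estimate of `B₁` and that of `Q₁` (`frob_projected_le`). The resulting bound has an extra factor
`p₁`, due to the many weak noise directions; it cancels because `D` divides by the `p₁ - k₁`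
columns. The remaining mixed powers are dominated by the two terms of the rate (`rpow_products_le`).
-/

noncomputable section

namespace MatrixFactor

/-! ### Squared Frobenius norms and bounds for quadratic forms -/

section LinearAlgebra

variable {m n l ι κ : Type*} [Fintype m] [Fintype n] [Fintype l] [Fintype ι] [Fintype κ]

/-- The squared Frobenius norm. -/
def frob (A : Matrix m n ℝ) : ℝ := ∑ i, ∑ j, A i j ^ 2

/-- `|A x|² ≤ c |x|²`. -/
def SqNormLe (A : Matrix m n ℝ) (c : ℝ) : Prop :=
  ∀ x : n → ℝ, (A *ᵥ x) ⬝ᵥ (A *ᵥ x) ≤ c * (x ⬝ᵥ x)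

/-- `c |x|² ≤ |A x|²`. -/
def SqNormGe (A : Matrix m n ℝ) (c : ℝ) : Prop :=
  ∀ x : n → ℝ, c * (x ⬝ᵥ x) ≤ (A *ᵥ x) ⬝ᵥ (A *ᵥ x)

lemma frob_nonneg (A : Matrix m n ℝ) : 0 ≤ frob A := by
  unfold frob; positivity

lemma dotProduct_self_nonneg' (x : n → ℝ) : 0 ≤ x ⬝ᵥ x :=
  Finset.sum_nonneg fun i _ => mul_self_nonneg (x i)

lemma dotProduct_self_eq_sum_sq (x : n → ℝ) : x ⬝ᵥ x = ∑ i, x i ^ 2 := by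
  simp [dotProduct, sq]

lemma dotProduct_sq_le (x y : n → ℝ) : (x ⬝ᵥ y) ^ 2 ≤ (x ⬝ᵥ x) * (y ⬝ᵥ y) := by
  rw [dotProduct_self_eq_sum_sq, dotProduct_self_eq_sum_sq]
  exact Finset.sum_mul_sq_le_sq_mul_sq _ _ _

lemma frob_transpose (A : Matrix m n ℝ) : frob Aᵀ = frob A := by
  unfold frob; rw [Finset.sum_comm]; rfl

lemma frob_eq_trace (A : Matrix m n ℝ) : frob A = Matrix.trace (Aᵀ * A) := by
  rw [← frob_transpose]
  simp [frob, Matrix.trace, Matrix.mul_apply, sq]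

lemma frob_eq_trace' (A : Matrix m n ℝ) : frob A = Matrix.trace (A * Aᵀ) := by
  rw [← frob_transpose, frob_eq_trace, Matrix.transpose_transpose]

lemma frob_eq_sum_col (A : Matrix m n ℝ) : frob A = ∑ j, (A.col j) ⬝ᵥ (A.col j) := by
  rw [frob, Finset.sum_comm]; simp [dotProduct, sq, Matrix.col]

lemma frob_neg (A : Matrix m n ℝ) : frob (-A) = frob A := by simp [frob]

lemma frob_add_le (A B : Matrix m n ℝ) : frob (A + B) ≤ 2 * frob A + 2 * frob B := by
  simp only [frob, Finset.mul_sum, ← Finset.sum_add_distrib]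
  refine Finset.sum_le_sum fun i _ => Finset.sum_le_sum fun j _ => ?_
  simp only [Matrix.add_apply]
  nlinarith [sq_nonneg (A i j - B i j)]

lemma frob_sub_comm (A B : Matrix m n ℝ) : frob (A - B) = frob (B - A) := by
  rw [← frob_neg, neg_sub]

lemma mul_col_eq {m l : Type*} (A : Matrix m n ℝ) (X : Matrix n l ℝ) (j : l) :
    (A * X).col j = A *ᵥ X.col j := by
  ext i; simp [Matrix.mul_apply, Matrix.mulVec, dotProduct, Matrix.col]

lemma SqNormLe.frob_mul_le {A : Matrix m n ℝ} {c : ℝ} (h : SqNormLe A c) (X : Matrix n l ℝ) :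
    frob (A * X) ≤ c * frob X := by
  rw [frob_eq_sum_col, frob_eq_sum_col, Finset.mul_sum]
  refine Finset.sum_le_sum fun j _ => ?_
  rw [mul_col_eq]
  exact h _

lemma SqNormGe.le_frob_mul {A : Matrix m n ℝ} {c : ℝ} (h : SqNormGe A c) (X : Matrix n l ℝ) :
    c * frob X ≤ frob (A * X) := by
  rw [frob_eq_sum_col, frob_eq_sum_col, Finset.mul_sum]
  refine Finset.sum_le_sum fun j _ => ?_
  rw [mul_col_eq]
  exact h _

lemma SqNormLe.frob_mul_le' {A : Matrix m n ℝ} {c : ℝ} (h : SqNormLe Aᵀ c) (X : Matrix l m ℝ) :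
    frob (X * A) ≤ c * frob X := by
  rw [← frob_transpose, Matrix.transpose_mul, ← frob_transpose X]
  exact h.frob_mul_le _

lemma SqNormGe.le_frob_mul' {A : Matrix m n ℝ} {c : ℝ} (h : SqNormGe Aᵀ c) (X : Matrix l m ℝ) :
    c * frob X ≤ frob (X * A) := by
  rw [← frob_transpose (X * A), Matrix.transpose_mul, ← frob_transpose X]
  exact h.le_frob_mul _

lemma mulVec_dotProduct_self (A : Matrix m n ℝ) (x : n → ℝ) :
    (A *ᵥ x) ⬝ᵥ (A *ᵥ x) = x ⬝ᵥ ((Aᵀ * A) *ᵥ x) := by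
  rw [← Matrix.mulVec_mulVec, Matrix.dotProduct_mulVec x, Matrix.vecMul_transpose]

lemma dotProduct_mulVec_transpose (A : Matrix m n ℝ) (x : m → ℝ) (y : n → ℝ) :
    x ⬝ᵥ (A *ᵥ y) = (Aᵀ *ᵥ x) ⬝ᵥ y := by
  rw [Matrix.dotProduct_mulVec, Matrix.mulVec_transpose]

lemma SqNormLe.mono {A : Matrix m n ℝ} {c d : ℝ} (h : SqNormLe A c) (hcd : c ≤ d) :
    SqNormLe A d := fun x =>
  (h x).trans (mul_le_mul_of_nonneg_right hcd (dotProduct_self_nonneg' x))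

lemma SqNormLe.mul {A : Matrix m n ℝ} {B : Matrix n l ℝ} {c d : ℝ} (hA : SqNormLe A c)
    (hB : SqNormLe B d) (hc : 0 ≤ c) : SqNormLe (A * B) (c * d) := by
  intro x
  rw [← Matrix.mulVec_mulVec, mul_assoc]
  exact (hA _).trans (mul_le_mul_of_nonneg_left (hB x) hc)

lemma SqNormGe.mul {A : Matrix m n ℝ} {B : Matrix n l ℝ} {c d : ℝ} (hA : SqNormGe A c)
    (hB : SqNormGe B d) (hc : 0 ≤ c) : SqNormGe (A * B) (c * d) := by
  intro x
  rw [← Matrix.mulVec_mulVec, mul_assoc]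
  exact (mul_le_mul_of_nonneg_left (hB x) hc).trans (hA _)

lemma SqNormLe.add {A B : Matrix m n ℝ} {c d : ℝ} (hA : SqNormLe A c) (hB : SqNormLe B d) :
    SqNormLe (A + B) (2 * c + 2 * d) := by
  intro x
  have h1 := hA x
  have h2 := hB x
  have h3 := dotProduct_self_nonneg' (A *ᵥ x - B *ᵥ x)
  rw [Matrix.add_mulVec]
  simp only [add_dotProduct, dotProduct_add, sub_dotProduct, dotProduct_sub] at h3 ⊢
  rw [dotProduct_comm (B *ᵥ x) (A *ᵥ x)] at h3 ⊢
  linarith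

/-- With `w = Aᵀ x` one has `|w|² = ⟨A w, x⟩`, and Cauchy–Schwarz gives `|w|⁴ ≤ c |w|² |x|²`. -/
lemma SqNormLe.transpose {A : Matrix m n ℝ} {c : ℝ} (h : SqNormLe A c) (hc : 0 ≤ c) :
    SqNormLe Aᵀ c := by
  intro x
  set w := Aᵀ *ᵥ x with hw
  have h1 : w ⬝ᵥ w = (A *ᵥ w) ⬝ᵥ x := by
    rw [dotProduct_comm (A *ᵥ w), dotProduct_mulVec_transpose, dotProduct_comm,
      Matrix.transpose_transpose]
  have h2 := dotProduct_sq_le (A *ᵥ w) x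
  rw [← h1] at h2
  have h3 := h w
  have hx := dotProduct_self_nonneg' x
  have hw0 := dotProduct_self_nonneg' w
  rcases hw0.eq_or_lt with h0 | h0
  · rw [← h0]; positivity
  · have : (w ⬝ᵥ w) * (w ⬝ᵥ w) ≤ (c * (x ⬝ᵥ x)) * (w ⬝ᵥ w) := by
      nlinarith
    exact le_of_mul_le_mul_right this h0

lemma sqNormLe_frob (A : Matrix m n ℝ) : SqNormLe A (frob A) := by
  intro x
  rw [dotProduct_self_eq_sum_sq, frob, Finset.sum_mul]
  refine Finset.sum_le_sum fun i _ => ?_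
  rw [dotProduct_self_eq_sum_sq]
  exact Finset.sum_mul_sq_le_sq_mul_sq _ _ _

/-- The lower bound makes `A` injective, hence surjective because it is square. For `y = A x`,
Cauchy–Schwarz on `|y|² = ⟨Aᵀ y, x⟩` and `c |x|² ≤ |y|²` conclude. For a tall matrix this fails,
since `Aᵀ` has a kernel. -/
lemma SqNormGe.transpose_of_square [DecidableEq n] {A : Matrix n n ℝ} {c : ℝ} (h : SqNormGe A c)
    (hc : 0 < c) : SqNormGe Aᵀ c := by
  have hinj : Function.Injective A.mulVec := by
    rw [← Matrix.coe_mulVecLin, ← LinearMap.ker_eq_bot, LinearMap.ker_eq_bot']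
    intro x hx
    have h1 := h x
    have h2 : A *ᵥ x = 0 := hx
    rw [h2] at h1
    have h3 : x ⬝ᵥ x = 0 := by
      have := dotProduct_self_nonneg' x
      simp only [dotProduct_zero] at h1
      nlinarith
    exact dotProduct_self_eq_zero.mp h3
  have hsurj : Function.Surjective A.mulVec := by
    have : Function.Injective A.mulVecLin := hinj
    exact LinearMap.surjective_of_injective this
  intro y
  obtain ⟨x, rfl⟩ := hsurj y
  set y := A *ᵥ x with hy
  have h1 := h x
  have h2 := dotProduct_sq_le (Aᵀ *ᵥ y) x
  rw [← dotProduct_mulVec_transpose] at h2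
  rw [← hy] at h1 h2
  have hy0 := dotProduct_self_nonneg' y
  rcases hy0.eq_or_lt with h0 | h0
  · rw [← h0, mul_zero]; exact dotProduct_self_nonneg' _
  · have ht := dotProduct_self_nonneg' (Aᵀ *ᵥ y)
    have : (c * (y ⬝ᵥ y)) * (y ⬝ᵥ y) ≤ ((Aᵀ *ᵥ y) ⬝ᵥ (Aᵀ *ᵥ y)) * (y ⬝ᵥ y) := by
      nlinarith
    exact le_of_mul_le_mul_right this h0

/-! ### Orthogonal projections -/

/-- Symmetric idempotent matrices. -/
def IsProj (E : Matrix m m ℝ) : Prop := Eᵀ = E ∧ E * E = E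

lemma IsProj.sqNormLe {E : Matrix m m ℝ} [DecidableEq m] (h : IsProj E) : SqNormLe E 1 := by
  intro x
  have h1 := dotProduct_self_nonneg' (x - E *ᵥ x)
  have h2 : (E *ᵥ x) ⬝ᵥ (E *ᵥ x) = x ⬝ᵥ (E *ᵥ x) := by
    rw [mulVec_dotProduct_self, h.1, h.2]
  simp only [sub_dotProduct, dotProduct_sub] at h1
  rw [dotProduct_comm (E *ᵥ x) x, h2] at h1
  rw [h2]; linarith

lemma IsProj.one_sub [DecidableEq m] {E : Matrix m m ℝ} (h : IsProj E) : IsProj (1 - E) := by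
  refine ⟨by simp [h.1], ?_⟩
  rw [Matrix.mul_sub, Matrix.sub_mul, Matrix.sub_mul, h.2]; simp

lemma IsProj.frob_mul_le [DecidableEq m] {E : Matrix m m ℝ} (h : IsProj E) (X : Matrix m n ℝ) :
    frob (E * X) ≤ frob X := by
  simpa using h.sqNormLe.frob_mul_le X

lemma IsProj.frob_mul_le' [DecidableEq m] {E : Matrix m m ℝ} (h : IsProj E) (X : Matrix n m ℝ) :
    frob (X * E) ≤ frob X := by
  have : SqNormLe Eᵀ 1 := by rw [h.1]; exact h.sqNormLe
  simpa using this.frob_mul_le' X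

lemma IsProj.kronecker [DecidableEq m] [DecidableEq n] {E : Matrix m m ℝ} {G : Matrix n n ℝ}
    (hE : IsProj E) (hG : IsProj G) : IsProj (E ⊗ₖ G) := by
  refine ⟨?_, ?_⟩
  · rw [← Matrix.kroneckerMap_transpose, hE.1, hG.1]
  · rw [← Matrix.mul_kronecker_mul, hE.2, hG.2]

lemma IsProj.frob_sub {E G : Matrix m m ℝ} (hE : IsProj E) (hG : IsProj G) :
    frob (E - G) = E.trace + G.trace - 2 * (E * G).trace := by
  rw [frob_eq_trace, Matrix.transpose_sub, hE.1, hG.1, Matrix.sub_mul, Matrix.mul_sub,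
    Matrix.mul_sub, hE.2, hG.2]
  simp only [Matrix.trace_sub]
  rw [Matrix.trace_mul_comm G E]; ring

lemma IsProj.trace_mul_transpose_mul {E : Matrix m m ℝ} (hE : IsProj E) (D : Matrix m n ℝ) :
    (D * Dᵀ * E).trace = frob (E * D) := by
  rw [frob_eq_trace, Matrix.transpose_mul, hE.1, Matrix.mul_assoc Dᵀ, ← Matrix.mul_assoc E E D,
    hE.2, Matrix.mul_assoc, Matrix.trace_mul_comm D, Matrix.mul_assoc]

lemma HalfOrthonormal.isProj [DecidableEq ι] {H : Matrix m ι ℝ} (h : HalfOrthonormal H) :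
    IsProj (H * Hᵀ) := by
  refine ⟨by simp, ?_⟩
  rw [Matrix.mul_assoc, ← Matrix.mul_assoc Hᵀ, show Hᵀ * H = 1 from h, Matrix.one_mul]

lemma HalfOrthonormal.trace_proj [DecidableEq ι] {H : Matrix m ι ℝ} (h : HalfOrthonormal H) :
    (H * Hᵀ).trace = Fintype.card ι := by
  rw [Matrix.trace_mul_comm, show Hᵀ * H = 1 from h, Matrix.trace_one]

lemma HalfOrthonormal.dotProduct_mulVec [DecidableEq ι] {H : Matrix m ι ℝ} (h : HalfOrthonormal H)
    (x : ι → ℝ) : (H *ᵥ x) ⬝ᵥ (H *ᵥ x) = x ⬝ᵥ x := by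
  rw [mulVec_dotProduct_self, show Hᵀ * H = 1 from h, Matrix.one_mulVec]

lemma HalfOrthonormal.sqNormLe [DecidableEq ι] {H : Matrix m ι ℝ} (h : HalfOrthonormal H) :
    SqNormLe H 1 := fun x => by rw [h.dotProduct_mulVec, one_mul]

lemma HalfOrthonormal.sqNormLe_transpose [DecidableEq ι] {H : Matrix m ι ℝ}
    (h : HalfOrthonormal H) : SqNormLe Hᵀ 1 := h.sqNormLe.transpose zero_le_one

/-- Complementary half orthonormal matrices give complementary projections. -/
lemma HalfOrthonormal.proj_add_eq_one [DecidableEq m] [DecidableEq ι] [DecidableEq κ]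
    {H : Matrix m ι ℝ} {K : Matrix m κ ℝ} (hH : HalfOrthonormal H) (hK : HalfOrthonormal K)
    (hKH : Kᵀ * H = 0) (hcard : Fintype.card m = Fintype.card ι + Fintype.card κ) :
    H * Hᵀ + K * Kᵀ = 1 := by
  have hHK : Hᵀ * K = 0 := by
    have := congrArg Matrix.transpose hKH
    simpa using this
  have h1 : (Matrix.fromRows Hᵀ Kᵀ) * (Matrix.fromCols H K) = 1 := by
    rw [Matrix.fromRows_mul_fromCols, show Hᵀ * H = 1 from hH, show Kᵀ * K = 1 from hK, hKH, hHK,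
      Matrix.fromBlocks_one]
  -- The dimension count makes `(H, K)` square, so its left inverse is also a right inverse.
  have e : (ι ⊕ κ) ≃ m := Fintype.equivOfCardEq (by simp [hcard])
  have h2 := (Matrix.mul_eq_one_comm_of_equiv e).mp h1
  rwa [Matrix.fromCols_mul_fromRows] at h2

/-- Two projections of trace `r` satisfy `‖E - G‖² = 2r - 2 tr(EG)`. All distances are handled in
this Frobenius form. -/
lemma spaceDist_eq [DecidableEq ι] [DecidableEq κ] {H : Matrix m ι ℝ} {K : Matrix m κ ℝ}
    (hH : HalfOrthonormal H) (hK : HalfOrthonormal K)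
    (hcard : Fintype.card ι = Fintype.card κ) (h0 : 0 < Fintype.card ι) :
    spaceDist H K = Real.sqrt (frob (H * Hᵀ - K * Kᵀ) / (2 * Fintype.card ι)) := by
  rw [spaceDist, hH.isProj.frob_sub hK.isProj, hH.trace_proj, hK.trace_proj, ← hcard,
    Matrix.mul_assoc (H * Hᵀ)]
  congr 1
  have : (Fintype.card ι : ℝ) ≠ 0 := by positivity
  field_simp; ring

/-! ### Perturbation of spectral projections -/

/-- Young's inequality with weight `η`, entry by entry. -/
lemma trace_transpose_mul_le (A B : Matrix m n ℝ) {η : ℝ} (hη : 0 < η) :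
    2 * (Aᵀ * B).trace ≤ η⁻¹ * frob A + η * frob B := by
  simp only [Matrix.trace, Matrix.diag, Matrix.mul_apply, Matrix.transpose_apply]
  rw [Finset.sum_comm]
  simp only [frob, Finset.mul_sum, ← Finset.sum_add_distrib]
  refine Finset.sum_le_sum fun i _ => Finset.sum_le_sum fun j _ => ?_
  have h1 : 0 ≤ η⁻¹ * (A i j - η * B i j) ^ 2 := by positivity
  have h2 : η⁻¹ * (A i j - η * B i j) ^ 2
      = η⁻¹ * A i j ^ 2 + η * B i j ^ 2 - 2 * (A i j * B i j) := by
    field_simp; ring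
  linarith

/-- A `sin Θ` theorem for left singular spaces: the squared distance of the projections is at most
the squared error over the gap. -/
lemma frob_proj_sub_le [DecidableEq m] {T T' : Matrix m n ℝ} {E E' : Matrix m m ℝ} (hE : IsProj E)
    (hE' : IsProj E') {g c : ℝ} (hg : 0 < g) (hc : 0 < c)
    (hmax : (T' * T'ᵀ * E).trace ≤ (T' * T'ᵀ * E').trace)
    (hgap : g / 2 * frob (E' - E) ≤ (T * Tᵀ * (E - E')).trace)
    (hbd : frob ((E' - E) * T) ≤ c * g * frob (E' - E)) :
    g * frob (E' - E) ≤ (22 * c + 3) * frob (T' - T) := by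
  set D := T' - T with hD
  have hT' : T' = T + D := by simp [hD]
  set X := E' - E with hX
  have hXt : Xᵀ = X := by simp [hX, hE.1, hE'.1]
  have e1 : (T * Tᵀ * (E - E')).trace = -(T * Tᵀ * X).trace := by
    rw [hX, ← Matrix.trace_neg, ← Matrix.mul_neg, neg_sub]
  have e2 : 0 ≤ (T' * T'ᵀ * X).trace := by
    rw [hX, Matrix.mul_sub, Matrix.trace_sub]; linarith
  -- Expansion of `(T + D)(T + D)ᵀ`; the two cross terms agree because `X` is symmetric.
  have e3 : (T' * T'ᵀ * X).trace = (T * Tᵀ * X).trace + 2 * (Dᵀ * (X * T)).trace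
      + (D * Dᵀ * X).trace := by
    have a1 : (T * Dᵀ * X).trace = (Dᵀ * (X * T)).trace := by
      rw [Matrix.mul_assoc, Matrix.trace_mul_comm, Matrix.mul_assoc]
    have a2 : (D * Tᵀ * X).trace = (Dᵀ * (X * T)).trace := by
      rw [← Matrix.trace_transpose]
      simp only [Matrix.transpose_mul, Matrix.transpose_transpose, hXt]
      rw [← Matrix.mul_assoc, Matrix.trace_mul_comm]
    rw [hT', Matrix.transpose_add, Matrix.add_mul, Matrix.mul_add, Matrix.mul_add, Matrix.add_mul,
      Matrix.add_mul, Matrix.add_mul]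
    simp only [Matrix.trace_add]
    rw [a1, a2]; ring
  have e4 : (D * Dᵀ * X).trace ≤ frob D := by
    rw [hX, Matrix.mul_sub, Matrix.trace_sub, hE'.trace_mul_transpose_mul,
      hE.trace_mul_transpose_mul]
    have := frob_nonneg (E * D)
    have := hE'.frob_mul_le D
    linarith
  -- With this `η` the cross term costs `8c ‖D‖² + (g/8) ‖X‖²`, and the last part is absorbed by the
  -- gap term `(g/2) ‖X‖²`. What remains is `(3/8) g ‖X‖² ≤ (8c + 1) ‖D‖²`, whence `22c + 3`.
  have e5 := trace_transpose_mul_le D (X * T) (η := (8 * c)⁻¹) (by positivity)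
  rw [inv_inv] at e5
  have e6 : (8 * c)⁻¹ * frob (X * T) ≤ g / 8 * frob X := by
    calc (8 * c)⁻¹ * frob (X * T) ≤ (8 * c)⁻¹ * (c * g * frob X) := by gcongr
      _ = g / 8 * frob X := by field_simp
  have := frob_nonneg D
  nlinarith

end LinearAlgebra

/-! ### Ordered eigenbases -/

section Eigen

variable {p : ℕ} {M G : Matrix (Fin p) (Fin p) ℝ}

lemma HalfOrthonormal.submatrix {m ι κ : Type*} [Fintype m] [DecidableEq ι] [DecidableEq κ]
    {H : Matrix m ι ℝ} (h : HalfOrthonormal H) {f : κ → ι} (hf : Function.Injective f) :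
    HalfOrthonormal (H.submatrix id f) := by
  unfold HalfOrthonormal at h ⊢
  ext i j
  have := congrFun (congrFun h (f i)) (f j)
  simp only [Matrix.mul_apply, Matrix.transpose_apply, Matrix.submatrix_apply, id] at this ⊢
  rw [this, Matrix.one_apply, Matrix.one_apply]
  simp [hf.eq_iff]

lemma HalfOrthonormal.firstCols {p q : ℕ} {H : Matrix (Fin p) (Fin q) ℝ} (h : HalfOrthonormal H)
    (k : ℕ) : HalfOrthonormal (firstCols k H) :=
  h.submatrix Subtype.val_injective

lemma HalfOrthonormal.lastCols {p q : ℕ} {H : Matrix (Fin p) (Fin q) ℝ} (h : HalfOrthonormal H)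
    (k : ℕ) : HalfOrthonormal (lastCols k H) :=
  h.submatrix Subtype.val_injective

lemma card_firstCols {p k : ℕ} (hk : k ≤ p) : Fintype.card {j : Fin p // j.val < k} = k := by
  rw [Fintype.card_subtype]
  exact Fin.card_filter_val_lt.trans (min_eq_right hk)

lemma card_lastCols {p k : ℕ} (hk : k ≤ p) : Fintype.card {j : Fin p // k ≤ j.val} = p - k := by
  have := Fintype.card_subtype_compl (fun j : Fin p => j.val < k)
  rw [card_firstCols hk] at this
  simpa [not_lt] using this

lemma firstCols_mul_transpose_add {p q : ℕ} (k : ℕ) (A : Matrix (Fin p) (Fin q) ℝ) :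
    firstCols k A * (firstCols k A)ᵀ + lastCols k A * (lastCols k A)ᵀ = A * Aᵀ := by
  ext a b
  simp only [Matrix.add_apply, Matrix.mul_apply, Matrix.transpose_apply, firstCols, lastCols,
    Matrix.submatrix_apply, id]
  rw [← Fintype.sum_subtype_add_sum_subtype (fun j : Fin q => j.val < k)
    (fun j => A a j * A b j)]
  congr 1
  exact Fintype.sum_equiv (Equiv.subtypeEquivRight fun j => by simp) _ _ fun _ => rfl

lemma HalfOrthonormal.mul_transpose_self {p : ℕ} {H : Matrix (Fin p) (Fin p) ℝ}
    (h : HalfOrthonormal H) : H * Hᵀ = 1 := mul_eq_one_comm.mp h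

lemma HalfOrthonormal.lastCols_proj {p : ℕ} {H : Matrix (Fin p) (Fin p) ℝ}
    (h : HalfOrthonormal H) (k : ℕ) :
    MatrixFactor.lastCols k H * (MatrixFactor.lastCols k H)ᵀ
      = 1 - MatrixFactor.firstCols k H * (MatrixFactor.firstCols k H)ᵀ := by
  rw [← h.mul_transpose_self, ← firstCols_mul_transpose_add k H]; simp

/-- The eigenvalues of an ordered eigenbasis maximize the trace over projections of rank `k`, with a
remainder that is controlled by the gap. -/
lemma trace_mul_proj_le {ev : Fin p → ℝ} (hG : HalfOrthonormal G)
    (hev : M * G = G * Matrix.diagonal ev) {k : ℕ} (hk : k ≤ p) {hi lo : ℝ}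
    (hhi : ∀ a : Fin p, a.val < k → hi ≤ ev a) (hlo : ∀ a : Fin p, k ≤ a.val → ev a ≤ lo)
    {E : Matrix (Fin p) (Fin p) ℝ} (hE : IsProj E) (htr : E.trace = k) :
    (hi - lo) / 2 * frob (E - firstCols k G * (firstCols k G)ᵀ)
      ≤ (M * (firstCols k G * (firstCols k G)ᵀ - E)).trace := by
  set F := firstCols k G * (firstCols k G)ᵀ with hF
  have hFp : IsProj F := (hG.firstCols k).isProj
  have hFtr : F.trace = k := by rw [(hG.firstCols k).trace_proj, card_firstCols hk]
  -- The projection in eigenvector coordinates. Only its diagonal matters: entries in `[0, 1]` with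
  -- sum `k`.
  set Q := Gᵀ * E * G with hQ
  have hQp : IsProj Q := by
    refine ⟨by simp [hQ, hE.1, Matrix.mul_assoc], ?_⟩
    calc Gᵀ * E * G * (Gᵀ * E * G) = Gᵀ * E * (G * Gᵀ) * E * G := by simp only [Matrix.mul_assoc]
      _ = Gᵀ * (E * E) * G := by rw [hG.mul_transpose_self]; simp only [Matrix.mul_assoc, Matrix.mul_one]
      _ = _ := by rw [hE.2]
  have hQ1 : ∀ a, Q a a ≤ 1 := by
    intro a
    -- Symmetry and idempotence make each diagonal entry a sum of squares that includes its own
    -- square.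
    have h1 : Q a a = ∑ b, Q a b ^ 2 := by
      conv_lhs => rw [← hQp.2]
      rw [Matrix.mul_apply]
      refine Finset.sum_congr rfl fun b _ => ?_
      rw [sq]; congr 1
      conv_lhs => rw [← hQp.1]
      rfl
    have h2 : Q a a ^ 2 ≤ ∑ b, Q a b ^ 2 :=
      Finset.single_le_sum (f := fun b => Q a b ^ 2) (fun b _ => sq_nonneg _) (Finset.mem_univ a)
    rw [← h1] at h2
    nlinarith
  have hQ0 : ∀ a, 0 ≤ Q a a := by
    intro a
    have h1 : Q a a = ∑ b, Q a b ^ 2 := by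
      conv_lhs => rw [← hQp.2]
      rw [Matrix.mul_apply]
      refine Finset.sum_congr rfl fun b _ => ?_
      rw [sq]; congr 1
      conv_lhs => rw [← hQp.1]
      rfl
    rw [h1]; positivity
  have hQtr : ∑ a, Q a a = k := by
    have : Q.trace = E.trace := by
      rw [hQ, Matrix.trace_mul_comm, ← Matrix.mul_assoc, hG.mul_transpose_self, Matrix.one_mul]
    rw [← htr, ← this]; rfl
  have hM : M = G * Matrix.diagonal ev * Gᵀ := by
    rw [← hev, Matrix.mul_assoc, hG.mul_transpose_self, Matrix.mul_one]
  have hME : (M * E).trace = ∑ a, ev a * Q a a := by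
    rw [hM, Matrix.mul_assoc, Matrix.mul_assoc, Matrix.trace_mul_comm, Matrix.mul_assoc, ← hQ]
    simp [Matrix.trace, Matrix.diagonal_mul]
  have hGF : Gᵀ * firstCols k G = (1 : Matrix (Fin p) (Fin p) ℝ).submatrix id Subtype.val := by
    rw [← show Gᵀ * G = 1 from hG]; rfl
  have hGFG : Gᵀ * F * G = Matrix.diagonal fun a : Fin p => if a.val < k then (1 : ℝ) else 0 := by
    have h1 : (firstCols k G)ᵀ * G = (Gᵀ * firstCols k G)ᵀ := by simp
    rw [hF, ← Matrix.mul_assoc, Matrix.mul_assoc (Gᵀ * firstCols k G), h1, hGF]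
    ext a b
    simp only [Matrix.mul_apply, Matrix.submatrix_apply, Matrix.transpose_apply, id,
      Matrix.one_apply, Matrix.diagonal_apply]
    have h2 := Fintype.sum_subtype_add_sum_subtype (fun j : Fin p => j.val < k)
      (fun j => if j.val < k then (if a = j then (1 : ℝ) else 0) * (if b = j then 1 else 0) else 0)
    have h3 : ∑ j : {j : Fin p // ¬ j.val < k}, (if j.1.val < k then
        (if a = j.1 then (1 : ℝ) else 0) * (if b = j.1 then 1 else 0) else 0) = 0 :=
      Finset.sum_eq_zero fun j _ => if_neg j.2
    rw [h3, add_zero] at h2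
    have h4 : ∑ j : {j : Fin p // j.val < k}, (if j.1.val < k then
        (if a = j.1 then (1 : ℝ) else 0) * (if b = j.1 then 1 else 0) else 0)
        = ∑ j : {j : Fin p // j.val < k},
          (if a = j.1 then (1 : ℝ) else 0) * (if b = j.1 then 1 else 0) :=
      Finset.sum_congr rfl fun j _ => if_pos j.2
    rw [← h4, h2, Finset.sum_eq_single a]
    · by_cases hab : a = b
      · subst hab; simp
      · simp [hab, Ne.symm hab]
    · intro c _ hc; simp [Ne.symm hc]
    · simp
  have hMF : (M * F).trace = ∑ a : Fin p, ev a * if a.val < k then 1 else 0 := by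
    rw [hM, Matrix.mul_assoc, Matrix.mul_assoc, Matrix.trace_mul_comm, Matrix.mul_assoc, hGFG]
    simp [Matrix.trace]
  have hFE : (E * F).trace = ∑ a : Fin p, (if a.val < k then 1 else 0) * Q a a := by
    have : (E * F).trace = ((Gᵀ * F * G) * Q).trace := by
      rw [hQ]
      calc (E * F).trace = (F * E).trace := Matrix.trace_mul_comm _ _
        _ = (F * (G * Gᵀ) * E * (G * Gᵀ)).trace := by rw [hG.mul_transpose_self]; simp
        _ = ((F * G * Gᵀ * E * G) * Gᵀ).trace := by simp only [Matrix.mul_assoc]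
        _ = _ := by rw [Matrix.trace_mul_comm]; simp only [Matrix.mul_assoc]
    rw [this, hGFG]; simp [Matrix.trace, Matrix.diagonal_mul]
  rw [hE.frob_sub hFp, htr, hFtr, Matrix.mul_sub, Matrix.trace_sub, hME, hMF, hFE]
  set χ : Fin p → ℝ := fun a => if a.val < k then 1 else 0 with hχ
  have hχs : ∑ a, χ a = k := by
    have : ∑ a, χ a = F.trace := by
      have : F.trace = (Gᵀ * F * G).trace := by
        rw [Matrix.trace_mul_comm (Gᵀ * F), ← Matrix.mul_assoc, hG.mul_transpose_self,
          Matrix.one_mul]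
      rw [this, hGFG]; simp [Matrix.trace, hχ]
    rw [this, hFtr]
  -- The weight missing from the first `k` coordinates equals the weight placed on the others, since
  -- both totals are `k`. Each unit moved loses at least `hi - lo`, and half of `‖E - F‖²` is the
  -- weight moved.
  have key : ∀ a, hi * (χ a - χ a * Q a a) + lo * (-Q a a + χ a * Q a a)
      ≤ ev a * χ a - ev a * Q a a := by
    intro a
    have h0 := hQ0 a
    have h1 := hQ1 a
    by_cases ha : a.val < k
    · have := hhi a ha
      simp only [hχ, ha, if_true]; nlinarith
    · have := hlo a (not_lt.mp ha)
      simp only [hχ, ha, if_false]; nlinarith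
  have := Finset.sum_le_sum fun a (_ : a ∈ Finset.univ) => key a
  simp only [Finset.sum_add_distrib, Finset.sum_sub_distrib, ← Finset.mul_sum,
    Finset.sum_neg_distrib, hχs, hQtr] at this
  change (hi - lo) / 2 * ((k : ℝ) + k - 2 * ∑ a, χ a * Q a a) ≤ ∑ a, ev a * χ a - _
  linarith

/-- The projection on the first `k` eigenvectors maximizes the trace. -/
lemma IsOrderedEigenbasis.trace_le (hG : IsOrderedEigenbasis M G) {k : ℕ} (hk : k ≤ p)
    (hk0 : 1 ≤ k) {E : Matrix (Fin p) (Fin p) ℝ} (hE : IsProj E) (htr : E.trace = k) :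
    (M * E).trace ≤ (M * (firstCols k G * (firstCols k G)ᵀ)).trace := by
  obtain ⟨hG, ev, hanti, hev⟩ := hG
  have hlt : k - 1 < p := by omega
  -- Taking `hi = lo` equal to the `k`-th eigenvalue gives Ky Fan's maximum principle. This index
  -- exists because `1 ≤ k`.
  have := trace_mul_proj_le hG hev hk (hi := ev ⟨k - 1, hlt⟩) (lo := ev ⟨k - 1, hlt⟩)
    (fun a ha => hanti (Fin.mk_le_mk.mpr (by omega) : a ≤ ⟨k - 1, hlt⟩))
    (fun a ha => hanti (by rw [Fin.le_def]; simp; omega)) hE htr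
  rw [Matrix.mul_sub, Matrix.trace_sub] at this
  simp only [sub_self, zero_div, zero_mul] at this
  linarith

lemma quadratic_form_eigen {ι : Type*} [Fintype ι] [DecidableEq ι] {ev : Fin p → ℝ}
    (hG : HalfOrthonormal G) (hev : M * G = G * Matrix.diagonal ev) {f : ι → Fin p}
    (hf : Function.Injective f) (x : ι → ℝ) :
    ((G.submatrix id f) *ᵥ x) ⬝ᵥ (M *ᵥ ((G.submatrix id f) *ᵥ x)) = ∑ i, ev (f i) * x i ^ 2 := by
  have h1 : M * G.submatrix id f = G.submatrix id f * Matrix.diagonal (ev ∘ f) := by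
    have : M * G.submatrix id f = (M * G).submatrix id f := rfl
    rw [this, hev]
    ext a b
    simp [Matrix.mul_diagonal]
  have h2 : (G.submatrix id f)ᵀ * G.submatrix id f = 1 := hG.submatrix hf
  rw [Matrix.mulVec_mulVec, h1, ← Matrix.mulVec_mulVec, dotProduct_mulVec_transpose,
    Matrix.mulVec_mulVec, h2, Matrix.one_mulVec, dotProduct]
  refine Finset.sum_congr rfl fun i _ => ?_
  simp [Matrix.mulVec_diagonal]; ring

lemma exists_mulVec_eq_zero_of_card_lt {ι κ : Type*} [Fintype ι] [Fintype κ]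
    (A : Matrix ι κ ℝ) (h : Fintype.card ι < Fintype.card κ) : ∃ x, x ≠ 0 ∧ A *ᵥ x = 0 := by
  have := LinearMap.ker_ne_bot_of_finrank_lt (f := A.mulVecLin) (by simpa using h)
  obtain ⟨x, hx, hx0⟩ := (Submodule.ne_bot_iff _).mp this
  exact ⟨x, hx0, hx⟩

/-- A lower bound of the `k`-th eigenvalue from a test space of dimension `k`. -/
lemma le_eigenvalue {ι : Type*} [Fintype ι] [DecidableEq ι] {ev : Fin p → ℝ}
    (hG : HalfOrthonormal G) (hanti : Antitone ev)
    (hev : M * G = G * Matrix.diagonal ev) {V : Matrix (Fin p) ι ℝ} (hV : HalfOrthonormal V)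
    {g : ℝ} (hg : ∀ x, g * (x ⬝ᵥ x) ≤ (V *ᵥ x) ⬝ᵥ (M *ᵥ (V *ᵥ x))) (a : Fin p)
    (ha : a.val < Fintype.card ι) : g ≤ ev a := by
  -- There are fewer than `card ι` eigenvectors before `a`, so some nonzero vector of the test space
  -- is orthogonal to all of them. On it the form is at most `ev a |x|²`.
  obtain ⟨x, hx0, hx⟩ := exists_mulVec_eq_zero_of_card_lt ((firstCols a.val G)ᵀ * V)
    (by rw [card_firstCols a.2.le]; exact ha)
  set u := (lastCols a.val G)ᵀ *ᵥ (V *ᵥ x) with hu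
  have h1 : V *ᵥ x = lastCols a.val G *ᵥ u := by
    rw [hu, Matrix.mulVec_mulVec (M := lastCols a.val G), hG.lastCols_proj, Matrix.sub_mulVec,
      Matrix.one_mulVec, ← Matrix.mulVec_mulVec _ (firstCols a.val G),
      Matrix.mulVec_mulVec x, hx, Matrix.mulVec_zero, sub_zero]
  have h2 := quadratic_form_eigen hG hev
    (Subtype.val_injective (p := fun j : Fin p => a.val ≤ j.val)) u
  have h3 := hg x
  rw [h1] at h3
  have h4 : x ⬝ᵥ x = u ⬝ᵥ u := by
    rw [← hV.dotProduct_mulVec, h1, (hG.lastCols a.val).dotProduct_mulVec]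
  have h5 : ∑ i : {j : Fin p // a.val ≤ j.val}, ev i.1 * u i ^ 2 ≤ ev a * (u ⬝ᵥ u) := by
    rw [dotProduct_self_eq_sum_sq, Finset.mul_sum]
    exact Finset.sum_le_sum fun i _ => mul_le_mul_of_nonneg_right (hanti (by
      rw [Fin.le_def]; exact i.2)) (sq_nonneg _)
  have h6 : 0 < u ⬝ᵥ u := by
    rw [← h4]
    exact (dotProduct_self_nonneg' x).lt_of_ne fun h => hx0 (dotProduct_self_eq_zero.mp h.symm)
  have h7 : g * (u ⬝ᵥ u) ≤ ev a * (u ⬝ᵥ u) := by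
    rw [← h4]
    calc _ ≤ _ := h3
      _ = _ := h2
      _ ≤ _ := h5
      _ = _ := by rw [h4]
  exact le_of_mul_le_mul_right h7 h6

/-- An upper bound of the eigenvalues after the `k`-th one from `k` linear constraints. -/
lemma eigenvalue_le {ι : Type*} [Fintype ι] [DecidableEq ι] {ev : Fin p → ℝ}
    (hG : HalfOrthonormal G) (hanti : Antitone ev)
    (hev : M * G = G * Matrix.diagonal ev) {V : Matrix (Fin p) ι ℝ}
    {g : ℝ} (hg : ∀ x, Vᵀ *ᵥ x = 0 → x ⬝ᵥ (M *ᵥ x) ≤ g * (x ⬝ᵥ x)) (a : Fin p)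
    (ha : Fintype.card ι ≤ a.val) : ev a ≤ g := by
  -- The eigenvectors up to and including `a` outnumber the constraints, so a nonzero combination of
  -- them satisfies all constraints.
  obtain ⟨x, hx0, hx⟩ := exists_mulVec_eq_zero_of_card_lt (Vᵀ * firstCols (a.val + 1) G)
    (by rw [card_firstCols a.2]; omega)
  set u := firstCols (a.val + 1) G *ᵥ x with hu
  have h2 := quadratic_form_eigen hG hev
    (Subtype.val_injective (p := fun j : Fin p => j.val < a.val + 1)) x
  have h3 := hg u (by rw [hu, Matrix.mulVec_mulVec, hx])
  have h4 : u ⬝ᵥ u = x ⬝ᵥ x := (hG.firstCols _).dotProduct_mulVec x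
  have h5 : ev a * (x ⬝ᵥ x) ≤ ∑ i : {j : Fin p // j.val < a.val + 1}, ev i.1 * x i ^ 2 := by
    rw [dotProduct_self_eq_sum_sq, Finset.mul_sum]
    exact Finset.sum_le_sum fun i _ => mul_le_mul_of_nonneg_right (hanti (by
      rw [Fin.le_def]; exact Nat.lt_succ_iff.mp i.2)) (sq_nonneg _)
  have h6 : 0 < x ⬝ᵥ x :=
    (dotProduct_self_nonneg' x).lt_of_ne fun h => hx0 (dotProduct_self_eq_zero.mp h.symm)
  have h7 : ev a * (x ⬝ᵥ x) ≤ g * (x ⬝ᵥ x) := by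
    calc _ ≤ _ := h5
      _ = _ := h2.symm
      _ ≤ _ := h3
      _ = _ := by rw [h4]
  exact le_of_mul_le_mul_right h7 h6

end Eigen

/-! ### Covariance inequalities for mixing σ-fields -/

section Covariance

variable {Ω : Type*} {m₁ m₂ mΩ : MeasurableSpace Ω} {P : Measure Ω} [IsProbabilityMeasure P]

lemma memLp_of_abs_le {X : Ω → ℝ} (hX : Measurable X) {a : ℝ} (ha : ∀ ω, |X ω| ≤ a)
    (q : ENNReal) : MemLp X q P :=
  MemLp.of_bound hX.aestronglyMeasurable a (ae_of_all _ ha)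

lemma covariance_eq_integral_mul_sub {X Y : Ω → ℝ} (hX : MemLp X 2 P) (hY : MemLp Y 2 P) :
    cov[X, Y; P] = ∫ ω, X ω * (Y ω - ∫ ω', Y ω' ∂P) ∂P := by
  have h1 : Integrable (fun ω => X ω * Y ω) P := hX.integrable_mul hY
  rw [covariance_eq_sub hX hY]
  simp only [mul_sub]
  rw [integral_sub h1 ((hX.integrable one_le_two).mul_const _), integral_mul_const]
  rfl

/-- The indicator of `A` with values `1` and `-1`. -/
def signInd (A : Set Ω) : Ω → ℝ := fun ω => 2 * A.indicator 1 ω - 1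

lemma abs_signInd (A : Set Ω) (ω : Ω) : |signInd A ω| ≤ 1 := by
  by_cases h : ω ∈ A
  · simp [signInd, h]; norm_num
  · simp [signInd, h]

lemma measurable_signInd {m : MeasurableSpace Ω} {A : Set Ω} (hA : MeasurableSet[m] A) :
    Measurable[m] (signInd A) :=
  ((measurable_const.indicator hA).const_mul 2).sub_const 1

lemma covariance_signInd {A B : Set Ω} (hA : MeasurableSet A) (hB : MeasurableSet B) :
    cov[signInd A, signInd B; P] = 4 * (P.real (A ∩ B) - P.real A * P.real B) := by
  have hI : ∀ {A : Set Ω}, MeasurableSet A → MemLp (A.indicator (1 : Ω → ℝ)) 2 P :=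
    fun {A} hA => memLp_of_abs_le (measurable_one.indicator hA) (a := 1) (fun ω => by
      by_cases h : ω ∈ A <;> simp [h]) 2
  have e : ∀ A : Set Ω, signInd A = fun ω => 2 * A.indicator 1 ω - 1 := fun _ => rfl
  rw [e A, e B, covariance_sub_const_left (((hI hA).integrable one_le_two).const_mul 2),
    covariance_sub_const_right (((hI hB).integrable one_le_two).const_mul 2),
    covariance_const_mul_left, covariance_const_mul_right, covariance_eq_sub (hI hA) (hI hB),
    integral_indicator_one hA, integral_indicator_one hB]
  have : A.indicator (1 : Ω → ℝ) * B.indicator 1 = (A ∩ B).indicator 1 := by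
    ext ω
    by_cases h : ω ∈ A <;> by_cases h' : ω ∈ B <;> simp [h, h']
  rw [this, integral_indicator_one (hA.inter hB)]; ring

/-- For bounded `m₁`-measurable `X`, `cov[X, Y] = E[X D]` with `D` the conditional expectation of
the centred `Y`. This is at most `a E|D|`, and `E|D|` is the covariance of `Y` with the sign of `D`.
So a bounded variable can be replaced by a two-valued one. -/
lemma exists_abs_covariance_le (hm : m₁ ≤ mΩ) {X Y : Ω → ℝ} (hX : Measurable[m₁] X) {a : ℝ}
    (ha : ∀ ω, |X ω| ≤ a) (hY : MemLp Y 2 P) :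
    ∃ A, MeasurableSet[m₁] A ∧ |cov[X, Y; P]| ≤ a * |cov[signInd A, Y; P]| := by
  set f : Ω → ℝ := fun ω => Y ω - ∫ ω', Y ω' ∂P with hf
  have hfi : Integrable f P := (hY.integrable one_le_two).sub (integrable_const _)
  set D := P[f | m₁] with hD
  have hDm : StronglyMeasurable[m₁] D := stronglyMeasurable_condExp
  have key : ∀ U : Ω → ℝ, Measurable[m₁] U → ∀ b : ℝ, (∀ ω, |U ω| ≤ b) →
      cov[U, Y; P] = ∫ ω, U ω * D ω ∂P := by
    intro U hU b hb
    have hU' : Measurable U := hU.mono hm le_rfl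
    have hi : Integrable (U * f) P := hfi.bdd_mul hU'.aestronglyMeasurable (ae_of_all _ hb)
    rw [covariance_eq_integral_mul_sub (memLp_of_abs_le hU' hb 2) hY]
    have h1 := condExp_mul_of_stronglyMeasurable_left (m := m₁) (μ := P) hU.stronglyMeasurable hi
      hfi
    have h2 := integral_condExp (μ := P) hm (f := U * f)
    calc ∫ ω, U ω * (Y ω - ∫ ω', Y ω' ∂P) ∂P = ∫ ω, (U * f) ω ∂P := rfl
      _ = ∫ ω, (P[U * f | m₁]) ω ∂P := h2.symm
      _ = _ := integral_congr_ae h1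
  refine ⟨{ω | 0 ≤ D ω}, hDm.measurable measurableSet_Ici, ?_⟩
  have hA : MeasurableSet[m₁] {ω | 0 ≤ D ω} := hDm.measurable measurableSet_Ici
  rw [key X hX a ha, key _ (measurable_signInd hA) 1 (abs_signInd _)]
  have hsD : ∀ ω, signInd {ω | 0 ≤ D ω} ω * D ω = |D ω| := by
    intro ω
    by_cases h : 0 ≤ D ω
    · simp [signInd, h, abs_of_nonneg h]; ring
    · simp [signInd, h, abs_of_neg (not_le.mp h)]
  simp only [hsD]
  have hDi : Integrable D P := integrable_condExp
  rw [abs_of_nonneg (a := ∫ ω, |D ω| ∂P) (integral_nonneg fun ω => abs_nonneg (D ω)),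
    ← integral_const_mul]
  refine (abs_integral_le_integral_abs).trans (integral_mono_of_nonneg
    (ae_of_all _ fun ω => abs_nonneg _) (hDi.abs.const_mul a) (ae_of_all _ fun ω => ?_))
  simp only [abs_mul]
  exact mul_le_mul_of_nonneg_right (ha ω) (abs_nonneg _)

/-- The covariance inequality for bounded variables. -/
lemma abs_covariance_le_of_bounded (h₁ : m₁ ≤ mΩ) (h₂ : m₂ ≤ mΩ) {α : ℝ}
    (hα : ∀ A B, MeasurableSet[m₁] A → MeasurableSet[m₂] B →
      |P.real (A ∩ B) - P.real A * P.real B| ≤ α)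
    {X Y : Ω → ℝ} (hX : Measurable[m₁] X) (hY : Measurable[m₂] Y) {a b : ℝ}
    (ha : ∀ ω, |X ω| ≤ a) (hb : ∀ ω, |Y ω| ≤ b) : |cov[X, Y; P]| ≤ 4 * α * (a * b) := by
  have : Nonempty Ω := nonempty_of_isProbabilityMeasure P
  have ha0 : 0 ≤ a := (abs_nonneg _).trans (ha (Classical.arbitrary Ω))
  have hb0 : 0 ≤ b := (abs_nonneg _).trans (hb (Classical.arbitrary Ω))
  -- The replacement by signs is made twice, first for `X` and then for `Y`; the covariance of two
  -- sign functions is four times the mixing difference.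
  obtain ⟨A, hA, hA'⟩ := exists_abs_covariance_le (P := P) h₁ hX ha
    (memLp_of_abs_le (hY.mono h₂ le_rfl) hb 2)
  obtain ⟨B, hB, hB'⟩ := exists_abs_covariance_le (P := P) h₂ hY hb
    (memLp_of_abs_le ((measurable_signInd hA).mono h₁ le_rfl) (abs_signInd A) 2)
  rw [covariance_comm, covariance_comm (signInd B), covariance_signInd (h₁ _ hA) (h₂ _ hB),
    abs_mul, abs_of_pos (by norm_num : (0 : ℝ) < 4)] at hB'
  have h := hα A B hA hB
  rw [covariance_comm] at hB'
  calc |cov[X, Y; P]| ≤ a * |cov[signInd A, Y; P]| := hA'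
    _ ≤ a * (b * (4 * |P.real (A ∩ B) - P.real A * P.real B|)) := by
      rw [covariance_comm (signInd A)]; gcongr
    _ ≤ a * (b * (4 * α)) := by gcongr
    _ = _ := by ring

/-- Truncation at level `M`. -/
def trunc (M x : ℝ) : ℝ := if |x| ≤ M then x else 0

lemma abs_trunc_le {M x : ℝ} (hM : 0 ≤ M) : |trunc M x| ≤ M := by
  unfold trunc; split_ifs with h
  · exact h
  · simpa using hM

lemma abs_trunc_le_abs (M x : ℝ) : |trunc M x| ≤ |x| := by
  unfold trunc; split_ifs with h
  · exact le_rfl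
  · simp

lemma measurable_trunc (M : ℝ) : Measurable (trunc M) :=
  Measurable.ite (measurableSet_le measurable_id.abs measurable_const) measurable_id
    measurable_const

/-- Beyond the truncation level a lower power is bounded by the `γ`-th power times a nonpositive
power of the level. -/
lemma rpow_tail {M t q γ : ℝ} (hM : 0 < M) (ht : M < t) (hq : q ≤ γ) :
    t ^ q ≤ t ^ γ * M ^ (q - γ) := by
  have ht0 : 0 < t := hM.trans ht
  calc t ^ q = t ^ γ * t ^ (q - γ) := by rw [← Real.rpow_add ht0]; ring_nf
    _ ≤ _ := by
      gcongr ?_ * ?_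
      exact Real.rpow_le_rpow_of_nonpos hM ht.le (by linarith)

lemma abs_sub_trunc_le {M x γ : ℝ} (hM : 0 < M) (hγ : 1 ≤ γ) :
    |x - trunc M x| ≤ |x| ^ γ * M ^ (1 - γ) := by
  unfold trunc; split_ifs with h
  · simp; positivity
  · simpa using rpow_tail hM (not_le.mp h) hγ

/-- If the first factor is nonzero then `|x| > M`. The product is at most the square of the larger
of `|x|` and `|y|`, which exceeds `M`, so `rpow_tail` with exponent `2` applies to it. -/
lemma abs_sub_trunc_mul_le {M x y γ : ℝ} (hM : 0 < M) (hγ : 2 ≤ γ) :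
    |x - trunc M x| * |y| ≤ (|x| ^ γ + |y| ^ γ) * M ^ (2 - γ) := by
  unfold trunc; split_ifs with h
  · simp; positivity
  · push Not at h
    rw [sub_zero]
    have hx := rpow_tail hM h hγ
    rw [Real.rpow_two] at hx
    rcases le_total |y| |x| with hyx | hxy
    · have : 0 ≤ |y| ^ γ * M ^ (2 - γ) := by positivity
      nlinarith [abs_nonneg x, abs_nonneg y]
    · have hy := rpow_tail hM (h.trans_le hxy) hγ
      rw [Real.rpow_two] at hy
      have : 0 ≤ |x| ^ γ * M ^ (2 - γ) := by positivity
      nlinarith [abs_nonneg x, abs_nonneg y]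

lemma memLp_two_of_moment {X : Ω → ℝ} (hX : Measurable X) {γ : ℝ} (hγ : 2 ≤ γ)
    (h : Integrable (fun ω => |X ω| ^ γ) P) : MemLp X 2 P := by
  rw [memLp_two_iff_integrable_sq hX.aestronglyMeasurable]
  refine Integrable.mono' ((integrable_const (1 : ℝ)).add h) (hX.pow_const 2).aestronglyMeasurable
    (ae_of_all _ fun ω => ?_)
  simp only [Real.norm_eq_abs, abs_pow, Pi.add_apply]
  rcases le_total |X ω| 1 with h1 | h1
  · have : 0 ≤ |X ω| ^ γ := by positivity
    nlinarith [abs_nonneg (X ω)]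
  · have : |X ω| ^ (2 : ℝ) ≤ |X ω| ^ γ := Real.rpow_le_rpow_of_exponent_le h1 hγ
    rw [Real.rpow_two] at this
    linarith

lemma abs_covariance_le_integral {U V : Ω → ℝ} (hU : MemLp U 2 P) (hV : MemLp V 2 P) :
    |cov[U, V; P]| ≤ ∫ ω, |U ω| * |V ω| ∂P + (∫ ω, |U ω| ∂P) * ∫ ω, |V ω| ∂P := by
  rw [covariance_eq_sub hU hV]
  refine (abs_sub _ _).trans (add_le_add ?_ ?_)
  · refine abs_integral_le_integral_abs.trans (le_of_eq ?_)
    simp [abs_mul]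
  · rw [abs_mul]
    exact mul_le_mul abs_integral_le_integral_abs abs_integral_le_integral_abs (abs_nonneg _)
      (integral_nonneg fun ω => abs_nonneg _)

/-- Both variables are truncated at `M`. The truncated parts contribute `4 α M²`; the covariances
with a remainder are bounded by moments and contribute `2K + (K + K²)` and `2K + K` times `M^(2-γ)`.
-/
lemma abs_covariance_le_truncation (h₁ : m₁ ≤ mΩ) (h₂ : m₂ ≤ mΩ) {α : ℝ}
    (hα : ∀ A B, MeasurableSet[m₁] A → MeasurableSet[m₂] B →
      |P.real (A ∩ B) - P.real A * P.real B| ≤ α)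
    {X Y : Ω → ℝ} (hX : Measurable[m₁] X) (hY : Measurable[m₂] Y) {γ K : ℝ} (hγ : 2 < γ)
    (hXK : MomentBound P X γ K) (hYK : MomentBound P Y γ K) {M : ℝ} (hM : 1 ≤ M) :
    |cov[X, Y; P]| ≤ 4 * α * M ^ 2 + (6 * K + K ^ 2) * M ^ (2 - γ) := by
  have hM0 : 0 < M := by linarith
  have hX' : Measurable X := hX.mono h₁ le_rfl
  have hY' : Measurable Y := hY.mono h₂ le_rfl
  have hX2 := memLp_two_of_moment hX' hγ.le hXK.1
  have hY2 := memLp_two_of_moment hY' hγ.le hYK.1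
  have hXi := hX2.integrable one_le_two
  have hYi := hY2.integrable one_le_two
  have hK : 0 ≤ K := (integral_nonneg fun ω => by positivity).trans hXK.2
  set U : Ω → ℝ := fun ω => trunc M (X ω) with hU
  set V : Ω → ℝ := fun ω => trunc M (Y ω) with hV
  have hUm : Measurable U := (measurable_trunc M).comp hX'
  have hVm : Measurable V := (measurable_trunc M).comp hY'
  have hU2 : MemLp U 2 P := memLp_of_abs_le hUm (fun ω => abs_trunc_le hM0.le) 2
  have hV2 : MemLp V 2 P := memLp_of_abs_le hVm (fun ω => abs_trunc_le hM0.le) 2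
  have e1 : cov[X, Y; P] = cov[U, V; P] + cov[X - U, Y; P] + cov[U, Y - V; P] := by
    rw [covariance_sub_left hX2 hU2 hY2, covariance_sub_right hU2 hY2 hV2]; ring
  have b1 : |cov[U, V; P]| ≤ 4 * α * (M * M) :=
    abs_covariance_le_of_bounded h₁ h₂ hα ((measurable_trunc M).comp hX)
      ((measurable_trunc M).comp hY) (fun ω => abs_trunc_le hM0.le) fun ω => abs_trunc_le hM0.le
  have hsum : Integrable (fun ω => (|X ω| ^ γ + |Y ω| ^ γ) * M ^ (2 - γ)) P :=
    (hXK.1.add hYK.1).mul_const _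
  have hsumle : ∫ ω, (|X ω| ^ γ + |Y ω| ^ γ) * M ^ (2 - γ) ∂P ≤ 2 * K * M ^ (2 - γ) := by
    rw [integral_mul_const, integral_add hXK.1 hYK.1]
    have := hXK.2; have := hYK.2
    gcongr; linarith
  have c1 : ∫ ω, |(X - U) ω| * |Y ω| ∂P ≤ 2 * K * M ^ (2 - γ) := by
    refine (integral_mono_of_nonneg (ae_of_all _ fun ω => by positivity) hsum
      (ae_of_all _ fun ω => ?_)).trans hsumle
    exact abs_sub_trunc_mul_le hM0 hγ.le
  have c2 : ∫ ω, |U ω| * |(Y - V) ω| ∂P ≤ 2 * K * M ^ (2 - γ) := by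
    refine (integral_mono_of_nonneg (ae_of_all _ fun ω => by positivity) hsum
      (ae_of_all _ fun ω => ?_)).trans hsumle
    have h1 := abs_sub_trunc_mul_le (x := Y ω) (y := X ω) hM0 hγ.le
    have h2 := abs_trunc_le_abs M (X ω)
    have h3 := abs_nonneg (Y ω - trunc M (Y ω))
    change |trunc M (X ω)| * |Y ω - trunc M (Y ω)| ≤ _
    nlinarith
  have tail : ∀ {Z : Ω → ℝ}, MomentBound P Z γ K → 
      ∫ ω, |Z ω - trunc M (Z ω)| ∂P ≤ K * M ^ (1 - γ) := by
    intro Z hZ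
    refine (integral_mono_of_nonneg (ae_of_all _ fun ω => abs_nonneg _)
      (hZ.1.mul_const (M ^ (1 - γ))) (ae_of_all _ fun ω =>
        abs_sub_trunc_le hM0 (by linarith))).trans ?_
    rw [integral_mul_const]
    exact mul_le_mul_of_nonneg_right hZ.2 (by positivity)
  have d1 : ∫ ω, |(X - U) ω| ∂P ≤ K * M ^ (1 - γ) := tail hXK
  have d2 : ∫ ω, |(Y - V) ω| ∂P ≤ K * M ^ (1 - γ) := tail hYK
  have dU : ∫ ω, |U ω| ∂P ≤ M := by
    calc ∫ ω, |U ω| ∂P ≤ ∫ _, M ∂P := integral_mono_of_nonneg (ae_of_all _ fun ω => abs_nonneg _)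
          (integrable_const _) (ae_of_all _ fun ω => abs_trunc_le hM0.le)
      _ = M := by simp
  have dV : ∫ ω, |V ω| ∂P ≤ M := by
    calc ∫ ω, |V ω| ∂P ≤ ∫ _, M ∂P := integral_mono_of_nonneg (ae_of_all _ fun ω => abs_nonneg _)
          (integrable_const _) (ae_of_all _ fun ω => abs_trunc_le hM0.le)
      _ = M := by simp
  have dY : ∫ ω, |Y ω| ∂P ≤ M + K * M ^ (1 - γ) := by
    have hi1 : Integrable (fun ω => |V ω|) P := (hV2.integrable one_le_two).abs
    have hi2 : Integrable (fun ω => |(Y - V) ω|) P := (hYi.sub (hV2.integrable one_le_two)).abs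
    calc ∫ ω, |Y ω| ∂P ≤ ∫ ω, (|V ω| + |(Y - V) ω|) ∂P := by
          refine integral_mono hYi.abs (hi1.add hi2) fun ω => ?_
          have := abs_add_le (V ω) ((Y - V) ω)
          simpa using this
      _ = ∫ ω, |V ω| ∂P + ∫ ω, |(Y - V) ω| ∂P := integral_add hi1 hi2
      _ ≤ _ := add_le_add dV d2
  have b2 := abs_covariance_le_integral (hX2.sub hU2) hY2
  have b3 := abs_covariance_le_integral hU2 (hY2.sub hV2)
  have p1 : M ^ (1 - γ) * M = M ^ (2 - γ) := by
    rw [← Real.rpow_add_one hM0.ne']; ring_nf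
  -- Here `1 ≤ M` is needed: the product of two tails must be no larger than `M^(2-γ)`.
  have p2 : M ^ (1 - γ) * M ^ (1 - γ) ≤ M ^ (2 - γ) := by
    rw [← p1]; gcongr
    exact (Real.rpow_le_one_of_one_le_of_nonpos hM (by linarith)).trans hM
  have q1 : (∫ ω, |(X - U) ω| ∂P) * ∫ ω, |Y ω| ∂P ≤ (K + K ^ 2) * M ^ (2 - γ) := by
    calc _ ≤ (K * M ^ (1 - γ)) * (M + K * M ^ (1 - γ)) :=
          mul_le_mul d1 dY (integral_nonneg fun ω => abs_nonneg _) (by positivity)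
      _ = K * (M ^ (1 - γ) * M) + K ^ 2 * (M ^ (1 - γ) * M ^ (1 - γ)) := by ring
      _ ≤ K * M ^ (2 - γ) + K ^ 2 * M ^ (2 - γ) := by rw [p1]; gcongr
      _ = _ := by ring
  have q2 : (∫ ω, |U ω| ∂P) * ∫ ω, |(Y - V) ω| ∂P ≤ K * M ^ (2 - γ) := by
    calc _ ≤ M * (K * M ^ (1 - γ)) :=
          mul_le_mul dU d2 (integral_nonneg fun ω => abs_nonneg _) hM0.le
      _ = K * (M ^ (1 - γ) * M) := by ring
      _ = _ := by rw [p1]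
  rw [e1]
  have t1 := abs_add_le (cov[U, V; P] + cov[X - U, Y; P]) cov[U, Y - V; P]
  have t2 := abs_add_le cov[U, V; P] cov[X - U, Y; P]
  nlinarith

/-- Davydov's covariance inequality, for variables with bounded moments of order `γ > 2`. -/
lemma abs_covariance_le_rpow (h₁ : m₁ ≤ mΩ) (h₂ : m₂ ≤ mΩ) {α : ℝ} (hα1 : α ≤ 1)
    (hα : ∀ A B, MeasurableSet[m₁] A → MeasurableSet[m₂] B →
      |P.real (A ∩ B) - P.real A * P.real B| ≤ α)
    {X Y : Ω → ℝ} (hX : Measurable[m₁] X) (hY : Measurable[m₂] Y) {γ K : ℝ} (hγ : 2 < γ)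
    (hXK : MomentBound P X γ K) (hYK : MomentBound P Y γ K) :
    |cov[X, Y; P]| ≤ (4 + 6 * K + K ^ 2) * α ^ (1 - 2 / γ) := by
  have hα0 : 0 ≤ α := (abs_nonneg _).trans (hα ∅ ∅ (@MeasurableSet.empty _ m₁) (@MeasurableSet.empty _ m₂))
  have hγ0 : 0 < γ := by linarith
  have hK : 0 ≤ K := (integral_nonneg fun ω => by positivity).trans hXK.2
  have hexp : 0 < 1 - 2 / γ := by rw [sub_pos, div_lt_one hγ0]; exact hγ
  have key : ∀ β : ℝ, 0 < β → β ≤ 1 → α ≤ β →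
      |cov[X, Y; P]| ≤ (4 + 6 * K + K ^ 2) * β ^ (1 - 2 / γ) := by
    intro β hβ hβ1 hαβ
    -- The level `β^(-1/γ)` balances `β M²` against `M^(2-γ)`; both become `β^(1-2/γ)`.
    have h := abs_covariance_le_truncation h₁ h₂ (fun A B hA hB => (hα A B hA hB).trans hαβ) hX hY
      hγ hXK hYK (M := β ^ (-(1 / γ)))
      (Real.one_le_rpow_of_pos_of_le_one_of_nonpos hβ hβ1 (by simp; positivity))
    have e1 : β * (β ^ (-(1 / γ))) ^ 2 = β ^ (1 - 2 / γ) := by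
      rw [← Real.rpow_natCast, ← Real.rpow_mul hβ.le, ← Real.rpow_one_add' hβ.le]
      · congr 1; push_cast; ring
      · push_cast; ring_nf; ring_nf at hexp; linarith
    have e2 : (β ^ (-(1 / γ))) ^ (2 - γ) = β ^ (1 - 2 / γ) := by
      rw [← Real.rpow_mul hβ.le]; congr 1; field_simp; ring
    rw [mul_assoc, e1, e2] at h
    linarith
  -- For `α = 0` no finite level balances the terms, so the bound is passed to the limit `β → 0`.
  rcases hα0.eq_or_lt with h0 | h0
  · have hc : Tendsto (fun β : ℝ => (4 + 6 * K + K ^ 2) * β ^ (1 - 2 / γ)) (𝓝[>] 0)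
        (𝓝 ((4 + 6 * K + K ^ 2) * α ^ (1 - 2 / γ))) := by
      rw [← h0]
      exact ((Real.continuousAt_rpow_const 0 _ (Or.inr hexp.le)).tendsto.const_mul _).mono_left
        nhdsWithin_le_nhds
    refine ge_of_tendsto hc ?_
    filter_upwards [Ioo_mem_nhdsGT (zero_lt_one (α := ℝ))] with β hβ
    exact key β hβ.1 hβ.2.le (h0 ▸ hβ.1.le)
  · exact key α h0 hα1 le_rfl

end Covariance

/-! ### Sums of mixing sequences -/

section MixingSums

variable {Ω : Type*} {a b c d : ℕ} {Y : ℤ → Ω → Matrix (Fin a) (Fin b) ℝ}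
  {F : ℤ → Ω → Matrix (Fin c) (Fin d) ℝ}

lemma sigmaField_mono {T T' : Set ℤ} (h : T ⊆ T') : sigmaField Y F T ≤ sigmaField Y F T' :=
  biSup_mono h

lemma measurable_entry_sigmaField {T : Set ℤ} {t : ℤ} (ht : t ∈ T) (i : Fin a) (j : Fin b) :
    Measurable[sigmaField Y F T] fun ω => Y t ω i j := by
  have h1 : Measurable[MeasurableSpace.comap (fun ω (i : Fin a) (j : Fin b) => Y t ω i j)
      inferInstance] (fun ω (i : Fin a) (j : Fin b) => Y t ω i j) := comap_measurable _
  have h2 := ((measurable_pi_apply j).comp (measurable_pi_apply i)).comp h1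
  exact h2.mono (le_sup_left.trans (le_biSup (fun t =>
    (MeasurableSpace.comap (fun ω (i : Fin a) (j : Fin b) => Y t ω i j) inferInstance ⊔
    MeasurableSpace.comap (fun ω (i : Fin c) (j : Fin d) => F t ω i j) inferInstance)) ht)) le_rfl

variable [mΩ : MeasurableSpace Ω] {P : Measure Ω}

lemma sigmaField_le (hY : ∀ t i j, Measurable fun ω => Y t ω i j)
    (hF : ∀ t i j, Measurable fun ω => F t ω i j) (T : Set ℤ) : sigmaField Y F T ≤ mΩ := by
  refine iSup₂_le fun t _ => sup_le ?_ ?_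
  · exact Measurable.comap_le (measurable_pi_lambda _ fun i => measurable_pi_lambda _ fun j =>
      hY t i j)
  · exact Measurable.comap_le (measurable_pi_lambda _ fun i => measurable_pi_lambda _ fun j =>
      hF t i j)

lemma mixingCoeff_nonneg (k : ℕ) : 0 ≤ mixingCoeff P Y F k := by
  refine Real.sSup_nonneg ?_
  rintro x ⟨i, A, B, -, -, rfl⟩
  exact abs_nonneg _

/-- `|uv|^γ` is at most the average of `|u|^(2γ)` and `|v|^(2γ)`. This is why moments of order `2γ`
are needed: the mixing inequality is applied to products. -/
lemma MomentBound.mul {U V : Ω → ℝ} (hU : Measurable U) (hV : Measurable V) {γ K : ℝ} 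
    (hUK : MomentBound P U (2 * γ) K) (hVK : MomentBound P V (2 * γ) K) :
    MomentBound P (fun ω => U ω * V ω) γ K := by
  have hle : ∀ ω, |U ω * V ω| ^ γ ≤ (|U ω| ^ (2 * γ) + |V ω| ^ (2 * γ)) / 2 := by
    intro ω
    have e : ∀ x : ℝ, |x| ^ (2 * γ) = (|x| ^ γ) ^ 2 := fun x => by
      rw [mul_comm, Real.rpow_mul (abs_nonneg x), Real.rpow_two]
    rw [abs_mul, Real.mul_rpow (abs_nonneg _) (abs_nonneg _), e, e]
    nlinarith [sq_nonneg (|U ω| ^ γ - |V ω| ^ γ)]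
  have hi := (hUK.1.add hVK.1).div_const 2
  refine ⟨hi.mono' ((hU.mul hV).abs.pow_const γ).aestronglyMeasurable (ae_of_all _ fun ω => ?_), ?_⟩
  · rw [Real.norm_of_nonneg (by positivity)]; exact hle ω
  · refine (integral_mono_of_nonneg (ae_of_all _ fun ω => by positivity) hi
      (ae_of_all _ hle)).trans ?_
    simp only [Pi.add_apply]
    rw [integral_div, integral_add hUK.1 hVK.1]
    linarith [hUK.2, hVK.2]

variable [IsProbabilityMeasure P]

lemma abs_real_inter_sub_le_one (A B : Set Ω) :
    |P.real (A ∩ B) - P.real A * P.real B| ≤ 1 := by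
  have h1 : P.real (A ∩ B) ≤ 1 := measureReal_le_one
  have h2 : P.real A ≤ 1 := measureReal_le_one
  have h3 : P.real B ≤ 1 := measureReal_le_one
  have h4 : 0 ≤ P.real (A ∩ B) := measureReal_nonneg
  have h5 : 0 ≤ P.real A := measureReal_nonneg
  have h6 : 0 ≤ P.real B := measureReal_nonneg
  rw [abs_le]; constructor <;> nlinarith [mul_nonneg h5 h6]

/-- Needed for `sSup` to be an actual upper bound of the mixing differences. -/
lemma bddAbove_mixing (k : ℕ) : BddAbove {x : ℝ | ∃ (i : ℤ) (A B : Set Ω),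
    MeasurableSet[sigmaField Y F (Set.Iic i)] A ∧ MeasurableSet[sigmaField Y F (Set.Ici (i + k))] B ∧
    x = |P.real (A ∩ B) - P.real A * P.real B|} := by
  refine ⟨1, ?_⟩
  rintro x ⟨i, A, B, -, -, rfl⟩
  exact abs_real_inter_sub_le_one A B

lemma mixingCoeff_le_one (k : ℕ) : mixingCoeff P Y F k ≤ 1 := by
  refine Real.sSup_le ?_ zero_le_one
  rintro x ⟨i, A, B, -, -, rfl⟩
  exact abs_real_inter_sub_le_one A B

lemma abs_covariance_le_mixingCoeff (hY : ∀ t i j, Measurable fun ω => Y t ω i j)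
    (hF : ∀ t i j, Measurable fun ω => F t ω i j) {i : ℤ} {k : ℕ} {U V : Ω → ℝ}
    (hU : Measurable[sigmaField Y F (Set.Iic i)] U)
    (hV : Measurable[sigmaField Y F (Set.Ici (i + k))] V) {γ K : ℝ} (hγ : 2 < γ)
    (hUK : MomentBound P U γ K) (hVK : MomentBound P V γ K) :
    |cov[U, V; P]| ≤ (4 + 6 * K + K ^ 2) * mixingCoeff P Y F k ^ (1 - 2 / γ) :=
  abs_covariance_le_rpow (sigmaField_le hY hF _) (sigmaField_le hY hF _) (mixingCoeff_le_one k)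
    (fun A B hA hB => le_csSup (bddAbove_mixing k) ⟨i, A, B, hA, hB, rfl⟩) hU hV hγ hUK hVK

/-- The mixing bound with both σ-fields full and `α = 1`. It serves the time lags at which two
products overlap. -/
lemma abs_covariance_le_moment {U V : Ω → ℝ} (hU : Measurable U) (hV : Measurable V) {γ K : ℝ}
    (hγ : 2 < γ) (hUK : MomentBound P U γ K) (hVK : MomentBound P V γ K) :
    |cov[U, V; P]| ≤ 4 + 6 * K + K ^ 2 := by
  simpa using abs_covariance_le_rpow (m₁ := mΩ) (m₂ := mΩ) le_rfl le_rfl le_rfl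
    (fun A B _ _ => abs_real_inter_sub_le_one A B) hU hV hγ hUK hVK

/-- On each side of `t` the map `s ↦ |t - s|` is injective; the two sides give the factor `2`. -/
lemma sum_natAbs_le_tsum {B : ℕ → ℝ} (hB : ∀ j, 0 ≤ B j) (hs : Summable B) (I : Finset ℤ)
    (t : ℤ) : ∑ s ∈ I, B (t - s).natAbs ≤ 2 * ∑' j, B j := by
  rw [← Finset.sum_filter_add_sum_filter_not I (fun s => t ≤ s)]
  have h1 : ∑ s ∈ I with t ≤ s, B (t - s).natAbs ≤ ∑' j, B j := by
    rw [← Finset.sum_image (s := I.filter (t ≤ ·)) (g := fun s => (t - s).natAbs) (f := B)]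
    · exact hs.sum_le_tsum _ fun j _ => hB j
    · intro x hx y hy hxy
      simp only [Finset.coe_filter, Set.mem_ofPred_eq] at hx hy hxy
      omega
  have h2 : ∑ s ∈ I with ¬ t ≤ s, B (t - s).natAbs ≤ ∑' j, B j := by
    rw [← Finset.sum_image (s := I.filter (¬ t ≤ ·)) (g := fun s => (t - s).natAbs) (f := B)]
    · exact hs.sum_le_tsum _ fun j _ => hB j
    · intro x hx y hy hxy
      simp only [Finset.coe_filter, Set.mem_ofPred_eq] at hx hy hxy
      omega
  linarith

lemma variance_sum_le {g : ℤ → Ω → ℝ} (I : Finset ℤ) (hg : ∀ t, MemLp (g t) 2 P) {B : ℕ → ℝ}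
    (hB : ∀ j, 0 ≤ B j) (hs : Summable B)
    (hcov : ∀ t s, t ≤ s → |cov[g t, g s; P]| ≤ B (s - t).natAbs) :
    Var[fun ω => ∑ t ∈ I, g t ω; P] ≤ I.card * (2 * ∑' j, B j) := by
  have hm : AEMeasurable (fun ω => ∑ t ∈ I, g t ω) P :=
    Finset.aemeasurable_fun_sum _ fun t _ => (hg t).aestronglyMeasurable.aemeasurable
  rw [← covariance_self hm, covariance_fun_sum_fun_sum' (fun t _ => hg t) fun t _ => hg t]
  calc ∑ t ∈ I, ∑ s ∈ I, cov[g t, g s; P] ≤ ∑ t ∈ I, ∑ s ∈ I, B (t - s).natAbs := by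
        refine Finset.sum_le_sum fun t _ => Finset.sum_le_sum fun s _ => ?_
        rcases le_total t s with h | h
        · rw [← Int.natAbs_neg, neg_sub]
          exact (le_abs_self _).trans (hcov t s h)
        · rw [covariance_comm]
          exact (le_abs_self _).trans (hcov s t h)
    _ ≤ ∑ _ ∈ I, 2 * ∑' j, B j := Finset.sum_le_sum fun t _ => sum_natAbs_le_tsum hB hs I t
    _ = _ := by simp

/-- Lets sample means be treated as sample moments of products with the constant `1`, which requires
`1 ≤ K`. -/
lemma momentBound_one {s K : ℝ} (hK : 1 ≤ K) : MomentBound P (fun _ : Ω => (1 : ℝ)) s K := by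
  simp [MomentBound, hK]

/-- The mixing coefficients, extended by `1` to the lags up to `k`. -/
def lagWeight (α : ℕ → ℝ) (k j : ℕ) : ℝ := if j ≤ k then 1 else α (j - k)

lemma summable_lagWeight {α : ℕ → ℝ} (hα : Summable fun j => α (j + 1)) (k : ℕ) :
    Summable (lagWeight α k) ∧ ∑' j, lagWeight α k j = k + 1 + ∑' j, α (j + 1) := by
  have e : (fun j => lagWeight α k (j + (k + 1))) = fun j => α (j + 1) := by
    ext j
    rw [lagWeight, if_neg (by omega)]; congr 1; omega
  have hs : Summable (lagWeight α k) := by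
    rw [← summable_nat_add_iff (k + 1), e]; exact hα
  refine ⟨hs, ?_⟩
  rw [← hs.sum_add_tsum_nat_add (k + 1), e]
  congr 1
  rw [Finset.sum_congr rfl (g := fun _ => (1 : ℝ))]
  · simp
  · intro j hj
    rw [lagWeight, if_pos (by rw [Finset.mem_range] at hj; omega)]

/-- The variance of sums of products of entries at lag `k` is of the order of the number of
summands. -/
lemma variance_sum_mul_le (hY : ∀ t i j, Measurable fun ω => Y t ω i j)
    (hF : ∀ t i j, Measurable fun ω => F t ω i j) {γ K S : ℝ} (hγ : 2 < γ)
    (hα : Summable fun j : ℕ => mixingCoeff P Y F (j + 1) ^ (1 - 2 / γ))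
    (hS : ∑' j : ℕ, mixingCoeff P Y F (j + 1) ^ (1 - 2 / γ) ≤ S)
    {U V : ℤ → Ω → ℝ} (hU : ∀ t, Measurable[sigmaField Y F {t}] (U t))
    (hV : ∀ t, Measurable[sigmaField Y F {t}] (V t))
    (hUK : ∀ t, MomentBound P (U t) (2 * γ) K) (hVK : ∀ t, MomentBound P (V t) (2 * γ) K)
    (k : ℕ) (I : Finset ℤ) :
    Var[fun ω => ∑ t ∈ I, U t ω * V (t - k) ω; P]
      ≤ I.card * (2 * ((4 + 6 * K + K ^ 2) * (k + 1 + S))) := by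
  have hU' : ∀ t, Measurable (U t) := fun t => (hU t).mono (sigmaField_le hY hF _) le_rfl
  have hV' : ∀ t, Measurable (V t) := fun t => (hV t).mono (sigmaField_le hY hF _) le_rfl
  have hgK : ∀ t, MomentBound P (fun ω => U t ω * V (t - k) ω) γ K := fun t =>
    (hUK t).mul (hU' t) (hV' _) (hVK _)
  have hg2 : ∀ t, MemLp (fun ω => U t ω * V (t - k) ω) 2 P := fun t =>
    memLp_two_of_moment ((hU' t).mul (hV' _)) hγ.le (hgK t).1
  have hK : 0 ≤ K := (integral_nonneg fun ω => by positivity).trans (hUK 0).2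
  obtain ⟨h1, h2⟩ := summable_lagWeight (α := fun j => mixingCoeff P Y F j ^ (1 - 2 / γ)) hα k
  set B : ℕ → ℝ := fun j => (4 + 6 * K + K ^ 2) *
    lagWeight (fun j => mixingCoeff P Y F j ^ (1 - 2 / γ)) k j with hB
  have hB0 : ∀ j, 0 ≤ B j := by
    intro j
    have : 0 ≤ mixingCoeff P Y F (j - k) := mixingCoeff_nonneg _
    simp only [hB, lagWeight]; split_ifs <;> positivity
  refine (variance_sum_le I hg2 hB0 (h1.mul_left _) ?_).trans ?_
  · intro t s hts
    simp only [hB, lagWeight]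
    split_ifs with h
    · rw [mul_one]
      exact abs_covariance_le_moment ((hU' t).mul (hV' _)) ((hU' s).mul (hV' _)) hγ (hgK t) (hgK s)
    -- The product at `t` involves the times `t - k` and `t`, that at `s` the times `s - k` and `s`.
    -- When `s - t > k` the two σ-fields are separated by `s - t - k`; smaller differences use the
    -- moment bound.
    · have hm : ∀ t : ℤ, ∀ T : Set ℤ, t ∈ T → t - k ∈ T →
          Measurable[sigmaField Y F T] (fun ω => U t ω * V (t - k) ω) := fun t T h1 h2 =>
        ((hU t).mono (sigmaField_mono (by simpa using h1)) le_rfl).mul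
          ((hV _).mono (sigmaField_mono (by simpa using h2)) le_rfl)
      refine abs_covariance_le_mixingCoeff hY hF (i := t) (hm t _ ?_ ?_) (hm s _ ?_ ?_) hγ (hgK t)
        (hgK s) <;> simp only [Set.mem_Iic, Set.mem_Ici] <;> omega
  · rw [tsum_mul_left, h2]
    gcongr

lemma integral_sub_sq {U : Ω → ℝ} (hU : MemLp U 2 P) (c : ℝ) :
    ∫ ω, (U ω - c) ^ 2 ∂P = Var[U; P] + (∫ ω, U ω ∂P - c) ^ 2 := by
  have hi := hU.integrable one_le_two
  have h2 : Integrable (fun ω => U ω ^ 2) P := hU.integrable_sq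
  rw [variance_eq_sub hU]
  have e : (fun ω => (U ω - c) ^ 2) = fun ω => (U ω ^ 2 - 2 * c * U ω) + c ^ 2 := by
    ext ω; ring
  have hi' : Integrable (fun ω => 2 * c * U ω) P := hi.const_mul _
  have h3 : Integrable (fun ω => U ω ^ 2 - 2 * c * U ω) P := h2.sub hi'
  rw [e, integral_add h3 (integrable_const _), integral_sub h2 hi', integral_const_mul]
  simp only [integral_const, probReal_univ, one_smul, Pi.pow_apply]
  ring

/-- The mean squared error of a sample moment at lag `k`. -/
lemma integral_sampleMoment_sub_sq_le (hY : ∀ t i j, Measurable fun ω => Y t ω i j)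
    (hF : ∀ t i j, Measurable fun ω => F t ω i j) {γ K S : ℝ} (hγ : 2 < γ)
    (hα : Summable fun j : ℕ => mixingCoeff P Y F (j + 1) ^ (1 - 2 / γ))
    (hS : ∑' j : ℕ, mixingCoeff P Y F (j + 1) ^ (1 - 2 / γ) ≤ S)
    {U V : ℤ → Ω → ℝ} (hU : ∀ t, Measurable[sigmaField Y F {t}] (U t))
    (hV : ∀ t, Measurable[sigmaField Y F {t}] (V t))
    (hUK : ∀ t, MomentBound P (U t) (2 * γ) K) (hVK : ∀ t, MomentBound P (V t) (2 * γ) K)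
    (k : ℕ) {n : ℕ} (hkn : k ≤ n) (hn : 0 < n) {σ : ℝ}
    (hσ : ∀ t, ∫ ω, U t ω * V (t - k) ω ∂P = σ) :
    Integrable (fun ω => (1 / (n : ℝ) * ∑ t ∈ Finset.Icc ((k : ℤ) + 1) n, U t ω * V (t - k) ω
      - σ) ^ 2) P ∧
    ∫ ω, (1 / (n : ℝ) * ∑ t ∈ Finset.Icc ((k : ℤ) + 1) n, U t ω * V (t - k) ω - σ) ^ 2 ∂P
      ≤ (2 * ((4 + 6 * K + K ^ 2) * (k + 1 + S)) + k ^ 2 * (1 + K) ^ 2) / n := by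
  have hU' : ∀ t, Measurable (U t) := fun t => (hU t).mono (sigmaField_le hY hF _) le_rfl
  have hV' : ∀ t, Measurable (V t) := fun t => (hV t).mono (sigmaField_le hY hF _) le_rfl
  have hgK : ∀ t, MomentBound P (fun ω => U t ω * V (t - k) ω) γ K := fun t =>
    (hUK t).mul (hU' t) (hV' _) (hVK _)
  have hg2 : ∀ t, MemLp (fun ω => U t ω * V (t - k) ω) 2 P := fun t =>
    memLp_two_of_moment ((hU' t).mul (hV' _)) hγ.le (hgK t).1
  have hK : 0 ≤ K := (integral_nonneg fun ω => by positivity).trans (hUK 0).2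
  have hS0 : 0 ≤ S := (tsum_nonneg fun j => Real.rpow_nonneg (mixingCoeff_nonneg _) _).trans hS
  have hsum : MemLp (fun ω => ∑ t ∈ Finset.Icc ((k : ℤ) + 1) n, U t ω * V (t - k) ω) 2 P :=
    memLp_finsetSum _ fun t _ => hg2 t
  have hmem := hsum.const_mul (1 / (n : ℝ))
  -- From `|x| ≤ 1 + |x|^γ`; this bound enters only through the bias.
  have hσb : |σ| ≤ 1 + K := by
    rw [← hσ 0]
    refine abs_integral_le_integral_abs.trans ?_
    have hi := (integrable_const (1 : ℝ)).add (hgK 0).1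
    refine (integral_mono_of_nonneg (ae_of_all _ fun ω => abs_nonneg _) hi
      (ae_of_all _ fun ω => ?_)).trans ?_
    · simp only [Pi.add_apply]
      rcases le_total |U 0 ω * V (0 - k) ω| 1 with h | h
      · exact h.trans (le_add_of_nonneg_right (by positivity))
      · have := Real.rpow_le_rpow_of_exponent_le h (by linarith : (1 : ℝ) ≤ γ)
        rw [Real.rpow_one] at this
        linarith
    · simp only [Pi.add_apply]
      rw [integral_add (integrable_const _) (hgK 0).1]
      simpa using (hgK 0).2
  refine ⟨(hmem.sub (memLp_const σ)).integrable_sq, ?_⟩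
  rw [integral_sub_sq hmem, variance_const_mul, integral_const_mul,
    integral_finsetSum _ fun t _ => (hg2 t).integrable one_le_two]
  simp only [hσ]
  have hcard : (Finset.Icc ((k : ℤ) + 1) n).card = n - k := by
    rw [Int.card_Icc]; omega
  have hv := variance_sum_mul_le hY hF hγ hα hS hU hV hUK hVK k (Finset.Icc ((k : ℤ) + 1) n)
  rw [Finset.sum_const, hcard, nsmul_eq_mul, Nat.cast_sub hkn]
  rw [hcard, Nat.cast_sub hkn] at hv
  have hn' : (0 : ℝ) < n := by exact_mod_cast hn
  have hn1 : (1 : ℝ) ≤ n := by exact_mod_cast hn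
  have hA : 0 ≤ 2 * ((4 + 6 * K + K ^ 2) * (k + 1 + S)) := by positivity
  rw [add_div]
  refine add_le_add ?_ ?_
  · calc (1 / (n : ℝ)) ^ 2 * _ ≤ (1 / (n : ℝ)) ^ 2 *
          ((n : ℝ) * (2 * ((4 + 6 * K + K ^ 2) * (k + 1 + S)))) := by
          refine mul_le_mul_of_nonneg_left (hv.trans ?_) (by positivity)
          exact mul_le_mul_of_nonneg_right (by linarith [(Nat.cast_nonneg k : (0 : ℝ) ≤ k)]) hA
      _ = _ := by field_simp
  -- Dividing `n - k` summands by `n` produces the bias `-kσ/n`, whose square is of smaller order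
  -- than the variance bound.
  · have e : 1 / (n : ℝ) * ((n - k) * σ) - σ = -(k * σ / n) := by field_simp; ring
    have hσ2 : σ ^ 2 ≤ (1 + K) ^ 2 := sq_le_sq' (by linarith [neg_abs_le σ]) (by
      linarith [le_abs_self σ])
    rw [e, neg_sq, div_pow, mul_pow]
    calc (k : ℝ) ^ 2 * σ ^ 2 / (n : ℝ) ^ 2 ≤ k ^ 2 * (1 + K) ^ 2 / (n : ℝ) ^ 2 := by gcongr
      _ ≤ _ := by
        gcongr
        nlinarith

end MixingSums

/-! ### Sample covariances of linear transformations -/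

section ColBound

variable {α β μ ν : Type*} [Fintype α] [Fintype β] [Fintype μ] [Fintype ν]

/-- `VᵀV ≤ diag w`. -/
def ColBound (V : Matrix α μ ℝ) (w : μ → ℝ) : Prop :=
  ∀ u : μ → ℝ, ∑ a, (∑ m, V a m * u m) ^ 2 ≤ ∑ m, w m * u m ^ 2

/-- The two indices are treated one after the other: `V'` with the first index frozen, then `V` for
each `m'`. The second step is weighted by `w'`, whence its nonnegativity. -/
lemma ColBound.double {V : Matrix α μ ℝ} {w : μ → ℝ} {V' : Matrix β ν ℝ} {w' : ν → ℝ}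
    (hV : ColBound V w) (hV' : ColBound V' w') (hw' : ∀ m, 0 ≤ w' m) (E : μ → ν → ℝ) :
    ∑ a, ∑ b, (∑ m, ∑ m', V a m * V' b m' * E m m') ^ 2
      ≤ ∑ m, ∑ m', w m * w' m' * E m m' ^ 2 := by
  have e : ∀ a b, ∑ m, ∑ m', V a m * V' b m' * E m m'
      = ∑ m', V' b m' * ∑ m, V a m * E m m' := by
    intro a b
    rw [Finset.sum_comm]
    refine Finset.sum_congr rfl fun m' _ => ?_
    rw [Finset.mul_sum]
    exact Finset.sum_congr rfl fun m _ => by ring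
  simp only [e]
  calc ∑ a, ∑ b, (∑ m', V' b m' * ∑ m, V a m * E m m') ^ 2
      ≤ ∑ a, ∑ m', w' m' * (∑ m, V a m * E m m') ^ 2 := Finset.sum_le_sum fun a _ => hV' _
    _ = ∑ m', w' m' * ∑ a, (∑ m, V a m * E m m') ^ 2 := by
      rw [Finset.sum_comm]; simp only [Finset.mul_sum]
    _ ≤ ∑ m', w' m' * ∑ m, w m * E m m' ^ 2 :=
      Finset.sum_le_sum fun m' _ => mul_le_mul_of_nonneg_left (hV _) (hw' m')
    _ = _ := by
      simp only [Finset.mul_sum]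
      rw [Finset.sum_comm]
      exact Finset.sum_congr rfl fun m _ => Finset.sum_congr rfl fun m' _ => by ring

lemma ColBound.kronecker {V : Matrix α μ ℝ} {w : μ → ℝ} {V' : Matrix β ν ℝ} {w' : ν → ℝ}
    (hV : ColBound V w) (hV' : ColBound V' w') (hw' : ∀ m, 0 ≤ w' m) :
    ColBound (V ⊗ₖ V') fun m => w m.1 * w' m.2 := by
  intro u
  simpa only [Fintype.sum_prod_type, Matrix.kroneckerMap_apply] using
    hV.double hV' hw' fun m m' => u (m, m')

end ColBound

section SampleError

variable {Ω : Type*} [mΩ : MeasurableSpace Ω] {P : Measure Ω} [IsProbabilityMeasure P]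
  {a b c d : ℕ} {Y : ℤ → Ω → Matrix (Fin a) (Fin b) ℝ} {F : ℤ → Ω → Matrix (Fin c) (Fin d) ℝ}

lemma sum_const_mul_sq_le {α : Type*} [Fintype α] {f g : α → ℝ} {θ A B : ℝ} (hθ : θ ^ 2 ≤ 1)
    (hf : ∑ a, f a ^ 2 ≤ A) (hg : ∑ a, g a ^ 2 ≤ B) :
    ∑ a, ∑ b, (θ * (f a * g b)) ^ 2 ≤ A * B := by
  have e : ∑ a, ∑ b, (θ * (f a * g b)) ^ 2 = θ ^ 2 * ((∑ a, f a ^ 2) * ∑ b, g b ^ 2) := by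
    rw [Finset.sum_mul_sum, Finset.mul_sum]
    refine Finset.sum_congr rfl fun a _ => ?_
    rw [Finset.mul_sum]
    exact Finset.sum_congr rfl fun b _ => by ring
  rw [e]
  have h1 : 0 ≤ ∑ a, f a ^ 2 := by positivity
  have h2 : 0 ≤ ∑ a, g a ^ 2 := by positivity
  calc θ ^ 2 * ((∑ a, f a ^ 2) * ∑ b, g b ^ 2) ≤ 1 * ((∑ a, f a ^ 2) * ∑ b, g b ^ 2) := by gcongr
    _ ≤ 1 * (A * B) := by
      have := h1.trans hf
      gcongr
    _ = _ := one_mul _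

/-- The bound `4 N² (T + 3 T²)`. -/
def scaledError (N T : ℝ) : ℝ := 4 * N ^ 2 * (T + 3 * T ^ 2)

/-- The four terms are those of a product centred at its sample mean. Squaring costs a factor `4`.
Each of the three rank-one terms is, after scaling by `N`, at most the square of the total `T`; this
gives `T + 3T²`. -/
lemma sum_sq_le_scaledError {α : Type*} [Fintype α] {E : α → α → ℝ} {f g g' : α → ℝ}
    {N θ q u v z : ℝ} (hN : 0 < N) (hθ : θ ^ 2 ≤ 1) (hE : ∑ a, ∑ b, E a b ^ 2 ≤ q)
    (hf : ∑ a, f a ^ 2 ≤ u) (hg : ∑ a, g a ^ 2 ≤ v) (hg' : ∑ a, g' a ^ 2 ≤ z)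
    (hq : 0 ≤ q) (hu : 0 ≤ u) (hv : 0 ≤ v) (hz : 0 ≤ z) :
    ∑ a, ∑ b, (E a b - 1 * (f a * g' b) - 1 * (g a * f b) + θ * (f a * f b)) ^ 2
      ≤ scaledError N (q / N ^ 2 + u / N + v / N + z / N) := by
  have n2 := sum_const_mul_sq_le (θ := 1) (by norm_num) hf hg'
  have n3 := sum_const_mul_sq_le (θ := 1) (by norm_num) hg hf
  have n4 := sum_const_mul_sq_le hθ hf hf
  have hfour : ∀ p1 p2 p3 p4 : ℝ, (p1 - p2 - p3 + p4) ^ 2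
      ≤ 4 * (p1 ^ 2 + p2 ^ 2 + p3 ^ 2 + p4 ^ 2) := by
    intro p1 p2 p3 p4
    nlinarith [sq_nonneg (p1 + p2), sq_nonneg (p1 + p3), sq_nonneg (p1 - p4),
      sq_nonneg (p2 - p3), sq_nonneg (p2 + p4), sq_nonneg (p3 + p4)]
  refine (Finset.sum_le_sum fun a _ => Finset.sum_le_sum fun b _ => hfour _ _ _ _).trans ?_
  simp only [← Finset.mul_sum, Finset.sum_add_distrib]
  have e : 4 * (q + u * z + v * u + u * u)
      = 4 * N ^ 2 * (q / N ^ 2 + (u / N * (z / N) + v / N * (u / N) + u / N * (u / N))) := by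
    field_simp; ring
  have g1 : 0 ≤ q / N ^ 2 := by positivity
  have g2 : 0 ≤ u / N := by positivity
  have g3 : 0 ≤ v / N := by positivity
  have g4 : 0 ≤ z / N := by positivity
  calc _ ≤ 4 * (q + u * z + v * u + u * u) := by linarith
    _ = _ := e
    _ ≤ _ := by
      rw [scaledError]
      generalize q / N ^ 2 = q at *
      generalize u / N = u at *
      generalize v / N = v at *
      generalize z / N = z at *
      refine mul_le_mul_of_nonneg_left ?_ (by positivity)
      have l1 : u * z ≤ (q + u + v + z) * (q + u + v + z) := by gcongr <;> linarith
      have l2 : v * u ≤ (q + u + v + z) * (q + u + v + z) := by gcongr <;> linarith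
      have l3 : u * u ≤ (q + u + v + z) * (q + u + v + z) := by gcongr <;> linarith
      linarith

/-- The squared error of the sample covariances of `V x_t` in terms of centred sample moments
of `x_t`. -/
lemma sampleError_le {α μ : Type*} [Fintype α] [Fintype μ] {k n : ℕ} (hkn : k ≤ n) (hn : 0 < n)
    {V : Matrix α μ ℝ} {w : μ → ℝ} (hV : ColBound V w) (hw : ∀ m, 0 ≤ w m) {N : ℝ} (hN : 0 < N)
    {x : ℤ → μ → ℝ} {y : ℤ → α → ℝ} (hy : ∀ t a, y t a = ∑ m, V a m * x t m)
    {ybar : α → ℝ} (hybar : ∀ a, ybar a = 1 / (n : ℝ) * ∑ t ∈ Finset.Icc (1 : ℤ) n, y t a)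
    (σ : μ → μ → ℝ) :
    ∑ a, ∑ b, (1 / (n : ℝ) * ∑ t ∈ Finset.Icc ((k : ℤ) + 1) n,
      (y t a - ybar a) * (y (t - k) b - ybar b) - ∑ m, ∑ m', V a m * V b m' * σ m m') ^ 2
    ≤ scaledError N
      ((∑ m, ∑ m', w m * w m' * (1 / (n : ℝ) * ∑ t ∈ Finset.Icc ((k : ℤ) + 1) n,
        x t m * x (t - k) m' - σ m m') ^ 2) / N ^ 2
      + (∑ m, w m * (1 / (n : ℝ) * ∑ t ∈ Finset.Icc (1 : ℤ) n, x t m) ^ 2) / N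
      + (∑ m, w m * (1 / (n : ℝ) * ∑ t ∈ Finset.Icc ((k : ℤ) + 1) n, x t m) ^ 2) / N
      + (∑ m, w m * (1 / (n : ℝ) * ∑ t ∈ Finset.Icc ((k : ℤ) + 1) n, x (t - k) m) ^ 2) / N) := by
  have hn' : (0 : ℝ) < n := by exact_mod_cast hn
  set e : μ → μ → ℝ := fun m m' =>
    1 / (n : ℝ) * ∑ t ∈ Finset.Icc ((k : ℤ) + 1) n, x t m * x (t - k) m' - σ m m' with he
  set s : μ → ℝ := fun m => 1 / (n : ℝ) * ∑ t ∈ Finset.Icc ((k : ℤ) + 1) n, x t m with hs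
  set s' : μ → ℝ := fun m =>
    1 / (n : ℝ) * ∑ t ∈ Finset.Icc ((k : ℤ) + 1) n, x (t - k) m with hs'
  set xb : μ → ℝ := fun m => 1 / (n : ℝ) * ∑ t ∈ Finset.Icc (1 : ℤ) n, x t m with hxb
  -- The mean is taken over all `n` times and the products over `n - k` of them, so the product of
  -- two means keeps the weight `(n - k)/n ≤ 1`.
  set θ : ℝ := 1 / (n : ℝ) * (n - k : ℕ) with hθ
  have hθ1 : θ ^ 2 ≤ 1 := by
    have h0 : 0 ≤ θ := by positivity
    have h1 : θ ≤ 1 := by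
      rw [hθ, one_div, inv_mul_le_iff₀ hn', mul_one]; exact_mod_cast Nat.sub_le n k
    nlinarith
  set yb : α → ℝ := fun a => ∑ m, V a m * xb m with hyb
  set ys : α → ℝ := fun a => ∑ m, V a m * s m with hys
  set ys' : α → ℝ := fun a => ∑ m, V a m * s' m with hys'
  have lin : ∀ (I : Finset ℤ) (f : ℤ → μ → ℝ) (a : α),
      1 / (n : ℝ) * ∑ t ∈ I, ∑ m, V a m * f t m = ∑ m, V a m * (1 / (n : ℝ) * ∑ t ∈ I, f t m) := by
    intro I f a
    rw [Finset.sum_comm, Finset.mul_sum]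
    refine Finset.sum_congr rfl fun m _ => ?_
    rw [← Finset.mul_sum]; ring
  have hyb' : ∀ a, ybar a = yb a := by
    intro a; rw [hybar]; simp only [hy]; rw [lin]
  have hys1 : ∀ a, 1 / (n : ℝ) * ∑ t ∈ Finset.Icc ((k : ℤ) + 1) n, y t a = ys a := by
    intro a; simp only [hy]; rw [lin]
  have hys1' : ∀ a, 1 / (n : ℝ) * ∑ t ∈ Finset.Icc ((k : ℤ) + 1) n, y (t - k) a = ys' a := by
    intro a; simp only [hy]; rw [lin _ fun t m => x (t - k) m]
  have hcard : (Finset.Icc ((k : ℤ) + 1) n).card = n - k := by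
    rw [Int.card_Icc]; omega
  have hC : ∀ a b, 1 / (n : ℝ) * ∑ t ∈ Finset.Icc ((k : ℤ) + 1) n, y t a * y (t - k) b
      - ∑ m, ∑ m', V a m * V b m' * σ m m' = ∑ m, ∑ m', V a m * V b m' * e m m' := by
    intro a b
    have : ∑ t ∈ Finset.Icc ((k : ℤ) + 1) n, y t a * y (t - k) b
        = ∑ m, ∑ m', V a m * V b m' * ∑ t ∈ Finset.Icc ((k : ℤ) + 1) n,
          x t m * x (t - k) m' := by
      simp_rw [hy, Finset.sum_mul_sum, Finset.mul_sum]
      rw [Finset.sum_comm]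
      refine Finset.sum_congr rfl fun m _ => ?_
      rw [Finset.sum_comm]
      exact Finset.sum_congr rfl fun m' _ => Finset.sum_congr rfl fun t _ => by ring
    rw [this, Finset.mul_sum, ← Finset.sum_sub_distrib]
    refine Finset.sum_congr rfl fun m _ => ?_
    rw [Finset.mul_sum, ← Finset.sum_sub_distrib]
    refine Finset.sum_congr rfl fun m' _ => ?_
    simp only [he]; ring
  have hdec : ∀ a b, 1 / (n : ℝ) * ∑ t ∈ Finset.Icc ((k : ℤ) + 1) n,
      (y t a - ybar a) * (y (t - k) b - ybar b) - ∑ m, ∑ m', V a m * V b m' * σ m m'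
      = ∑ m, ∑ m', V a m * V b m' * e m m' - 1 * (yb a * ys' b) - 1 * (ys a * yb b)
        + θ * (yb a * yb b) := by
    intro a b
    rw [← hC, ← hys1, ← hys1', hθ, ← hcard]
    simp only [hyb', sub_mul, mul_sub, Finset.sum_sub_distrib, ← Finset.mul_sum, ← Finset.sum_mul,
      Finset.sum_const, nsmul_eq_mul]
    ring
  simp only [hdec]
  exact sum_sq_le_scaledError hN hθ1 (hV.double hV hw e) (hV xb) (hV s) (hV s')
    (Finset.sum_nonneg fun m _ => Finset.sum_nonneg fun m' _ =>
      mul_nonneg (mul_nonneg (hw m) (hw m')) (sq_nonneg _))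
    (Finset.sum_nonneg fun m _ => mul_nonneg (hw m) (sq_nonneg _))
    (Finset.sum_nonneg fun m _ => mul_nonneg (hw m) (sq_nonneg _))
    (Finset.sum_nonneg fun m _ => mul_nonneg (hw m) (sq_nonneg _))

/-- The squared error of the sample covariances of the variables `V x_t` is bounded by a variable
whose expectation is of order `1 / n`, after division by the squared scale. -/
lemma exists_sampleError_bound {α μ : Type*} [Fintype α] [Fintype μ]
    (hY : ∀ t i j, Measurable fun ω => Y t ω i j)
    (hF : ∀ t i j, Measurable fun ω => F t ω i j) {γ K S : ℝ} (hγ : 2 < γ) (hK : 1 ≤ K)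
    (hα : Summable fun j : ℕ => mixingCoeff P Y F (j + 1) ^ (1 - 2 / γ))
    (hS : ∑' j : ℕ, mixingCoeff P Y F (j + 1) ^ (1 - 2 / γ) ≤ S)
    {x : ℤ → Ω → μ → ℝ} (hx : ∀ t m, Measurable[sigmaField Y F {t}] fun ω => x t ω m)
    (hxK : ∀ t m, MomentBound P (fun ω => x t ω m) (2 * γ) K)
    (hx0 : ∀ t m, ∫ ω, x t ω m ∂P = 0)
    {k n : ℕ} (hkn : k ≤ n) (hn : 0 < n) {σ : μ → μ → ℝ}
    (hσ : ∀ t m m', ∫ ω, x t ω m * x (t - k) ω m' ∂P = σ m m')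
    {V : Matrix α μ ℝ} {w : μ → ℝ} (hV : ColBound V w) (hw : ∀ m, 0 ≤ w m) {N : ℝ} (hN : 0 < N)
    (hwN : ∑ m, w m ≤ N) {y : ℤ → Ω → α → ℝ} (hy : ∀ t ω a, y t ω a = ∑ m, V a m * x t ω m)
    {ybar : Ω → α → ℝ}
    (hybar : ∀ ω a, ybar ω a = 1 / (n : ℝ) * ∑ t ∈ Finset.Icc (1 : ℤ) n, y t ω a) :
    ∃ T : Ω → ℝ, (∀ ω, 0 ≤ T ω) ∧ Integrable T P ∧
      ∫ ω, T ω ∂P ≤ 4 * (2 * ((4 + 6 * K + K ^ 2) * (k + 1 + S)) + k ^ 2 * (1 + K) ^ 2) / n ∧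
      ∀ ω, ∑ a, ∑ b, (1 / (n : ℝ) * ∑ t ∈ Finset.Icc ((k : ℤ) + 1) n,
          (y t ω a - ybar ω a) * (y (t - k) ω b - ybar ω b)
          - ∑ m, ∑ m', V a m * V b m' * σ m m') ^ 2 ≤ scaledError N (T ω) := by
  have hn' : (0 : ℝ) < n := by exact_mod_cast hn
  have hS0 : 0 ≤ S := (tsum_nonneg fun j => Real.rpow_nonneg (mixingCoeff_nonneg _) _).trans hS
  set D : ℝ := 2 * ((4 + 6 * K + K ^ 2) * (k + 1 + S)) + k ^ 2 * (1 + K) ^ 2 with hD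
  have hone : ∀ t : ℤ, MomentBound P (fun _ : Ω => (1 : ℝ)) (2 * γ) K := fun _ => momentBound_one hK
  -- centred sample moments of `x`
  set e : Ω → μ → μ → ℝ := fun ω m m' =>
    1 / (n : ℝ) * ∑ t ∈ Finset.Icc ((k : ℤ) + 1) n, x t ω m * x (t - k) ω m' - σ m m' with he
  set s : Ω → μ → ℝ := fun ω m => 1 / (n : ℝ) * ∑ t ∈ Finset.Icc ((k : ℤ) + 1) n, x t ω m with hs
  set s' : Ω → μ → ℝ := fun ω m =>
    1 / (n : ℝ) * ∑ t ∈ Finset.Icc ((k : ℤ) + 1) n, x (t - k) ω m with hs'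
  set xb : Ω → μ → ℝ := fun ω m => 1 / (n : ℝ) * ∑ t ∈ Finset.Icc (1 : ℤ) n, x t ω m with hxb
  have he1 : ∀ m m', Integrable (fun ω => e ω m m' ^ 2) P ∧ ∫ ω, e ω m m' ^ 2 ∂P ≤ D / n :=
    fun m m' => integral_sampleMoment_sub_sq_le hY hF hγ hα hS (U := fun t ω => x t ω m)
      (V := fun t ω => x t ω m') (fun t => hx t m) (fun t => hx t m') (fun t => hxK t m)
      (fun t => hxK t m') k hkn hn fun t => hσ t m m'
  -- Partial means are moments of products with the constant `1`, so the bound for second moments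
  -- covers them with the same `D`.
  have hs1 : ∀ m, Integrable (fun ω => s ω m ^ 2) P ∧ ∫ ω, s ω m ^ 2 ∂P ≤ D / n := fun m => by
    have := integral_sampleMoment_sub_sq_le hY hF hγ hα hS (U := fun t ω => x t ω m)
      (V := fun t ω => 1) (fun t => hx t m) (fun t => measurable_const) (fun t => hxK t m)
      hone k hkn hn (σ := 0) fun t => by simpa using hx0 t m
    simp only [mul_one, sub_zero] at this
    exact this
  have hs'1 : ∀ m, Integrable (fun ω => s' ω m ^ 2) P ∧ ∫ ω, s' ω m ^ 2 ∂P ≤ D / n := fun m => by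
    have := integral_sampleMoment_sub_sq_le hY hF hγ hα hS (U := fun t ω => 1)
      (V := fun t ω => x t ω m) (fun t => measurable_const) (fun t => hx t m) hone
      (fun t => hxK t m) k hkn hn (σ := 0) fun t => by simpa using hx0 (t - k) m
    simp only [one_mul, sub_zero] at this
    exact this
  have hxb1 : ∀ m, Integrable (fun ω => xb ω m ^ 2) P ∧ ∫ ω, xb ω m ^ 2 ∂P ≤ D / n := fun m => by
    have := integral_sampleMoment_sub_sq_le hY hF hγ hα hS (U := fun t ω => x t ω m)
      (V := fun t ω => 1) (fun t => hx t m) (fun t => measurable_const) (fun t => hxK t m)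
      hone 0 (Nat.zero_le n) hn (σ := 0) fun t => by simpa using hx0 t m
    simp only [Nat.cast_zero, zero_add, mul_one, sub_zero] at this
    refine ⟨this.1, this.2.trans ?_⟩
    gcongr
    rw [hD]
    have : 0 ≤ (k : ℝ) ^ 2 * (1 + K) ^ 2 := by positivity
    have : (4 + 6 * K + K ^ 2) * (1 + S) ≤ (4 + 6 * K + K ^ 2) * (k + 1 + S) := by
      gcongr; linarith [(Nat.cast_nonneg k : (0 : ℝ) ≤ k)]
    nlinarith
  -- weighted sums
  set Q : Ω → ℝ := fun ω => ∑ m, ∑ m', w m * w m' * e ω m m' ^ 2 with hQ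
  set A : (Ω → μ → ℝ) → Ω → ℝ := fun f ω => ∑ m, w m * f ω m ^ 2 with hA
  have hD0 : 0 ≤ D / n := by positivity
  have hAint : ∀ f : Ω → μ → ℝ, (∀ m, Integrable (fun ω => f ω m ^ 2) P ∧
      ∫ ω, f ω m ^ 2 ∂P ≤ D / n) → Integrable (A f) P ∧ ∫ ω, A f ω ∂P ≤ N * (D / n) := by
    intro f hf
    have hi : ∀ m ∈ Finset.univ, Integrable (fun ω => w m * f ω m ^ 2) P := fun m _ =>
      (hf m).1.const_mul _
    refine ⟨integrable_finsetSum _ hi, ?_⟩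
    simp only [hA]
    rw [integral_finsetSum _ hi]
    simp only [integral_const_mul]
    calc ∑ m, w m * ∫ ω, f ω m ^ 2 ∂P ≤ ∑ m, w m * (D / n) :=
          Finset.sum_le_sum fun m _ => mul_le_mul_of_nonneg_left (hf m).2 (hw m)
      _ = (∑ m, w m) * (D / n) := by rw [Finset.sum_mul]
      _ ≤ _ := by gcongr
  have hQint : Integrable Q P ∧ ∫ ω, Q ω ∂P ≤ N ^ 2 * (D / n) := by
    have hi : ∀ m ∈ Finset.univ, ∀ m' ∈ Finset.univ,
        Integrable (fun ω => w m * w m' * e ω m m' ^ 2) P := fun m _ m' _ =>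
      (he1 m m').1.const_mul _
    refine ⟨integrable_finsetSum _ fun m hm => integrable_finsetSum _ (hi m hm), ?_⟩
    simp only [hQ]
    rw [integral_finsetSum _ fun m hm => integrable_finsetSum _ (hi m hm)]
    have h0 : 0 ≤ ∑ m, w m := Finset.sum_nonneg fun m _ => hw m
    calc ∑ m, ∫ ω, ∑ m', w m * w m' * e ω m m' ^ 2 ∂P
        = ∑ m, ∑ m', w m * w m' * ∫ ω, e ω m m' ^ 2 ∂P := by
          refine Finset.sum_congr rfl fun m hm => ?_
          rw [integral_finsetSum _ (hi m hm)]
          simp only [integral_const_mul]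
      _ ≤ ∑ m, ∑ m', w m * w m' * (D / n) := Finset.sum_le_sum fun m _ =>
          Finset.sum_le_sum fun m' _ => mul_le_mul_of_nonneg_left (he1 m m').2
            (mul_nonneg (hw m) (hw m'))
      _ = (∑ m, w m) * (∑ m, w m) * (D / n) := by
          rw [Finset.sum_mul_sum, Finset.sum_mul]
          exact Finset.sum_congr rfl fun m _ => by rw [Finset.sum_mul]
      _ ≤ N * N * (D / n) := by gcongr
      _ = _ := by ring
  have hQ0 : ∀ ω, 0 ≤ Q ω := fun ω => Finset.sum_nonneg fun m _ => Finset.sum_nonneg fun m' _ =>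
    mul_nonneg (mul_nonneg (hw m) (hw m')) (sq_nonneg _)
  have hA0 : ∀ f ω, 0 ≤ A f ω := fun f ω => Finset.sum_nonneg fun m _ =>
    mul_nonneg (hw m) (sq_nonneg _)
  have i1 : Integrable (fun ω => Q ω / N ^ 2) P := hQint.1.div_const _
  have i2 : Integrable (fun ω => A xb ω / N) P := (hAint xb hxb1).1.div_const _
  have i3 : Integrable (fun ω => A s ω / N) P := (hAint s hs1).1.div_const _
  have i4 : Integrable (fun ω => A s' ω / N) P := (hAint s' hs'1).1.div_const _
  -- Since the weights sum to at most `N`, each of the four summands has expectation at most `D / n`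
  -- after this scaling; hence the factor `4` in the bound.
  refine ⟨fun ω => Q ω / N ^ 2 + A xb ω / N + A s ω / N + A s' ω / N, fun ω => ?_,
    ((i1.add i2).add i3).add i4, ?_, fun ω => ?_⟩
  · have := hQ0 ω; have := hA0 xb ω; have := hA0 s ω; have := hA0 s' ω
    positivity
  · have j3 : Integrable (fun ω => Q ω / N ^ 2 + A xb ω / N + A s ω / N) P := (i1.add i2).add i3
    have j2 : Integrable (fun ω => Q ω / N ^ 2 + A xb ω / N) P := i1.add i2
    rw [integral_add j3 i4, integral_add j2 i3, integral_add i1 i2, integral_div, integral_div,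
      integral_div, integral_div]
    have k1 : (∫ ω, Q ω ∂P) / N ^ 2 ≤ D / n := by
      rw [div_le_iff₀ (by positivity), mul_comm]; exact hQint.2
    have k2 : (∫ ω, A xb ω ∂P) / N ≤ D / n := by
      rw [div_le_iff₀ hN, mul_comm]; exact (hAint xb hxb1).2
    have k3 : (∫ ω, A s ω ∂P) / N ≤ D / n := by
      rw [div_le_iff₀ hN, mul_comm]; exact (hAint s hs1).2
    have k4 : (∫ ω, A s' ω ∂P) / N ≤ D / n := by
      rw [div_le_iff₀ hN, mul_comm]; exact (hAint s' hs'1).2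
    rw [mul_div_assoc]; linarith
  · have := sampleError_le hkn hn hV hw hN (x := fun t => x t ω) (y := fun t => y t ω)
      (ybar := ybar ω) (fun t => hy t ω) (hybar ω) σ
    exact this

end SampleError

/-! ### Second moments of the observed series -/

section LinearCovariance

variable {Ω : Type*} [MeasurableSpace Ω] {P : Measure Ω} [IsProbabilityMeasure P]
  {ι κ : Type*} [Fintype ι] [Fintype κ]

lemma covariance_linear {X : ι → Ω → ℝ} {Y : κ → Ω → ℝ} (hX : ∀ i, MemLp (X i) 2 P)
    (hY : ∀ j, MemLp (Y j) 2 P) (A : ι → ℝ) (B : κ → ℝ) :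
    cov[fun ω => ∑ i, A i * X i ω, fun ω => ∑ j, B j * Y j ω; P]
      = ∑ i, ∑ j, A i * B j * cov[X i, Y j; P] := by
  rw [covariance_fun_sum_fun_sum (fun i => (hX i).const_mul _) fun j => (hY j).const_mul _]
  refine Finset.sum_congr rfl fun i _ => Finset.sum_congr rfl fun j _ => ?_
  rw [covariance_const_mul_left, covariance_const_mul_right]; ring

end LinearCovariance

/-- The Gram matrix `Aᵀ A` has the rank of `A`, hence is invertible, and `(Aᵀ A)⁻¹ Aᵀ` is a left
inverse. -/
lemma exists_left_inverse_of_rank {m n : Type*} [Fintype m] [Fintype n] [DecidableEq n]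
    (A : Matrix m n ℝ) (h : A.rank = Fintype.card n) : ∃ B : Matrix n m ℝ, B * A = 1 := by
  have h1 : (Aᵀ * A).rank = Fintype.card n := by rw [Matrix.rank_transpose_mul_self, h]
  have h2 : IsUnit (Aᵀ * A) := by
    rw [← Matrix.mulVec_surjective_iff_isUnit, ← Matrix.coe_mulVecLin, ← LinearMap.range_eq_top]
    refine Submodule.eq_top_of_finrank_eq ?_
    rw [Module.finrank_fintype_fun_eq_card]; exact h1
  obtain ⟨C, hC⟩ := h2.exists_left_inv
  exact ⟨C * Aᵀ, by rw [Matrix.mul_assoc, hC]⟩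

namespace Model

variable {Ω : Type*} [MeasurableSpace Ω] {P : Measure Ω} {r₁ v₁ r₂ v₂ : ℕ}

/-- The matrix of factors and noises. -/
def X (M : Model P r₁ v₁ r₂ v₂) (t : ℤ) (ω : Ω) :
    Matrix (Fin r₁ ⊕ Fin v₁) (Fin r₂ ⊕ Fin v₂) ℝ :=
  Matrix.fromBlocks (M.F t ω) (M.Z₁₂ t ω) (M.Z₂₁ t ω) (M.Z₂₂ t ω)

lemma Y_eq (M : Model P r₁ v₁ r₂ v₂) (t : ℤ) (ω : Ω) :
    M.Y t ω = Matrix.fromCols M.L₁ M.L₂ * M.X t ω * (Matrix.fromCols M.R₁ M.R₂)ᵀ := rfl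

/-- Vectorization with index order (row, column), opposite to that of `Matrix.vec`. It lets the
bounds for linear images of vectors apply to `A Z Bᵀ`. -/
lemma mul_mul_transpose_apply {m n ι κ : Type*} [Fintype ι] [Fintype κ] (A : Matrix m ι ℝ)
    (Z : Matrix ι κ ℝ) (B : Matrix n κ ℝ) (a : m) (i : n) :
    (A * Z * Bᵀ) a i = ∑ x : ι × κ, (A ⊗ₖ B) (a, i) x * Z x.1 x.2 := by
  rw [Matrix.mul_apply, Fintype.sum_prod_type, Finset.sum_comm]
  refine Finset.sum_congr rfl fun l _ => ?_
  rw [Matrix.mul_apply, Finset.sum_mul]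
  refine Finset.sum_congr rfl fun m _ => ?_
  simp only [Matrix.transpose_apply, Matrix.kroneckerMap_apply]; ring

lemma X_eq_F_or_noise (M : Model P r₁ v₁ r₂ v₂) (m : Fin r₁ ⊕ Fin v₁) (l : Fin r₂ ⊕ Fin v₂) :
    (∃ i j, m = Sum.inl i ∧ l = Sum.inl j ∧ ∀ t ω, M.X t ω m l = M.F t ω i j) ∨
    (∃ x, (∀ t ω, M.X t ω m l = M.z t ω x)) := by
  rcases m with m | m <;> rcases l with l | l
  · exact Or.inl ⟨m, l, rfl, rfl, fun _ _ => rfl⟩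
  · exact Or.inr ⟨Sum.inl (m, l), fun _ _ => rfl⟩
  · exact Or.inr ⟨Sum.inr (Sum.inl (m, l)), fun _ _ => rfl⟩
  · exact Or.inr ⟨Sum.inr (Sum.inr (m, l)), fun _ _ => rfl⟩

lemma X_measurable (M : Model P r₁ v₁ r₂ v₂) (t m l) : Measurable fun ω => M.X t ω m l := by
  rcases M.X_eq_F_or_noise m l with ⟨i, j, -, -, h⟩ | ⟨x, h⟩ <;> simp only [h]
  · exact M.F_meas t i j
  · exact M.Z_meas t x

lemma X_memLp (M : Model P r₁ v₁ r₂ v₂) (t m l) : MemLp (fun ω => M.X t ω m l) 2 P := by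
  rcases M.X_eq_F_or_noise m l with ⟨i, j, -, -, h⟩ | ⟨x, h⟩ <;> simp only [h]
  · exact M.F_sq t i j
  · exact M.Z_sq t x

lemma X_mean (M : Model P r₁ v₁ r₂ v₂) (t m l) : ∫ ω, M.X t ω m l ∂P = 0 := by
  rcases M.X_eq_F_or_noise m l with ⟨i, j, -, -, h⟩ | ⟨x, h⟩ <;> simp only [h]
  · exact M.F_mean t i j
  · exact M.Z_mean t x

lemma X_cov (M : Model P r₁ v₁ r₂ v₂) (t m l m' l') :
    cov[fun ω => M.X t ω m l, fun ω => M.X t ω m' l'; P] = if m = m' ∧ l = l' then 1 else 0 := by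
  rcases m with m | m <;> rcases l with l | l <;> rcases m' with m' | m' <;> rcases l' with l' | l'
  · exact (M.F_cov t m l m' l').trans (by simp)
  · exact (M.FZ_uncorr t t m l (Sum.inl (m', l'))).trans (by simp)
  · exact (M.FZ_uncorr t t m l (Sum.inr (Sum.inl (m', l')))).trans (by simp)
  · exact (M.FZ_uncorr t t m l (Sum.inr (Sum.inr (m', l')))).trans (by simp)
  · rw [covariance_comm]; exact (M.FZ_uncorr t t m' l' (Sum.inl (m, l))).trans (by simp)
  · exact (M.Z_cov t (Sum.inl (m, l)) (Sum.inl (m', l'))).trans (by simp)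
  · exact (M.Z_cov t (Sum.inl (m, l)) (Sum.inr (Sum.inl (m', l')))).trans (by simp)
  · exact (M.Z_cov t (Sum.inl (m, l)) (Sum.inr (Sum.inr (m', l')))).trans (by simp)
  · rw [covariance_comm]; exact (M.FZ_uncorr t t m' l' (Sum.inr (Sum.inl (m, l)))).trans (by simp)
  · exact (M.Z_cov t (Sum.inr (Sum.inl (m, l))) (Sum.inl (m', l'))).trans (by simp)
  · exact (M.Z_cov t (Sum.inr (Sum.inl (m, l))) (Sum.inr (Sum.inl (m', l')))).trans (by simp)
  · exact (M.Z_cov t (Sum.inr (Sum.inl (m, l))) (Sum.inr (Sum.inr (m', l')))).trans (by simp)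
  · rw [covariance_comm]; exact (M.FZ_uncorr t t m' l' (Sum.inr (Sum.inr (m, l)))).trans (by simp)
  · exact (M.Z_cov t (Sum.inr (Sum.inr (m, l))) (Sum.inl (m', l'))).trans (by simp)
  · exact (M.Z_cov t (Sum.inr (Sum.inr (m, l))) (Sum.inr (Sum.inl (m', l')))).trans (by simp)
  · exact (M.Z_cov t (Sum.inr (Sum.inr (m, l))) (Sum.inr (Sum.inr (m', l')))).trans (by simp)

lemma X_cov_lag_left (M : Model P r₁ v₁ r₂ v₂) {t s : ℤ} (hts : t ≠ s) (m l m' l')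
    (h : m.isRight ∨ l.isRight) : cov[fun ω => M.X t ω m l, fun ω => M.X s ω m' l'; P] = 0 := by
  rcases M.X_eq_F_or_noise m l with ⟨i, j, rfl, rfl, -⟩ | ⟨x, hx⟩
  · simp at h
  · rcases M.X_eq_F_or_noise m' l' with ⟨i', j', -, -, hx'⟩ | ⟨x', hx'⟩ <;> simp only [hx, hx']
    · rw [covariance_comm]; exact M.FZ_uncorr s t i' j' x
    · exact M.Z_white t s hts x x'

lemma X_cov_lag_right (M : Model P r₁ v₁ r₂ v₂) {t s : ℤ} (hts : t ≠ s) (m l m' l')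
    (h : m'.isRight ∨ l'.isRight) :
    cov[fun ω => M.X t ω m l, fun ω => M.X s ω m' l'; P] = 0 := by
  rw [covariance_comm]; exact M.X_cov_lag_left hts.symm _ _ _ _ h

lemma Y_apply (M : Model P r₁ v₁ r₂ v₂) (t ω a i) :
    M.Y t ω a i = ∑ x : (Fin r₁ ⊕ Fin v₁) × (Fin r₂ ⊕ Fin v₂),
      (Matrix.fromCols M.L₁ M.L₂ ⊗ₖ Matrix.fromCols M.R₁ M.R₂) (a, i) x * M.X t ω x.1 x.2 := by
  rw [Y_eq, mul_mul_transpose_apply]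

lemma Y_measurable (M : Model P r₁ v₁ r₂ v₂) (t a i) : Measurable fun ω => M.Y t ω a i := by
  simp only [Y_apply]
  exact Finset.measurable_sum _ fun x _ => (M.X_measurable t _ _).const_mul _

lemma Y_memLp (M : Model P r₁ v₁ r₂ v₂) (t a i) : MemLp (fun ω => M.Y t ω a i) 2 P := by
  simp only [Y_apply]
  exact memLp_finsetSum _ fun x _ => (M.X_memLp t _ _).const_mul _

variable [IsProbabilityMeasure P]

lemma Y_cov (M : Model P r₁ v₁ r₂ v₂) (t s a i b j) :
    cov[fun ω => M.Y t ω a i, fun ω => M.Y s ω b j; P] =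
      ∑ x : (Fin r₁ ⊕ Fin v₁) × (Fin r₂ ⊕ Fin v₂), ∑ y : (Fin r₁ ⊕ Fin v₁) × (Fin r₂ ⊕ Fin v₂),
      (Matrix.fromCols M.L₁ M.L₂ ⊗ₖ Matrix.fromCols M.R₁ M.R₂) (a, i) x *
      (Matrix.fromCols M.L₁ M.L₂ ⊗ₖ Matrix.fromCols M.R₁ M.R₂) (b, j) y *
      cov[fun ω => M.X t ω x.1 x.2, fun ω => M.X s ω y.1 y.2; P] := by
  simp only [Y_apply]
  exact covariance_linear (fun x : (Fin r₁ ⊕ Fin v₁) × (Fin r₂ ⊕ Fin v₂) => M.X_memLp t x.1 x.2)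
    (fun x : (Fin r₁ ⊕ Fin v₁) × (Fin r₂ ⊕ Fin v₂) => M.X_memLp s x.1 x.2) _ _

/-- `Cov(vec Y_t) = (R R') ⊗ (L L')`. -/
lemma Y_cov_zero (M : Model P r₁ v₁ r₂ v₂) (t a i b j) :
    cov[fun ω => M.Y t ω a i, fun ω => M.Y t ω b j; P] =
      (M.L₁ * M.L₁ᵀ + M.L₂ * M.L₂ᵀ) a b * (M.R₁ * M.R₁ᵀ + M.R₂ * M.R₂ᵀ) i j := by
  rw [Y_cov]
  have e : ∀ x y : (Fin r₁ ⊕ Fin v₁) × (Fin r₂ ⊕ Fin v₂),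
      (if x.1 = y.1 ∧ x.2 = y.2 then (1 : ℝ) else 0) = if x = y then 1 else 0 := fun x y => by
    simp [Prod.ext_iff]
  simp only [X_cov, e, mul_ite, mul_one, mul_zero, Finset.sum_ite_eq, Finset.mem_univ, if_true]
  rw [← Matrix.fromCols_mul_fromRows, ← Matrix.fromCols_mul_fromRows,
    ← Matrix.transpose_fromCols, ← Matrix.transpose_fromCols, Matrix.mul_apply, Matrix.mul_apply,
    Finset.sum_mul_sum, Fintype.sum_prod_type]
  refine Finset.sum_congr rfl fun m _ => Finset.sum_congr rfl fun l _ => ?_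
  simp only [Matrix.kroneckerMap_apply, Matrix.transpose_apply]; ring

/-- The autocovariances of `Y_t` come from the factors only. -/
lemma Y_cov_lag (M : Model P r₁ v₁ r₂ v₂) {t s : ℤ} (hts : t ≠ s) (a i b j) :
    cov[fun ω => M.Y t ω a i, fun ω => M.Y s ω b j; P] =
      ∑ x : Fin r₁ × Fin r₂, ∑ y : Fin r₁ × Fin r₂, (M.L₁ ⊗ₖ M.R₁) (a, i) x *
        (M.L₁ ⊗ₖ M.R₁) (b, j) y * cov[fun ω => M.F t ω x.1 x.2, fun ω => M.F s ω y.1 y.2; P] := by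
  rw [Y_cov]
  simp only [Fintype.sum_prod_type, Fintype.sum_sum_type]
  simp only [M.X_cov_lag_left hts _ (Sum.inr _) _ _ (Or.inr rfl),
    M.X_cov_lag_left hts (Sum.inr _) _ _ _ (Or.inl rfl),
    M.X_cov_lag_right hts _ _ _ (Sum.inr _) (Or.inr rfl),
    M.X_cov_lag_right hts _ _ (Sum.inr _) _ (Or.inl rfl), mul_zero, Finset.sum_const_zero, add_zero]
  rfl

end Model

/-! ### Factors and noises in the coordinates of the singular value decompositions -/

/-- The loading matrix `(L₁, A₂ diag(d))`. -/
def Decomposition.loading {p r v : ℕ} {L₁ : Matrix (Fin p) (Fin r) ℝ}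
    {L₂ : Matrix (Fin p) (Fin v) ℝ} (D : Decomposition L₁ L₂) : Matrix (Fin p) (Fin r ⊕ Fin v) ℝ :=
  Matrix.fromCols L₁ (D.A₂ * Matrix.diagonal D.d)

/-- The orthogonal matrix `diag(I, U₂)`. -/
def Decomposition.rotation {p r v : ℕ} {L₁ : Matrix (Fin p) (Fin r) ℝ}
    {L₂ : Matrix (Fin p) (Fin v) ℝ} (D : Decomposition L₁ L₂) :
    Matrix (Fin r ⊕ Fin v) (Fin r ⊕ Fin v) ℝ :=
  Matrix.fromBlocks 1 0 0 D.U₂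

namespace Decomposition

variable {p r v : ℕ} {L₁ : Matrix (Fin p) (Fin r) ℝ} {L₂ : Matrix (Fin p) (Fin v) ℝ}

lemma loading_mul_rotation (D : Decomposition L₁ L₂) :
    D.loading * D.rotationᵀ = Matrix.fromCols L₁ L₂ := by
  rw [loading, rotation, Matrix.fromBlocks_transpose, Matrix.fromCols_mul_fromBlocks]
  simp [← D.L₂_eq]

/-- Weights that bound the Gram matrix of `loading`. -/
def weight (D : Decomposition L₁ L₂) (U : ℝ) : Fin r ⊕ Fin v → ℝ :=
  Sum.elim (fun _ => 2 * U) fun j => 2 * D.d j ^ 2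

lemma weight_nonneg (D : Decomposition L₁ L₂) {U : ℝ} (hU : 0 ≤ U) (m) : 0 ≤ D.weight U m := by
  rcases m with m | m <;> simp only [weight, Sum.elim_inl, Sum.elim_inr] <;> positivity

/-- The squared sum of the two parts is at most twice the sum of squares, which explains the factors
`2` in the weights. The second part is exact because `A₂` is an isometry. -/
lemma colBound_loading (D : Decomposition L₁ L₂) {U : ℝ} (hU : SqNormLe L₁ U) :
    ColBound D.loading (D.weight U) := by
  intro u
  have h1 := hU (u ∘ Sum.inl)
  have h2 : ((D.A₂ * Matrix.diagonal D.d) *ᵥ (u ∘ Sum.inr)) ⬝ᵥ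
      ((D.A₂ * Matrix.diagonal D.d) *ᵥ (u ∘ Sum.inr)) = ∑ j, D.d j ^ 2 * u (Sum.inr j) ^ 2 := by
    rw [← Matrix.mulVec_mulVec, D.A₂_orth.dotProduct_mulVec, dotProduct_self_eq_sum_sq]
    simp [Matrix.mulVec_diagonal, mul_pow]
  have h3 : ∀ a, ∑ m, D.loading a m * u m = (L₁ *ᵥ (u ∘ Sum.inl)) a
      + ((D.A₂ * Matrix.diagonal D.d) *ᵥ (u ∘ Sum.inr)) a := by
    intro a
    rw [Fintype.sum_sum_type]; rfl
  simp only [h3, Fintype.sum_sum_type, weight, Sum.elim_inl, Sum.elim_inr]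
  rw [dotProduct_self_eq_sum_sq, dotProduct_self_eq_sum_sq] at h1
  rw [dotProduct_self_eq_sum_sq] at h2
  have h4 : ∀ a, ((L₁ *ᵥ (u ∘ Sum.inl)) a + ((D.A₂ * Matrix.diagonal D.d) *ᵥ (u ∘ Sum.inr)) a) ^ 2
      ≤ 2 * (L₁ *ᵥ (u ∘ Sum.inl)) a ^ 2
        + 2 * ((D.A₂ * Matrix.diagonal D.d) *ᵥ (u ∘ Sum.inr)) a ^ 2 := fun a => by
    nlinarith [sq_nonneg ((L₁ *ᵥ (u ∘ Sum.inl)) a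
      - ((D.A₂ * Matrix.diagonal D.d) *ᵥ (u ∘ Sum.inr)) a)]
  refine (Finset.sum_le_sum fun a _ => h4 a).trans ?_
  rw [Finset.sum_add_distrib, ← Finset.mul_sum, ← Finset.mul_sum, h2]
  simp only [mul_assoc, ← Finset.mul_sum]
  simp only [Function.comp_apply] at h1
  linarith

end Decomposition

namespace Model

variable {Ω : Type*} [MeasurableSpace Ω] {P : Measure Ω} {r₁ v₁ r₂ v₂ : ℕ}

/-- Factors and noises in rotated coordinates. -/
def rot (M : Model P r₁ v₁ r₂ v₂) (DL : Decomposition M.L₁ M.L₂) (DR : Decomposition M.R₁ M.R₂)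
    (t : ℤ) (ω : Ω) : Matrix (Fin r₁ ⊕ Fin v₁) (Fin r₂ ⊕ Fin v₂) ℝ :=
  DL.rotationᵀ * M.X t ω * DR.rotation

variable (M : Model P r₁ v₁ r₂ v₂) (DL : Decomposition M.L₁ M.L₂) (DR : Decomposition M.R₁ M.R₂)

lemma rot_eq (t ω) : M.rot DL DR t ω = Matrix.fromBlocks (M.F t ω) (M.Z₁₂ t ω * DR.U₂)
    (DL.U₂ᵀ * M.Z₂₁ t ω) (DL.U₂ᵀ * M.Z₂₂ t ω * DR.U₂) := by
  rw [rot, X, Decomposition.rotation, Decomposition.rotation, Matrix.fromBlocks_transpose,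
    Matrix.fromBlocks_multiply, Matrix.fromBlocks_multiply]
  simp

lemma Y_eq_rot (t ω) : M.Y t ω = DL.loading * M.rot DL DR t ω * DR.loadingᵀ := by
  rw [Y_eq, ← DL.loading_mul_rotation, ← DR.loading_mul_rotation, rot, Matrix.transpose_mul,
    Matrix.transpose_transpose]
  simp only [Matrix.mul_assoc]

/-- Full-rank loadings have left inverses, so the rotated entries are linear in `Y_t`. They are
therefore measurable with respect to `Y_t` and inherit second-order stationarity, which is assumed
only for the observations. -/
lemma exists_rot_eq : ∃ (A : Matrix (Fin r₁ ⊕ Fin v₁) (Fin (r₁ + v₁)) ℝ)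
    (B : Matrix (Fin r₂ ⊕ Fin v₂) (Fin (r₂ + v₂)) ℝ), ∀ t ω, M.rot DL DR t ω = A * M.Y t ω * Bᵀ := by
  obtain ⟨A, hA⟩ := exists_left_inverse_of_rank _ (M.L_full.trans (by simp))
  obtain ⟨B, hB⟩ := exists_left_inverse_of_rank _ (M.R_full.trans (by simp))
  refine ⟨DL.rotationᵀ * A, DR.rotationᵀ * B, fun t ω => ?_⟩
  have hB' : (Matrix.fromCols M.R₁ M.R₂)ᵀ * Bᵀ = 1 := by
    rw [← Matrix.transpose_mul, hB, Matrix.transpose_one]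
  calc M.rot DL DR t ω = DL.rotationᵀ * (A * Matrix.fromCols M.L₁ M.L₂) * M.X t ω
        * ((Matrix.fromCols M.R₁ M.R₂)ᵀ * Bᵀ) * DR.rotation := by
        rw [hA, hB', rot]; simp only [Matrix.mul_one]
    _ = _ := by
        rw [Y_eq, Matrix.transpose_mul, Matrix.transpose_transpose]
        simp only [Matrix.mul_assoc]

lemma ProjMomentBound.apply {a b : ℕ} {Z : Ω → Matrix (Fin a) (Fin b) ℝ} {s C : ℝ}
    (h : ProjMomentBound P Z s C) {l₁ l₂ : ℕ} {U : Matrix (Fin a) (Fin l₁) ℝ}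
    {V : Matrix (Fin b) (Fin l₂) ℝ} (hU : HalfOrthonormal U) (hV : HalfOrthonormal V) (i j) :
    MomentBound P (fun ω => (Uᵀ * Z ω * V) i j) s C := by
  have := h l₁ l₂ (Pi.single (j, i) 1) U V (by simp) hU hV
  simpa [Matrix.vec] using this

/-- A rotated noise entry is a coordinate of `U' Z V` with orthogonal `U`, `V` (the identity on an
unrotated side), which is what the projected moment condition controls. Bounds for the individual
entries of `Z` would not suffice, as the rotation mixes a growing number of them. -/
lemma rot_momentBound {t : ℤ} {s K : ℝ} (hF : ∀ i j, MomentBound P (fun ω => M.F t ω i j) s K)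
    (h₂₂ : ProjMomentBound P (M.Z₂₂ t) s K) (h₁₂ : ProjMomentBound P (M.Z₁₂ t) s K)
    (h₂₁ : ProjMomentBound P (M.Z₂₁ t) s K) (m l) :
    MomentBound P (fun ω => M.rot DL DR t ω m l) s K := by
  have h1 : ∀ {n : ℕ}, HalfOrthonormal (1 : Matrix (Fin n) (Fin n) ℝ) := by
    intro n; simp [HalfOrthonormal]
  simp only [rot_eq]
  rcases m with m | m <;> rcases l with l | l
  · exact hF m l
  · simpa using ProjMomentBound.apply h₁₂ h1 DR.U₂_orth m l
  · simpa using ProjMomentBound.apply h₂₁ DL.U₂_orth h1 m l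
  · exact ProjMomentBound.apply h₂₂ DL.U₂_orth DR.U₂_orth m l

lemma rot_apply (t ω m l) : M.rot DL DR t ω m l = ∑ x : (Fin r₁ ⊕ Fin v₁) × (Fin r₂ ⊕ Fin v₂),
    (DL.rotationᵀ ⊗ₖ DR.rotationᵀ) (m, l) x * M.X t ω x.1 x.2 := by
  rw [rot, ← mul_mul_transpose_apply, Matrix.transpose_transpose]

lemma rot_memLp (t m l) : MemLp (fun ω => M.rot DL DR t ω m l) 2 P := by
  simp only [rot_apply]
  exact memLp_finsetSum _ fun x _ => (M.X_memLp t _ _).const_mul _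

lemma rot_measurable_sigmaField (t m l) :
    Measurable[sigmaField M.Y M.F {t}] fun ω => M.rot DL DR t ω m l := by
  obtain ⟨A, B, h⟩ := M.exists_rot_eq DL DR
  simp only [h, mul_mul_transpose_apply]
  exact Finset.measurable_sum _ fun x _ =>
    (measurable_entry_sigmaField (Set.mem_singleton t) _ _).const_mul _

variable [IsProbabilityMeasure P]

lemma rot_mean (t m l) : ∫ ω, M.rot DL DR t ω m l ∂P = 0 := by
  simp only [rot_apply]
  rw [integral_finsetSum _ fun x _ => ((M.X_memLp t _ _).integrable one_le_two).const_mul _]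
  simp only [integral_const_mul, X_mean, mul_zero, Finset.sum_const_zero]

lemma rot_cov_stationary (k : ℕ) (t m l m' l') :
    cov[fun ω => M.rot DL DR t ω m l, fun ω => M.rot DL DR (t - k) ω m' l'; P]
      = cov[fun ω => M.rot DL DR 0 ω m l, fun ω => M.rot DL DR (-(k : ℤ)) ω m' l'; P] := by
  obtain ⟨A, B, h⟩ := M.exists_rot_eq DL DR
  simp only [h, mul_mul_transpose_apply]
  have e : ∀ t s : ℤ, _ := fun t s => covariance_linear
    (fun x : Fin (r₁ + v₁) × Fin (r₂ + v₂) => M.Y_memLp t x.1 x.2)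
    (fun x : Fin (r₁ + v₁) × Fin (r₂ + v₂) => M.Y_memLp s x.1 x.2) ((A ⊗ₖ B) (m, l))
      ((A ⊗ₖ B) (m', l'))
  rw [e, e]
  refine Finset.sum_congr rfl fun x _ => Finset.sum_congr rfl fun y _ => ?_
  have := M.Y_stationary 0 (-(k : ℤ)) t x.1 x.2 y.1 y.2
  rw [zero_add, neg_add_eq_sub] at this
  congr 1

end Model

/-! ### Errors of the sample autocovariances -/

/-- The squared error of the sample autocovariances at lag `k`. -/
def lagErr {Ω : Type*} [MeasurableSpace Ω] {p q : ℕ} (P : Measure Ω)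
    (X : ℤ → Ω → Matrix (Fin p) (Fin q) ℝ) (n k : ℕ) (ω : Ω) : ℝ :=
  ∑ i, ∑ j, frob (sampleLagCov n (fun t => X t ω) k i j - lagCov P X k i j)

lemma lagErr_nonneg {Ω : Type*} [MeasurableSpace Ω] {p q : ℕ} (P : Measure Ω)
    (X : ℤ → Ω → Matrix (Fin p) (Fin q) ℝ) (n k : ℕ) (ω : Ω) : 0 ≤ lagErr P X n k ω :=
  Finset.sum_nonneg fun _ _ => Finset.sum_nonneg fun _ _ => frob_nonneg _

lemma lagErr_eq {Ω : Type*} [MeasurableSpace Ω] {p q : ℕ} (P : Measure Ω)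
    (X : ℤ → Ω → Matrix (Fin p) (Fin q) ℝ) (n k : ℕ) (ω : Ω) :
    lagErr P X n k ω = ∑ x : Fin p × Fin q, ∑ y : Fin p × Fin q,
      (sampleLagCov n (fun t => X t ω) k x.2 y.2 x.1 y.1 - lagCov P X k x.2 y.2 x.1 y.1) ^ 2 := by
  simp only [lagErr, frob, Fintype.sum_prod_type_right, Matrix.sub_apply]
  refine Finset.sum_congr rfl fun i _ => ?_
  rw [Finset.sum_comm]

/-- Transposition only permutes the pairs of entries, so one tightness statement serves both the row
and the column analysis. -/
lemma lagErr_transpose {Ω : Type*} [MeasurableSpace Ω] {p q : ℕ} (P : Measure Ω)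
    (X : ℤ → Ω → Matrix (Fin p) (Fin q) ℝ) (n k : ℕ) (ω : Ω) :
    lagErr P (fun t ω => (X t ω)ᵀ) n k ω = lagErr P X n k ω := by
  rw [lagErr_eq, lagErr_eq]
  refine Fintype.sum_equiv (Equiv.prodComm _ _) _ _ fun x => ?_
  refine Fintype.sum_equiv (Equiv.prodComm _ _) _ _ fun y => ?_
  simp [sampleLagCov, lagCov, sampleMean, Matrix.sum_apply]

lemma exists_lagErr_bound_of_linear {Ω : Type*} [MeasurableSpace Ω] {P : Measure Ω}
    [IsProbabilityMeasure P] {p q c d : ℕ} {Y : ℤ → Ω → Matrix (Fin p) (Fin q) ℝ}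
    {F : ℤ → Ω → Matrix (Fin c) (Fin d) ℝ} {μ : Type*} [Fintype μ]
    (hY : ∀ t i j, Measurable fun ω => Y t ω i j)
    (hF : ∀ t i j, Measurable fun ω => F t ω i j) {γ K S : ℝ} (hγ : 2 < γ) (hK : 1 ≤ K)
    (hα : Summable fun j : ℕ => mixingCoeff P Y F (j + 1) ^ (1 - 2 / γ))
    (hS : ∑' j : ℕ, mixingCoeff P Y F (j + 1) ^ (1 - 2 / γ) ≤ S)
    {x : ℤ → Ω → μ → ℝ} (hx : ∀ t m, Measurable[sigmaField Y F {t}] fun ω => x t ω m)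
    (hx2 : ∀ t m, MemLp (fun ω => x t ω m) 2 P)
    (hxK : ∀ t m, MomentBound P (fun ω => x t ω m) (2 * γ) K)
    (hx0 : ∀ t m, ∫ ω, x t ω m ∂P = 0)
    {k n : ℕ} (hkn : k ≤ n) (hn : 0 < n)
    (hcov : ∀ t m m', cov[fun ω => x t ω m, fun ω => x (t - k) ω m'; P]
      = cov[fun ω => x 0 ω m, fun ω => x (-(k : ℤ)) ω m'; P])
    {V : Matrix (Fin p × Fin q) μ ℝ} {w : μ → ℝ} (hV : ColBound V w) (hw : ∀ m, 0 ≤ w m) {N : ℝ}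
    (hN : 0 < N) (hwN : ∑ m, w m ≤ N)
    (hy : ∀ t ω a, Y t ω a.1 a.2 = ∑ m, V a m * x t ω m) :
    ∃ T : Ω → ℝ, (∀ ω, 0 ≤ T ω) ∧ Integrable T P ∧
      ∫ ω, T ω ∂P ≤ 4 * (2 * ((4 + 6 * K + K ^ 2) * (k + 1 + S)) + k ^ 2 * (1 + K) ^ 2) / n ∧
      ∀ ω, lagErr P Y n k ω ≤ scaledError N (T ω) := by
  have hσ : ∀ (t : ℤ) (m m' : μ), ∫ ω, x t ω m * x (t - k) ω m' ∂P
      = cov[fun ω => x 0 ω m, fun ω => x (-(k : ℤ)) ω m'; P] := by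
    intro t m m'
    rw [← hcov t, covariance_eq_sub (hx2 _ _) (hx2 _ _), hx0, zero_mul, sub_zero]
    rfl
  have hbar : ∀ ω (a : Fin p × Fin q), sampleMean n (fun t => Y t ω) a.1 a.2
      = 1 / (n : ℝ) * ∑ t ∈ Finset.Icc (1 : ℤ) n, Y t ω a.1 a.2 := fun ω a => by
    simp only [sampleMean, Matrix.smul_apply, Matrix.sum_apply, smul_eq_mul]
  obtain ⟨T, hT0, hTi, hT1, hT2⟩ := exists_sampleError_bound hY hF hγ hK hα hS hx hxK hx0 hkn hn
    hσ hV hw hN hwN (y := fun t ω a => Y t ω a.1 a.2) hy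
    (ybar := fun ω a => sampleMean n (fun t => Y t ω) a.1 a.2) hbar
  refine ⟨T, hT0, hTi, hT1, fun ω => ?_⟩
  refine le_trans (le_of_eq ?_) (hT2 ω)
  rw [lagErr_eq]
  refine Finset.sum_congr rfl fun a _ => Finset.sum_congr rfl fun b _ => ?_
  have : lagCov P Y k a.2 b.2 a.1 b.1 = ∑ m, ∑ m', V a m * V b m' *
      cov[fun ω => x 0 ω m, fun ω => x (-(k : ℤ)) ω m'; P] := by
    rw [← covariance_linear (hx2 0) (hx2 (-(k : ℤ)))]
    simp only [← hy]
    rfl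
  rw [this]
  simp only [sampleLagCov, Matrix.of_apply]

/-- The coordinates are the rotated entries and the loading is the Kronecker product of the two
loadings. The weights are products, so their sum factorizes over the two sides. -/
lemma Model.exists_lagErr_bound {Ω : Type*} [MeasurableSpace Ω] {P : Measure Ω}
    [IsProbabilityMeasure P] {r₁ v₁ r₂ v₂ : ℕ}
    (M : Model P r₁ v₁ r₂ v₂) (DL : Decomposition M.L₁ M.L₂) (DR : Decomposition M.R₁ M.R₂)
    {γ K S : ℝ} (hγ : 2 < γ) (hK : 1 ≤ K)
    (hα : Summable fun j : ℕ => mixingCoeff P M.Y M.F (j + 1) ^ (1 - 2 / γ))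
    (hS : ∑' j : ℕ, mixingCoeff P M.Y M.F (j + 1) ^ (1 - 2 / γ) ≤ S)
    (hmom : ∀ t m l, MomentBound P (fun ω => M.rot DL DR t ω m l) (2 * γ) K)
    {U U' N : ℝ} (hU0 : 0 ≤ U) (hU0' : 0 ≤ U') (hU : SqNormLe M.L₁ U) (hU' : SqNormLe M.R₁ U')
    (hN : 0 < N) (hwN : (∑ m, DL.weight U m) * (∑ m, DR.weight U' m) ≤ N)
    {k n : ℕ} (hkn : k ≤ n) (hn : 0 < n) :
    ∃ T : Ω → ℝ, (∀ ω, 0 ≤ T ω) ∧ Integrable T P ∧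
      ∫ ω, T ω ∂P ≤ 4 * (2 * ((4 + 6 * K + K ^ 2) * (k + 1 + S)) + k ^ 2 * (1 + K) ^ 2) / n ∧
      ∀ ω, lagErr P M.Y n k ω ≤ scaledError N (T ω) := by
  have hV := (DL.colBound_loading hU).kronecker (DR.colBound_loading hU') (DR.weight_nonneg hU0')
  have hy : ∀ t ω (x : Fin (r₁ + v₁) × Fin (r₂ + v₂)), M.Y t ω x.1 x.2 =
      ∑ m, (DL.loading ⊗ₖ DR.loading) x m * M.rot DL DR t ω m.1 m.2 := by
    intro t ω x
    rw [M.Y_eq_rot DL DR, mul_mul_transpose_apply]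
  have hw : ∑ m : (Fin r₁ ⊕ Fin v₁) × (Fin r₂ ⊕ Fin v₂), DL.weight U m.1 * DR.weight U' m.2 ≤ N := by
    rwa [Fintype.sum_prod_type, ← Finset.sum_mul_sum]
  have hmeas : ∀ (t : ℤ) (m : (Fin r₁ ⊕ Fin v₁) × (Fin r₂ ⊕ Fin v₂)),
      Measurable[sigmaField M.Y M.F {t}] fun ω => M.rot DL DR t ω m.1 m.2 :=
    fun t m => M.rot_measurable_sigmaField DL DR t _ _
  have hw0 : ∀ m : (Fin r₁ ⊕ Fin v₁) × (Fin r₂ ⊕ Fin v₂), 0 ≤ DL.weight U m.1 * DR.weight U' m.2 :=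
    fun m => mul_nonneg (DL.weight_nonneg hU0 _) (DR.weight_nonneg hU0' _)
  exact exists_lagErr_bound_of_linear M.Y_measurable M.F_meas hγ hK hα hS hmeas
    (fun t m => M.rot_memLp DL DR t m.1 m.2) (fun t m => hmom t m.1 m.2)
    (fun t m => M.rot_mean DL DR t m.1 m.2) hkn hn
    (fun t m m' => M.rot_cov_stationary DL DR k t m.1 m.2 m'.1 m'.2) hV hw0 hN hw hy

/-! ### Bounds for the loadings -/

section Loadings

variable {p r v k : ℕ} {L₁ : Matrix (Fin p) (Fin r) ℝ} {L₂ : Matrix (Fin p) (Fin v) ℝ}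

/-- Bounds for a pair of loadings: the squared singular values of `L₁` are of order `s₁`, the first
`k` squared singular values of `L₂` are of order `s₂`, the others are bounded, and the first `k`
left singular vectors of `L₂` are separated from the column space of `L₁`. -/
structure LoadingBounds (D : Decomposition L₁ L₂) (k : ℕ) (c C c₃ s₁ s₂ : ℝ) : Prop where
  c_pos : 0 < c
  one_le_C : 1 ≤ C
  c₃_pos : 0 < c₃
  s₁_pos : 0 < s₁
  one_le_s₂ : 1 ≤ s₂
  lower : SqNormGe L₁ (c * s₁)
  upper : SqNormLe L₁ (C * s₁)
  d_lower : ∀ j : Fin v, j.val < k → c * s₂ ≤ D.d j ^ 2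
  d_upper : ∀ j : Fin v, j.val < k → D.d j ^ 2 ≤ C * s₂
  d_upper' : ∀ j : Fin v, k ≤ j.val → D.d j ^ 2 ≤ C
  sep : WellProjected (D.starBasis k) D.A₁ c₃

namespace Decomposition

variable (D : Decomposition L₁ L₂)

lemma L₂_mul_transpose :
    L₂ * L₂ᵀ = D.A₂ * Matrix.diagonal (fun j => D.d j ^ 2) * D.A₂ᵀ := by
  have h : L₂ * L₂ᵀ = D.A₂ * Matrix.diagonal D.d * D.U₂ᵀ * (D.A₂ * Matrix.diagonal D.d * D.U₂ᵀ)ᵀ :=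
    congrArg (fun A => A * Aᵀ) D.L₂_eq
  rw [h, Matrix.transpose_mul, Matrix.transpose_mul, Matrix.transpose_transpose,
    Matrix.diagonal_transpose]
  have e : Matrix.diagonal (fun j => D.d j ^ 2) = Matrix.diagonal D.d * Matrix.diagonal D.d := by
    rw [Matrix.diagonal_mul_diagonal]; simp [sq]
  rw [e]
  calc D.A₂ * Matrix.diagonal D.d * D.U₂ᵀ * (D.U₂ * (Matrix.diagonal D.d * D.A₂ᵀ))
      = D.A₂ * Matrix.diagonal D.d * (D.U₂ᵀ * D.U₂) * Matrix.diagonal D.d * D.A₂ᵀ := by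
        simp only [Matrix.mul_assoc]
    _ = _ := by
        rw [show D.U₂ᵀ * D.U₂ = 1 from D.U₂_orth]; simp only [Matrix.mul_assoc, Matrix.mul_one]

lemma L₂_mul_transpose_mulVec (x : Fin p → ℝ) :
    (L₂ * L₂ᵀ) *ᵥ x = D.A₂ *ᵥ fun j => D.d j ^ 2 * (D.A₂ᵀ *ᵥ x) j := by
  rw [D.L₂_mul_transpose, ← Matrix.mulVec_mulVec, ← Matrix.mulVec_mulVec]
  congr 1
  ext j
  simp [Matrix.mulVec_diagonal]

lemma proj_add_A (hp : p = r + v) : D.A₁ * D.A₁ᵀ + D.B₁ * D.B₁ᵀ = 1 :=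
  D.A₁_orth.proj_add_eq_one D.B₁_orth D.B₁_compl (by simp [hp])

lemma proj_add_B (hp : p = r + v) : D.A₂ * D.A₂ᵀ + D.B₂ * D.B₂ᵀ = 1 :=
  D.A₂_orth.proj_add_eq_one D.B₂_orth D.B₂_compl (by simp [hp]; omega)

end Decomposition

/-- Pythagoras' theorem for a complementary pair. -/
lemma dotProduct_mulVec_of_proj_add {m ι κ : Type*} [Fintype m] [Fintype ι] [Fintype κ]
    [DecidableEq m] {H : Matrix m ι ℝ} {K : Matrix m κ ℝ} (h : H * Hᵀ + K * Kᵀ = 1) (u : m → ℝ) :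
    (Hᵀ *ᵥ u) ⬝ᵥ (Hᵀ *ᵥ u) + (Kᵀ *ᵥ u) ⬝ᵥ (Kᵀ *ᵥ u) = u ⬝ᵥ u := by
  rw [mulVec_dotProduct_self, mulVec_dotProduct_self, Matrix.transpose_transpose,
    Matrix.transpose_transpose, ← dotProduct_add, ← Matrix.add_mulVec, h, Matrix.one_mulVec]

/-- The first `k` columns of `A₂` are complementary to `(A₂₂, B₂)`. Since `Ξᵀ` is a contraction,
separation gives every unit vector in the span of `A₁` a component of squared length at least `c₃²`
in the latter space, which leaves at most `1 - c₃²` for the former. -/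
lemma sqNormLe_firstCols_transpose_mul (D : Decomposition L₁ L₂) (hp : p = r + v) {c₃ : ℝ}
    (hsep : WellProjected (D.starBasis k) D.A₁ c₃) :
    SqNormLe ((firstCols k D.A₂)ᵀ * D.A₁) (1 - c₃ ^ 2) := by
  obtain ⟨Ξ, hΞ, h⟩ := hsep
  intro w
  set u := D.A₁ *ᵥ w with hu
  have hu1 : u ⬝ᵥ u = w ⬝ᵥ w := D.A₁_orth.dotProduct_mulVec w
  have h1 : firstCols k D.A₂ * (firstCols k D.A₂)ᵀ + D.starBasis k * (D.starBasis k)ᵀ = 1 := by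
    rw [Decomposition.starBasis, Matrix.transpose_fromCols, Matrix.fromCols_mul_fromRows,
      ← add_assoc, firstCols_mul_transpose_add, D.proj_add_B hp]
  have h2 := dotProduct_mulVec_of_proj_add h1 u
  have h3 := h w
  rw [← Matrix.mulVec_mulVec, ← hu, ← Matrix.mulVec_mulVec] at h3
  have h4 := hΞ.sqNormLe_transpose ((D.starBasis k)ᵀ *ᵥ u)
  rw [← Matrix.mulVec_mulVec, ← hu]
  rw [hu1] at h2
  linarith

namespace LoadingBounds

variable {D : Decomposition L₁ L₂} {c C c₃ s₁ s₂ : ℝ}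

lemma C_pos (h : LoadingBounds D k c C c₃ s₁ s₂) : 0 < C := lt_of_lt_of_le one_pos h.one_le_C

lemma s₂_pos (h : LoadingBounds D k c C c₃ s₁ s₂) : 0 < s₂ := lt_of_lt_of_le one_pos h.one_le_s₂

lemma sqNormLe_L₁L₁ (h : LoadingBounds D k c C c₃ s₁ s₂) :
    SqNormLe (L₁ * L₁ᵀ) ((C * s₁) ^ 2) := by
  have h0 : 0 ≤ C * s₁ := (mul_pos h.C_pos h.s₁_pos).le
  rw [sq]
  exact h.upper.mul (h.upper.transpose h0) h0

lemma d_sq_le (h : LoadingBounds D k c C c₃ s₁ s₂) (j : Fin v) : D.d j ^ 2 ≤ C * s₂ := by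
  rcases lt_or_ge j.val k with hj | hj
  · exact h.d_upper j hj
  · exact (h.d_upper' j hj).trans (le_mul_of_one_le_right h.C_pos.le h.one_le_s₂)

lemma sqNormLe_L₂L₂ (h : LoadingBounds D k c C c₃ s₁ s₂) :
    SqNormLe (L₂ * L₂ᵀ) ((C * s₂) ^ 2) := by
  intro x
  rw [D.L₂_mul_transpose_mulVec, D.A₂_orth.dotProduct_mulVec, dotProduct_self_eq_sum_sq]
  have h1 := D.A₂_orth.sqNormLe_transpose x
  rw [one_mul, dotProduct_self_eq_sum_sq] at h1
  refine le_trans ?_ (mul_le_mul_of_nonneg_left h1 (sq_nonneg _))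
  rw [Finset.mul_sum]
  refine Finset.sum_le_sum fun j _ => ?_
  rw [mul_pow]
  exact mul_le_mul_of_nonneg_right (pow_le_pow_left₀ (sq_nonneg _) (h.d_sq_le j) 2) (sq_nonneg _)

lemma sum_d_pow_le (h : LoadingBounds D k c C c₃ s₁ s₂) (e : ℕ) :
    ∑ j, (D.d j ^ 2) ^ e ≤ k * (C * s₂) ^ e + v * C ^ e := by
  have hC := h.C_pos; have hs := h.s₂_pos
  have hle : ∀ j : Fin v, (D.d j ^ 2) ^ e ≤ (if j.val < k then (C * s₂) ^ e else 0) + C ^ e := by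
    intro j
    split_ifs with hj
    · exact (pow_le_pow_left₀ (sq_nonneg _) (h.d_upper j hj) e).trans
        (le_add_of_nonneg_right (by positivity))
    · rw [zero_add]
      exact pow_le_pow_left₀ (sq_nonneg _) (h.d_upper' j (not_lt.mp hj)) e
  refine (Finset.sum_le_sum fun j _ => hle j).trans ?_
  rw [Finset.sum_add_distrib, Finset.sum_const, Finset.card_univ, Fintype.card_fin, nsmul_eq_mul,
    ← Finset.sum_filter, Finset.sum_const, nsmul_eq_mul]
  gcongr
  rw [Fin.card_filter_val_lt]
  exact min_le_right _ _

lemma frob_L₂L₂_le (h : LoadingBounds D k c C c₃ s₁ s₂) :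
    frob (L₂ * L₂ᵀ) ≤ k * (C * s₂) ^ 2 + v * C ^ 2 := by
  refine le_trans ?_ (h.sum_d_pow_le 2)
  have h1 : SqNormLe D.A₂ᵀᵀ 1 := by rw [Matrix.transpose_transpose]; exact D.A₂_orth.sqNormLe
  rw [D.L₂_mul_transpose, Matrix.mul_assoc]
  refine (D.A₂_orth.sqNormLe.frob_mul_le _).trans ?_
  rw [one_mul]
  refine (h1.frob_mul_le' _).trans ?_
  rw [one_mul, frob]
  refine Finset.sum_le_sum fun j _ => ?_
  rw [Finset.sum_eq_single j]
  · simp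
  · intro i _ hi; simp [Matrix.diagonal_apply_ne _ (Ne.symm hi)]
  · simp

lemma sum_weight_le (h : LoadingBounds D k c C c₃ s₁ s₂) :
    ∑ m, D.weight (C * s₁) m ≤ 2 * r * (C * s₁) + 2 * (k * (C * s₂) + v * C) := by
  have h1 := h.sum_d_pow_le 1
  simp only [pow_one] at h1
  rw [Fintype.sum_sum_type]
  simp only [Decomposition.weight, Sum.elim_inl, Sum.elim_inr, Finset.sum_const, Finset.card_univ,
    Fintype.card_fin, nsmul_eq_mul, ← Finset.mul_sum]
  linarith

/-- Transposing the previous estimate bounds the component along `A₁` of a unit vector in the span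
of the strong directions; Pythagoras leaves at least `c₃²` for `B₁`. The projection by `B₁` thus
keeps the strong noise. -/
lemma sqNormGe_B₁_firstCols (h : LoadingBounds D k c C c₃ s₁ s₂) (hp : p = r + v) (hr : 1 ≤ r) :
    SqNormGe (D.B₁ᵀ * firstCols k D.A₂) (c₃ ^ 2) := by
  have h1 := sqNormLe_firstCols_transpose_mul D hp h.sep
  -- Nonnegativity of the constant, needed for transposing, follows by testing on one unit vector;
  -- `1 ≤ r` provides it.
  have h0 : 0 ≤ 1 - c₃ ^ 2 := by
    have := h1 (Pi.single ⟨0, hr⟩ 1)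
    have h2 := dotProduct_self_nonneg' (((firstCols k D.A₂)ᵀ * D.A₁) *ᵥ (Pi.single ⟨0, hr⟩ 1))
    simp only [dotProduct_single, Pi.single_eq_same, mul_one] at this
    linarith
  have h2 := h1.transpose h0
  rw [Matrix.transpose_mul, Matrix.transpose_transpose] at h2
  intro y
  have h3 := h2 y
  have h4 := dotProduct_mulVec_of_proj_add (D.proj_add_A hp) (firstCols k D.A₂ *ᵥ y)
  rw [(D.A₂_orth.firstCols k).dotProduct_mulVec] at h4
  rw [← Matrix.mulVec_mulVec] at h3 ⊢
  linarith

lemma L₂L₂_mul_firstCols (D : Decomposition L₁ L₂) (k : ℕ) : L₂ * L₂ᵀ * firstCols k D.A₂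
    = firstCols k D.A₂ * Matrix.diagonal fun j : {j : Fin v // j.val < k} => D.d j.1 ^ 2 := by
  rw [D.L₂_mul_transpose, Matrix.mul_assoc]
  have h1 : D.A₂ᵀ * firstCols k D.A₂ = (1 : Matrix (Fin v) (Fin v) ℝ).submatrix id Subtype.val := by
    rw [← show D.A₂ᵀ * D.A₂ = 1 from D.A₂_orth]; rfl
  rw [h1]
  ext a j
  simp only [Matrix.mul_apply, Matrix.submatrix_apply, id, Matrix.one_apply, firstCols]
  rw [Finset.sum_eq_single j.1]
  · simp [Matrix.diagonal_apply]
  · intro i _ hi; simp [hi]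
  · simp

/-- `B₁' L₂ L₂'` is bounded below on the span of the first `k` singular vectors. -/
lemma sqNormGe_B₁_L₂L₂_firstCols (h : LoadingBounds D k c C c₃ s₁ s₂) (hp : p = r + v)
    (hr : 1 ≤ r) : SqNormGe (D.B₁ᵀ * (L₂ * L₂ᵀ) * firstCols k D.A₂) ((c₃ * (c * s₂)) ^ 2) := by
  rw [Matrix.mul_assoc, L₂L₂_mul_firstCols, ← Matrix.mul_assoc, mul_pow]
  refine (h.sqNormGe_B₁_firstCols hp hr).mul ?_ (sq_nonneg _)
  intro y
  rw [dotProduct_self_eq_sum_sq, dotProduct_self_eq_sum_sq, Finset.mul_sum]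
  refine Finset.sum_le_sum fun j _ => ?_
  rw [Matrix.mulVec_diagonal, mul_pow (D.d j.1 ^ 2)]
  have := h.c_pos; have := h.s₂_pos
  exact mul_le_mul_of_nonneg_right (pow_le_pow_left₀ (by positivity) (h.d_lower j.1 j.2) 2)
    (sq_nonneg _)

lemma L₂L₂_mulVec_le (h : LoadingBounds D k c C c₃ s₁ s₂) (x : Fin p → ℝ)
    (hx : (firstCols k D.A₂)ᵀ *ᵥ x = 0) :
    ((L₂ * L₂ᵀ) *ᵥ x) ⬝ᵥ ((L₂ * L₂ᵀ) *ᵥ x) ≤ C ^ 2 * (x ⬝ᵥ x) := by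
  rw [D.L₂_mul_transpose_mulVec, D.A₂_orth.dotProduct_mulVec, dotProduct_self_eq_sum_sq]
  have h1 := D.A₂_orth.sqNormLe_transpose x
  rw [one_mul, dotProduct_self_eq_sum_sq] at h1
  refine le_trans ?_ (mul_le_mul_of_nonneg_left h1 (sq_nonneg _))
  rw [Finset.mul_sum]
  refine Finset.sum_le_sum fun j _ => ?_
  rw [mul_pow]
  rcases lt_or_ge j.val k with hj | hj
  · have : (D.A₂ᵀ *ᵥ x) j = 0 := congrFun hx ⟨j, hj⟩
    simp [this]
  · exact mul_le_mul_of_nonneg_right (pow_le_pow_left₀ (sq_nonneg _) (h.d_upper' j hj) 2)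
      (sq_nonneg _)

/-- `B₁' L L' = B₁' L₂ L₂'`. -/
lemma B₁_mul_L₁ (D : Decomposition L₁ L₂) : D.B₁ᵀ * L₁ = 0 := by
  have : D.B₁ᵀ * L₁ = D.B₁ᵀ * D.A₁ * D.W₁ := by
    rw [Matrix.mul_assoc]; exact congrArg (D.B₁ᵀ * ·) D.L₁_eq
  rw [this, D.B₁_compl, Matrix.zero_mul]

end LoadingBounds

end Loadings

/-! ### Families of matrices, side by side -/

section Stack

variable {m n κ : Type*}

/-- The matrix whose column blocks are the members of a family of matrices. -/
def stack (A : κ → Matrix m n ℝ) : Matrix m (κ × n) ℝ :=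
  Matrix.of fun a x => A x.1 a x.2

lemma stack_mul_transpose [Fintype n] [Fintype κ] (A : κ → Matrix m n ℝ) :
    stack A * (stack A)ᵀ = ∑ i, A i * (A i)ᵀ := by
  ext a b
  rw [Matrix.mul_apply, Matrix.sum_apply, Fintype.sum_prod_type]
  rfl

lemma frob_stack [Fintype m] [Fintype n] [Fintype κ] (A : κ → Matrix m n ℝ) :
    frob (stack A) = ∑ i, frob (A i) := by
  simp only [frob, stack, Matrix.of_apply, Fintype.sum_prod_type]
  rw [Finset.sum_comm]

lemma stack_sub (A B : κ → Matrix m n ℝ) : stack A - stack B = stack fun i => A i - B i := rfl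

lemma dotProduct_stack_transpose [Fintype m] [Fintype n] [Fintype κ] (A : κ → Matrix m n ℝ)
    (x : m → ℝ) :
    ((stack A)ᵀ *ᵥ x) ⬝ᵥ ((stack A)ᵀ *ᵥ x) = ∑ i, ((A i)ᵀ *ᵥ x) ⬝ᵥ ((A i)ᵀ *ᵥ x) := by
  rw [dotProduct, Fintype.sum_prod_type]
  rfl

end Stack

/-! ### The spaces of the factor loadings -/

section FactorSpace

/-- The trace lost by replacing `A Aᵀ` by `E` is `‖(1 - E) T‖² = ‖(1 - E) A (Aᵀ T)‖²`, because the
range of `T` lies in the span of `A`. This is at least `g ‖(1 - E) A‖²`, and `‖(1 - E) A‖²` is half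
the squared distance of the projections. -/
lemma gap_of_range {m ι n : Type*} [Fintype m] [Fintype ι] [Fintype n] [DecidableEq m]
    [DecidableEq ι] {A : Matrix m ι ℝ} (hA : HalfOrthonormal A) {T : Matrix m n ℝ}
    (hT : A * Aᵀ * T = T) {g : ℝ} (hg : SqNormGe (Aᵀ * T)ᵀ g) {E : Matrix m m ℝ} (hE : IsProj E)
    (htr : E.trace = Fintype.card ι) :
    g / 2 * frob (E - A * Aᵀ) ≤ (T * Tᵀ * (A * Aᵀ - E)).trace := by
  have h1 : (T * Tᵀ * (A * Aᵀ - E)).trace = frob ((1 - E) * T) := by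
    rw [← hE.one_sub.trace_mul_transpose_mul, Matrix.mul_sub, Matrix.trace_sub,
      hA.isProj.trace_mul_transpose_mul, hT, Matrix.mul_sub, Matrix.trace_sub, Matrix.mul_one,
      ← frob_eq_trace']
  have h2 : (1 - E) * T = (1 - E) * A * (Aᵀ * T) := by
    rw [← Matrix.mul_assoc, Matrix.mul_assoc (1 - E) A, Matrix.mul_assoc (1 - E), hT]
  have h3 : frob ((1 - E) * A) = frob (E - A * Aᵀ) / 2 := by
    rw [← hE.one_sub.trace_mul_transpose_mul, hE.frob_sub hA.isProj, htr, hA.trace_proj,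
      Matrix.mul_sub, Matrix.trace_sub, Matrix.mul_one, hA.trace_proj, Matrix.trace_mul_comm E]
    ring
  rw [h1, h2]
  refine le_trans (le_of_eq ?_) (hg.le_frob_mul' _)
  rw [h3]; ring

variable {p q r s : ℕ}

/-- The coefficients of the autocovariances of the columns of `L₁ F R₁'`. -/
def lagCoeff (R : Matrix (Fin q) (Fin s) ℝ) (Φ : Fin s → Fin s → Matrix (Fin r) (Fin r) ℝ)
    (i j : Fin q) : Matrix (Fin r) (Fin r) ℝ :=
  Matrix.of fun e f => ∑ c, ∑ d, R i c * R j d * Φ c d e f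

lemma lagCoeff_apply (R : Matrix (Fin q) (Fin s) ℝ)
    (Φ : Fin s → Fin s → Matrix (Fin r) (Fin r) ℝ) (i j e f) :
    lagCoeff R Φ i j e f = (R * Matrix.of (fun c d => Φ c d e f) * Rᵀ) i j := by
  simp only [lagCoeff, Matrix.of_apply, Matrix.mul_apply, Matrix.transpose_apply, Finset.sum_mul]
  rw [Finset.sum_comm]
  exact Finset.sum_congr rfl fun c _ => Finset.sum_congr rfl fun d _ => by ring

/-- With the entry `(e, f)` fixed, the array in `(i, j)` is `R Φ R'`, so exchanging the order of
summation lets the bound for `R` act once on each side. -/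
lemma sum_frob_lagCoeff_le {R : Matrix (Fin q) (Fin s) ℝ} {U : ℝ} (hR : SqNormLe R U) (hU : 0 ≤ U)
    {Φ : Fin s → Fin s → Matrix (Fin r) (Fin r) ℝ} (hΦ : ∀ c d e f, |Φ c d e f| ≤ 1) :
    ∑ i, ∑ j, frob (lagCoeff R Φ i j) ≤ U ^ 2 * (r * s) ^ 2 := by
  have e1 : ∑ i, ∑ j, frob (lagCoeff R Φ i j)
      = ∑ e, ∑ f, frob (R * Matrix.of (fun c d => Φ c d e f) * Rᵀ) := by
    simp only [frob, lagCoeff_apply]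
    calc _ = ∑ i, ∑ e, ∑ j, ∑ f, ((R * Matrix.of (fun c d => Φ c d e f) * Rᵀ) i j) ^ 2 :=
          Finset.sum_congr rfl fun i _ => Finset.sum_comm
      _ = ∑ e, ∑ i, ∑ f, ∑ j, ((R * Matrix.of (fun c d => Φ c d e f) * Rᵀ) i j) ^ 2 := by
          rw [Finset.sum_comm]
          exact Finset.sum_congr rfl fun e _ => Finset.sum_congr rfl fun i _ => Finset.sum_comm
      _ = _ := Finset.sum_congr rfl fun e _ => Finset.sum_comm
  have hR' : SqNormLe Rᵀᵀ U := by rwa [Matrix.transpose_transpose]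
  rw [e1]
  calc _ ≤ ∑ e : Fin r, ∑ f : Fin r, U ^ 2 * (s : ℝ) ^ 2 := by
        refine Finset.sum_le_sum fun e _ => Finset.sum_le_sum fun f _ => ?_
        refine (hR'.frob_mul_le' _).trans ?_
        rw [sq U, mul_assoc]
        refine mul_le_mul_of_nonneg_left ((hR.frob_mul_le _).trans
          (mul_le_mul_of_nonneg_left ?_ hU)) hU
        calc frob (Matrix.of fun c d => Φ c d e f) ≤ ∑ _c : Fin s, ∑ _d : Fin s, (1 : ℝ) :=
              Finset.sum_le_sum fun c _ => Finset.sum_le_sum fun d _ => by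
                rw [Matrix.of_apply, ← sq_abs]
                exact pow_le_one₀ (abs_nonneg _) (hΦ c d e f)
          _ = (s : ℝ) ^ 2 := by simp [sq]
    _ = _ := by simp; ring

/-- The same exchange of summations after contraction with `w`; the lower bound for `R` is used on
both sides. -/
lemma le_sum_lagCoeff {R : Matrix (Fin q) (Fin s) ℝ} {u : ℝ} (hR : SqNormGe R u) (hu : 0 ≤ u)
    (Φ : Fin s → Fin s → Matrix (Fin r) (Fin r) ℝ) (w : Fin r → ℝ) :
    u ^ 2 * ∑ c, ∑ d, ((Φ c d)ᵀ *ᵥ w) ⬝ᵥ ((Φ c d)ᵀ *ᵥ w)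
      ≤ ∑ i, ∑ j, ((lagCoeff R Φ i j)ᵀ *ᵥ w) ⬝ᵥ ((lagCoeff R Φ i j)ᵀ *ᵥ w) := by
  set Ψ : Fin r → Matrix (Fin s) (Fin s) ℝ := fun f =>
    Matrix.of fun c d => ((Φ c d)ᵀ *ᵥ w) f with hΨ
  have e1 : ∀ i j f, ((lagCoeff R Φ i j)ᵀ *ᵥ w) f = (R * Ψ f * Rᵀ) i j := by
    intro i j f
    simp only [hΨ, Matrix.mulVec, dotProduct, Matrix.transpose_apply, lagCoeff, Matrix.of_apply,
      Matrix.mul_apply, Finset.sum_mul, Finset.mul_sum]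
    calc _ = ∑ c, ∑ e, ∑ d, R i c * R j d * Φ c d e f * w e := Finset.sum_comm
      _ = ∑ c, ∑ d, ∑ e, R i c * R j d * Φ c d e f * w e :=
        Finset.sum_congr rfl fun c _ => Finset.sum_comm
      _ = ∑ d, ∑ c, ∑ e, R i c * R j d * Φ c d e f * w e := Finset.sum_comm
      _ = _ := Finset.sum_congr rfl fun d _ => Finset.sum_congr rfl fun c _ =>
        Finset.sum_congr rfl fun e _ => by ring
  have e2 : ∑ i, ∑ j, ((lagCoeff R Φ i j)ᵀ *ᵥ w) ⬝ᵥ ((lagCoeff R Φ i j)ᵀ *ᵥ w)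
      = ∑ f, frob (R * Ψ f * Rᵀ) := by
    simp only [dotProduct_self_eq_sum_sq, e1, frob]
    calc _ = ∑ i, ∑ f, ∑ j, (R * Ψ f * Rᵀ) i j ^ 2 :=
          Finset.sum_congr rfl fun i _ => Finset.sum_comm
      _ = _ := Finset.sum_comm
  have e3 : ∑ c, ∑ d, ((Φ c d)ᵀ *ᵥ w) ⬝ᵥ ((Φ c d)ᵀ *ᵥ w) = ∑ f, frob (Ψ f) := by
    simp only [dotProduct_self_eq_sum_sq, frob]
    calc _ = ∑ c, ∑ f, ∑ d, ((Φ c d)ᵀ *ᵥ w) f ^ 2 :=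
          Finset.sum_congr rfl fun i _ => Finset.sum_comm
      _ = _ := Finset.sum_comm
  have hR' : SqNormGe Rᵀᵀ u := by rwa [Matrix.transpose_transpose]
  rw [e2, e3, Finset.mul_sum]
  refine Finset.sum_le_sum fun f _ => ?_
  rw [sq, mul_assoc]
  exact (mul_le_mul_of_nonneg_left (hR.le_frob_mul _) hu).trans (hR'.le_frob_mul' _)

/-- `A₁` is an isometry, so `W₁` inherits the lower bound of `L₁`; being square, it passes the bound
to its transpose. -/
lemma sqNormGe_W₁_transpose {r v : ℕ} {L₁ : Matrix (Fin p) (Fin r) ℝ}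
    {L₂ : Matrix (Fin p) (Fin v) ℝ} (D : Decomposition L₁ L₂) {l : ℝ} (hl : 0 < l)
    (h : SqNormGe L₁ l) : SqNormGe D.W₁ᵀ l := by
  refine SqNormGe.transpose_of_square (fun x => ?_) hl
  have e : (L₁ *ᵥ x) ⬝ᵥ (L₁ *ᵥ x) = (D.W₁ *ᵥ x) ⬝ᵥ (D.W₁ *ᵥ x) := by
    have : L₁ *ᵥ x = D.A₁ *ᵥ (D.W₁ *ᵥ x) := by
      rw [Matrix.mulVec_mulVec]; exact congrArg (· *ᵥ x) D.L₁_eq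
    rw [this, D.A₁_orth.dotProduct_mulVec]
  rw [← e]; exact h x

/-- The error of the estimated factor loading space, in terms of the errors of the sample
autocovariances. -/
lemma frob_factorSpace_le {v : ℕ} {L₁ : Matrix (Fin p) (Fin r) ℝ}
    {L₂ : Matrix (Fin p) (Fin v) ℝ} (D : Decomposition L₁ L₂) {R : Matrix (Fin q) (Fin s) ℝ}
    {l U u U' c₀ : ℝ} (hl : 0 < l) (hL : SqNormGe L₁ l) (hU : 0 < U) (hL' : SqNormLe L₁ U)
    (hu : 0 < u) (hR : SqNormGe R u) (hU' : 0 < U') (hR' : SqNormLe R U') (hc₀ : 0 < c₀)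
    (hr : 1 ≤ r) (hs : 1 ≤ s) (hrp : r ≤ p) {ι : Type*} [Fintype ι] [Nonempty ι]
    {Γ Γ' : ι → Fin q → Fin q → Matrix (Fin p) (Fin p) ℝ}
    {Φ : ι → Fin s → Fin s → Matrix (Fin r) (Fin r) ℝ}
    (hΓ : ∀ k i j, Γ k i j = L₁ * lagCoeff R (Φ k) i j * L₁ᵀ)
    (hΦ : ∀ k c d e f, |Φ k c d e f| ≤ 1)
    (hdyn : ∀ w : Fin r → ℝ, c₀ * (w ⬝ᵥ w) ≤
      w ⬝ᵥ ((∑ k, ∑ c, ∑ d, Φ k c d * (Φ k c d)ᵀ) *ᵥ w))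
    {H : Matrix (Fin p) (Fin p) ℝ}
    (hH : IsOrderedEigenbasis (∑ k, ∑ i, ∑ j, Γ' k i j * (Γ' k i j)ᵀ) H) :
    c₀ * l ^ 2 * u ^ 2 * frob (firstCols r H * (firstCols r H)ᵀ - D.A₁ * D.A₁ᵀ) ≤
      (22 * (Fintype.card ι * (U * U' * (r * s)) ^ 2 / (c₀ * l ^ 2 * u ^ 2)) + 3) *
        ∑ k, ∑ i, ∑ j, frob (Γ' k i j - Γ k i j) := by
  set T := stack fun x : ι × Fin q × Fin q => Γ x.1 x.2.1 x.2.2 with hT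
  set T' := stack fun x : ι × Fin q × Fin q => Γ' x.1 x.2.1 x.2.2 with hT'
  have hTT' : T' * T'ᵀ = ∑ k, ∑ i, ∑ j, Γ' k i j * (Γ' k i j)ᵀ := by
    rw [hT', stack_mul_transpose]; simp only [Fintype.sum_prod_type]
  have hsub : frob (T' - T) = ∑ k, ∑ i, ∑ j, frob (Γ' k i j - Γ k i j) := by
    rw [hT, hT', stack_sub, frob_stack]; simp only [Fintype.sum_prod_type]
  have hAL : D.A₁ * D.A₁ᵀ * L₁ = L₁ := by
    have h1 : D.A₁ * D.A₁ᵀ * (D.A₁ * D.W₁) = D.A₁ * D.W₁ := by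
      rw [Matrix.mul_assoc, ← Matrix.mul_assoc D.A₁ᵀ, show D.A₁ᵀ * D.A₁ = 1 from D.A₁_orth,
        Matrix.one_mul]
    calc D.A₁ * D.A₁ᵀ * L₁ = D.A₁ * D.A₁ᵀ * (D.A₁ * D.W₁) := congrArg (D.A₁ * D.A₁ᵀ * ·) D.L₁_eq
      _ = D.A₁ * D.W₁ := h1
      _ = L₁ := D.L₁_eq.symm
  have hAT : D.A₁ * D.A₁ᵀ * T = T := by
    ext a x
    have h1 : (D.A₁ * D.A₁ᵀ * T) a x = (D.A₁ * D.A₁ᵀ * Γ x.1.1 x.1.2.1 x.1.2.2) a x.2 := rfl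
    have h2 : T a x = Γ x.1.1 x.1.2.1 x.1.2.2 a x.2 := rfl
    rw [h1, h2, hΓ, ← Matrix.mul_assoc, ← Matrix.mul_assoc, hAL]
  -- In the gap, one factor `l` comes from the inner `L₁' A₁ = W₁'` and one from the outer `L₁`, the
  -- factor `u²` from `R` on both sides, and `c₀` from the serial dependence of the factors.
  have hge : SqNormGe (D.A₁ᵀ * T)ᵀ (c₀ * l ^ 2 * u ^ 2) := by
    intro y
    set w := L₁ᵀ *ᵥ (D.A₁ *ᵥ y) with hw
    have hwW : w = D.W₁ᵀ *ᵥ y := by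
      have : L₁ᵀ * D.A₁ = D.W₁ᵀ := by
        have h1 : L₁ᵀ = D.W₁ᵀ * D.A₁ᵀ := by
          rw [← Matrix.transpose_mul]; exact congrArg Matrix.transpose D.L₁_eq
        rw [h1, Matrix.mul_assoc, show D.A₁ᵀ * D.A₁ = 1 from D.A₁_orth, Matrix.mul_one]
      rw [hw, Matrix.mulVec_mulVec, this]
    have h1 : l * (y ⬝ᵥ y) ≤ w ⬝ᵥ w := by rw [hwW]; exact sqNormGe_W₁_transpose D hl hL y
    have h2 : ((D.A₁ᵀ * T)ᵀ *ᵥ y) ⬝ᵥ ((D.A₁ᵀ * T)ᵀ *ᵥ y)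
        = ∑ k, ∑ i, ∑ j, (L₁ *ᵥ ((lagCoeff R (Φ k) i j)ᵀ *ᵥ w)) ⬝ᵥ
          (L₁ *ᵥ ((lagCoeff R (Φ k) i j)ᵀ *ᵥ w)) := by
      rw [Matrix.transpose_mul, Matrix.transpose_transpose, ← Matrix.mulVec_mulVec, hT,
        dotProduct_stack_transpose]
      simp only [Fintype.sum_prod_type]
      refine Finset.sum_congr rfl fun k _ => Finset.sum_congr rfl fun i _ =>
        Finset.sum_congr rfl fun j _ => ?_
      have : (Γ k i j)ᵀ *ᵥ (D.A₁ *ᵥ y) = L₁ *ᵥ ((lagCoeff R (Φ k) i j)ᵀ *ᵥ w) := by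
        rw [hΓ, Matrix.transpose_mul, Matrix.transpose_mul, Matrix.transpose_transpose, hw]
        simp only [Matrix.mulVec_mulVec, Matrix.mul_assoc]
      rw [this]
    have h3 : l * u ^ 2 * ∑ k, ∑ c, ∑ d, ((Φ k c d)ᵀ *ᵥ w) ⬝ᵥ ((Φ k c d)ᵀ *ᵥ w)
        ≤ ∑ k, ∑ i, ∑ j, (L₁ *ᵥ ((lagCoeff R (Φ k) i j)ᵀ *ᵥ w)) ⬝ᵥ
          (L₁ *ᵥ ((lagCoeff R (Φ k) i j)ᵀ *ᵥ w)) := by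
      rw [Finset.mul_sum]
      refine Finset.sum_le_sum fun k _ => ?_
      calc _ ≤ l * ∑ i, ∑ j, ((lagCoeff R (Φ k) i j)ᵀ *ᵥ w) ⬝ᵥ ((lagCoeff R (Φ k) i j)ᵀ *ᵥ w) := by
            rw [mul_assoc]
            exact mul_le_mul_of_nonneg_left (le_sum_lagCoeff hR hu.le _ _) hl.le
        _ ≤ _ := by
            simp only [Finset.mul_sum]
            exact Finset.sum_le_sum fun i _ => Finset.sum_le_sum fun j _ => hL _
    have h4 : w ⬝ᵥ ((∑ k, ∑ c, ∑ d, Φ k c d * (Φ k c d)ᵀ) *ᵥ w)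
        = ∑ k, ∑ c, ∑ d, ((Φ k c d)ᵀ *ᵥ w) ⬝ᵥ ((Φ k c d)ᵀ *ᵥ w) := by
      simp only [Matrix.sum_mulVec, dotProduct_sum]
      refine Finset.sum_congr rfl fun k _ => Finset.sum_congr rfl fun i _ =>
        Finset.sum_congr rfl fun j _ => ?_
      rw [mulVec_dotProduct_self, Matrix.transpose_transpose]
    have h5 := hdyn w
    rw [h2]
    calc c₀ * l ^ 2 * u ^ 2 * (y ⬝ᵥ y) = l * u ^ 2 * (c₀ * (l * (y ⬝ᵥ y))) := by ring
      _ ≤ l * u ^ 2 * (c₀ * (w ⬝ᵥ w)) := by gcongr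
      _ ≤ l * u ^ 2 * (w ⬝ᵥ ((∑ k, ∑ c, ∑ d, Φ k c d * (Φ k c d)ᵀ) *ᵥ w)) := by gcongr
      _ ≤ _ := by rw [h4]; exact h3
  set E := firstCols r H * (firstCols r H)ᵀ with hE
  have hEp : IsProj E := (hH.1.firstCols r).isProj
  have hEtr : E.trace = r := by rw [(hH.1.firstCols r).trace_proj, card_firstCols hrp]
  have hAtr : (D.A₁ * D.A₁ᵀ).trace = r := by rw [D.A₁_orth.trace_proj, Fintype.card_fin]
  have hmax := hH.trace_le hrp hr D.A₁_orth.isProj hAtr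
  rw [← hTT'] at hmax
  have hgap := gap_of_range D.A₁_orth hAT hge hEp (by rw [hEtr, Fintype.card_fin])
  have hfT : frob T ≤ Fintype.card ι * (U * U' * (r * s)) ^ 2 := by
    rw [hT, frob_stack]
    simp only [Fintype.sum_prod_type]
    calc _ ≤ ∑ _k : ι, (U * U' * (r * s)) ^ 2 := by
          refine Finset.sum_le_sum fun k _ => ?_
          have h1 := sum_frob_lagCoeff_le hR' hU'.le (hΦ k)
          have hLt : SqNormLe L₁ᵀᵀ U := by rwa [Matrix.transpose_transpose]
          calc ∑ i, ∑ j, frob (Γ k i j) ≤ ∑ i, ∑ j, U ^ 2 * frob (lagCoeff R (Φ k) i j) := by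
                refine Finset.sum_le_sum fun i _ => Finset.sum_le_sum fun j _ => ?_
                rw [hΓ, sq, mul_assoc]
                exact (hLt.frob_mul_le' _).trans
                  (mul_le_mul_of_nonneg_left (hL'.frob_mul_le _) hU.le)
            _ = U ^ 2 * ∑ i, ∑ j, frob (lagCoeff R (Φ k) i j) := by simp only [Finset.mul_sum]
            _ ≤ U ^ 2 * (U' ^ 2 * (r * s) ^ 2) := by gcongr
            _ = _ := by ring
      _ = _ := by simp
  have hg : 0 < c₀ * l ^ 2 * u ^ 2 := by positivity
  have hr' : (0 : ℝ) < r := by exact_mod_cast hr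
  have hs' : (0 : ℝ) < s := by exact_mod_cast hs
  have hcard : (0 : ℝ) < Fintype.card ι := by exact_mod_cast Fintype.card_pos
  -- The operator norm of `T` is crudely replaced by its Frobenius norm. This costs only factors
  -- depending on the fixed numbers of factors and lags.
  have hbd : frob ((E - D.A₁ * D.A₁ᵀ) * T) ≤
      Fintype.card ι * (U * U' * (r * s)) ^ 2 / (c₀ * l ^ 2 * u ^ 2) * (c₀ * l ^ 2 * u ^ 2) *
        frob (E - D.A₁ * D.A₁ᵀ) := by
    rw [div_mul_cancel₀ _ hg.ne']
    have h1 : SqNormLe Tᵀ (frob T) := by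
      have := sqNormLe_frob Tᵀ; rwa [frob_transpose] at this
    exact (h1.frob_mul_le' _).trans (mul_le_mul_of_nonneg_right hfT (frob_nonneg _))
  have := frob_proj_sub_le D.A₁_orth.isProj hEp hg (by positivity) hmax hgap hbd
  rwa [hsub] at this

end FactorSpace

/-! ### The spaces of the projected principal component analysis -/

section KronRow

variable {p q : ℕ}

/-- The `i`-th block of rows of the Kronecker product `S' ⊗ S`. -/
def kronRow (S : Matrix (Fin p) (Fin p) ℝ) (S' : Matrix (Fin q) (Fin q) ℝ) (i : Fin q) :
    Matrix (Fin p) (Fin q × Fin p) ℝ :=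
  Matrix.of fun a x => S a x.2 * S' i x.1

lemma kronRow_mul (S Z : Matrix (Fin p) (Fin p) ℝ) (S' X : Matrix (Fin q) (Fin q) ℝ) (i : Fin q) :
    kronRow S S' i * (X ⊗ₖ Z) = kronRow (S * Z) (S' * X) i := by
  ext a x
  simp only [kronRow, Matrix.mul_apply, Matrix.of_apply, Matrix.kroneckerMap_apply,
    Fintype.sum_prod_type, Finset.sum_mul_sum]
  rw [Finset.sum_comm]
  exact Finset.sum_congr rfl fun b _ => Finset.sum_congr rfl fun j _ => by ring

lemma sum_frob_kronRow (S : Matrix (Fin p) (Fin p) ℝ) (S' : Matrix (Fin q) (Fin q) ℝ) :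
    ∑ i, frob (kronRow S S' i) = frob S * frob S' := by
  simp only [frob, kronRow, Matrix.of_apply, Fintype.sum_prod_type, mul_pow]
  rw [Finset.sum_comm, Finset.sum_mul]
  refine Finset.sum_congr rfl fun a _ => ?_
  rw [Finset.mul_sum]
  refine Finset.sum_congr rfl fun i _ => ?_
  rw [Finset.sum_comm, Finset.sum_mul_sum]

/-- Because the covariance is a Kronecker product, the other side enters only through the scalar
`‖S'‖²`; the eigenvectors are determined by `S` alone. -/
lemma sum_kronRow_transpose_mulVec (S : Matrix (Fin p) (Fin p) ℝ) (S' : Matrix (Fin q) (Fin q) ℝ)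
    (x : Fin p → ℝ) :
    ∑ i, ((kronRow S S' i)ᵀ *ᵥ x) ⬝ᵥ ((kronRow S S' i)ᵀ *ᵥ x)
      = frob S' * ((Sᵀ *ᵥ x) ⬝ᵥ (Sᵀ *ᵥ x)) := by
  simp only [dotProduct_self_eq_sum_sq, Fintype.sum_prod_type, frob, Finset.sum_mul]
  refine Finset.sum_congr rfl fun i _ => Finset.sum_congr rfl fun j _ => ?_
  rw [Finset.mul_sum]
  refine Finset.sum_congr rfl fun b _ => ?_
  rw [← mul_pow]
  congr 1
  simp only [Matrix.mulVec, dotProduct, Matrix.transpose_apply, kronRow, Matrix.of_apply,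
    Finset.mul_sum]
  exact Finset.sum_congr rfl fun a _ => by ring

lemma kronRow_sub_sub (S Z Z' : Matrix (Fin p) (Fin p) ℝ) (S' X X' : Matrix (Fin q) (Fin q) ℝ)
    (i : Fin q) : kronRow (S * Z') (S' * X') i - kronRow (S * Z) (S' * X) i
      = kronRow (S * (Z' - Z)) (S' * X') i + kronRow (S * Z) (S' * (X' - X)) i := by
  ext a x
  simp only [kronRow, Matrix.sub_apply, Matrix.add_apply, Matrix.of_apply, Matrix.mul_sub]
  ring

/-- Telescoping separates the errors of the covariance, of `EB` and of `EQ`. The first is contracted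
by the estimated projections; the error of `EB` is paired with the estimated `EQ'`. -/
lemma sum_frob_mul_kronecker_sub_le {S EB EB' : Matrix (Fin p) (Fin p) ℝ}
    {S' EQ EQ' : Matrix (Fin q) (Fin q) ℝ} (hEB' : IsProj EB') (hEQ' : IsProj EQ')
    (Ω' : Fin q → Matrix (Fin p) (Fin q × Fin p) ℝ) :
    ∑ i, frob (Ω' i * (EQ' ⊗ₖ EB') - kronRow S S' i * (EQ ⊗ₖ EB)) ≤
      2 * ∑ i, frob (Ω' i - kronRow S S' i) + 4 * (frob (S * (EB' - EB)) * frob (S' * EQ')) +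
        4 * (frob (S * EB) * frob (S' * (EQ' - EQ))) := by
  rw [← sum_frob_kronRow, ← sum_frob_kronRow, Finset.mul_sum, Finset.mul_sum, Finset.mul_sum,
    ← Finset.sum_add_distrib, ← Finset.sum_add_distrib]
  refine Finset.sum_le_sum fun i _ => ?_
  have e : Ω' i * (EQ' ⊗ₖ EB') - kronRow S S' i * (EQ ⊗ₖ EB) =
      (Ω' i - kronRow S S' i) * (EQ' ⊗ₖ EB') +
        (kronRow (S * (EB' - EB)) (S' * EQ') i + kronRow (S * EB) (S' * (EQ' - EQ)) i) := by
    rw [← kronRow_sub_sub, Matrix.sub_mul, kronRow_mul, kronRow_mul]; abel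
  rw [e]
  have h1 := frob_add_le ((Ω' i - kronRow S S' i) * (EQ' ⊗ₖ EB'))
    (kronRow (S * (EB' - EB)) (S' * EQ') i + kronRow (S * EB) (S' * (EQ' - EQ)) i)
  have h2 := frob_add_le (kronRow (S * (EB' - EB)) (S' * EQ') i)
    (kronRow (S * EB) (S' * (EQ' - EQ)) i)
  have h3 := (hEQ'.kronecker hEB').frob_mul_le' (Ω' i - kronRow S S' i)
  linarith

/-- `(Q ⊗ B)(Q ⊗ B)'` is a projection and equals its own square. Bases are determined only up to
rotation, so this form makes population and sample matrices comparable. -/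
lemma sum_mul_kronecker_mul_transpose {ι κ : Type*} [Fintype ι] [Fintype κ] [DecidableEq ι]
    [DecidableEq κ] {Q : Matrix (Fin q) κ ℝ} {B : Matrix (Fin p) ι ℝ} (hQ : HalfOrthonormal Q)
    (hB : HalfOrthonormal B) (W : Fin q → Matrix (Fin p) (Fin q × Fin p) ℝ) :
    ∑ i, (W i * (Q ⊗ₖ B)) * (W i * (Q ⊗ₖ B))ᵀ =
      stack (fun i => W i * ((Q * Qᵀ) ⊗ₖ (B * Bᵀ))) *
        (stack fun i => W i * ((Q * Qᵀ) ⊗ₖ (B * Bᵀ)))ᵀ := by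
  rw [stack_mul_transpose]
  refine Finset.sum_congr rfl fun i _ => ?_
  have hP := hQ.isProj.kronecker hB.isProj
  rw [Matrix.transpose_mul, Matrix.transpose_mul, hP.1, ← Matrix.mul_assoc, ← Matrix.mul_assoc,
    Matrix.mul_assoc (W i) _ ((Q * Qᵀ) ⊗ₖ (B * Bᵀ)), hP.2, Matrix.mul_kronecker_mul,
    ← Matrix.kroneckerMap_transpose]
  simp only [Matrix.mul_assoc]

end KronRow

namespace LoadingBounds

variable {p r v k : ℕ} {L₁ : Matrix (Fin p) (Fin r) ℝ} {L₂ : Matrix (Fin p) (Fin v) ℝ}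
  {D : Decomposition L₁ L₂} {c C c₃ s₁ s₂ : ℝ}

lemma frob_mul_le (h : LoadingBounds D k c C c₃ s₁ s₂) (X : Matrix (Fin p) (Fin p) ℝ) :
    frob ((L₁ * L₁ᵀ + L₂ * L₂ᵀ) * X) ≤ 2 * C ^ 2 * (s₁ ^ 2 + s₂ ^ 2) * frob X := by
  refine ((h.sqNormLe_L₁L₁.add h.sqNormLe_L₂L₂).frob_mul_le X).trans (le_of_eq ?_)
  ring

lemma mul_B₁ (D : Decomposition L₁ L₂) :
    (L₁ * L₁ᵀ + L₂ * L₂ᵀ) * (D.B₁ * D.B₁ᵀ) = L₂ * L₂ᵀ * (D.B₁ * D.B₁ᵀ) := by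
  have h : L₁ᵀ * D.B₁ = 0 := by
    have := congrArg Matrix.transpose (B₁_mul_L₁ D)
    simpa [Matrix.transpose_mul] using this
  rw [Matrix.add_mul, Matrix.mul_assoc L₁, ← Matrix.mul_assoc L₁ᵀ, h, Matrix.zero_mul,
    Matrix.mul_zero, zero_add]

lemma frob_mul_B₁_le (h : LoadingBounds D k c C c₃ s₁ s₂) :
    frob ((L₁ * L₁ᵀ + L₂ * L₂ᵀ) * (D.B₁ * D.B₁ᵀ)) ≤ k * (C * s₂) ^ 2 + v * C ^ 2 := by
  rw [mul_B₁]
  exact (D.B₁_orth.isProj.frob_mul_le' _).trans h.frob_L₂L₂_le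

/-- Restriction to the `k ≥ 1` strong directions, where `B₁' L₂ L₂'` is bounded below. Applied to
the opposite side, it is the lower bound for the scalar `τ`. -/
lemma le_frob_mul_B₁ (h : LoadingBounds D k c C c₃ s₁ s₂) (hp : p = r + v) (hr : 1 ≤ r)
    (hk : 1 ≤ k) (hkv : k ≤ v) :
    (c₃ * (c * s₂)) ^ 2 ≤ frob ((L₁ * L₁ᵀ + L₂ * L₂ᵀ) * (D.B₁ * D.B₁ᵀ)) := by
  have h1 := (h.sqNormGe_B₁_L₂L₂_firstCols hp hr).le_frob_mul
    (1 : Matrix {j : Fin v // j.val < k} {j : Fin v // j.val < k} ℝ)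
  have h2 : frob (1 : Matrix {j : Fin v // j.val < k} {j : Fin v // j.val < k} ℝ) = k := by
    simp only [frob, Matrix.one_apply, ite_pow, one_pow, ne_eq, OfNat.ofNat_ne_zero,
      not_false_eq_true, zero_pow, Finset.sum_ite_eq, Finset.mem_univ, if_true, Finset.sum_const,
      Finset.card_univ, card_firstCols hkv, nsmul_eq_mul, mul_one]
  have hA : SqNormLe (firstCols k D.A₂)ᵀ 1 := (D.A₂_orth.firstCols k).sqNormLe_transpose
  have h3 := hA.frob_mul_le' (D.B₁ᵀ * (L₂ * L₂ᵀ))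
  have h4 : frob (D.B₁ᵀ * (L₂ * L₂ᵀ)) = frob (L₂ * L₂ᵀ * (D.B₁ * D.B₁ᵀ)) := by
    rw [← frob_transpose (L₂ * L₂ᵀ * (D.B₁ * D.B₁ᵀ)), Matrix.transpose_mul, D.B₁_orth.isProj.1,
      Matrix.transpose_mul, Matrix.transpose_transpose, Matrix.mul_assoc, frob_eq_trace,
      frob_eq_trace, Matrix.transpose_mul D.B₁, Matrix.mul_assoc _ D.B₁ᵀ,
      ← Matrix.mul_assoc D.B₁ᵀ D.B₁, show D.B₁ᵀ * D.B₁ = 1 from D.B₁_orth, Matrix.one_mul]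
  rw [Matrix.mul_one, h2] at h1
  rw [mul_B₁, ← h4]
  have hk' : (1 : ℝ) ≤ k := by exact_mod_cast hk
  have := le_mul_of_one_le_right (sq_nonneg (c₃ * (c * s₂))) hk'
  linarith

/-- The error of the estimated space of the projected principal component analysis, in terms of the
errors of the sample covariances and of the estimated complements of the loading spaces. -/
lemma frob_projected_le (h : LoadingBounds D k c C c₃ s₁ s₂) (hp : p = r + v) (hr : 1 ≤ r)
    (hk : 1 ≤ k) (hkv : k ≤ v) {q r' w k' : ℕ} {R₁ : Matrix (Fin q) (Fin r') ℝ}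
    {R₂ : Matrix (Fin q) (Fin w) ℝ} {D' : Decomposition R₁ R₂} {t₁ t₂ : ℝ}
    (h' : LoadingBounds D' k' c C c₃ t₁ t₂) (hq : q = r' + w) (hr' : 1 ≤ r') (hk' : 1 ≤ k')
    (hkw : k' ≤ w) (hs : 2 * C ^ 2 ≤ (c₃ * (c * s₂)) ^ 2)
    {ι κ : Type*} [Fintype ι] [Fintype κ] [DecidableEq ι] [DecidableEq κ]
    {Q : Matrix (Fin q) κ ℝ} {B : Matrix (Fin p) ι ℝ} (hQ : HalfOrthonormal Q)
    (hB : HalfOrthonormal B) {W W' : Fin q → Matrix (Fin p) (Fin q × Fin p) ℝ}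
    (hW : ∀ i, W i = kronRow (L₁ * L₁ᵀ + L₂ * L₂ᵀ) (R₁ * R₁ᵀ + R₂ * R₂ᵀ) i)
    {G K : Matrix (Fin p) (Fin p) ℝ}
    (hG : IsOrderedEigenbasis (∑ i, (W i * (D'.B₁ ⊗ₖ D.B₁)) * (W i * (D'.B₁ ⊗ₖ D.B₁))ᵀ) G)
    (hK : IsOrderedEigenbasis (∑ i, (W' i * (Q ⊗ₖ B)) * (W' i * (Q ⊗ₖ B))ᵀ) K) :
    (c₃ * (c * s₂)) ^ 2 / 2 *
        frob (firstCols k K * (firstCols k K)ᵀ - firstCols k G * (firstCols k G)ᵀ) ≤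
      (22 * (2 * (C / (c₃ * c)) ^ 2) + 3) *
        (2 * (∑ i, frob (W' i - W i)) / (c₃ * (c * t₂)) ^ 2
          + 16 * C ^ 2 * (s₁ ^ 2 + s₂ ^ 2) * frob (B * Bᵀ - D.B₁ * D.B₁ᵀ)
          + 32 * C ^ 4 * (s₁ ^ 2 + s₂ ^ 2) * (t₁ ^ 2 + t₂ ^ 2) * frob (B * Bᵀ - D.B₁ * D.B₁ᵀ) *
            frob (Q * Qᵀ - D'.B₁ * D'.B₁ᵀ) / (c₃ * (c * t₂)) ^ 2
          + 8 * C ^ 2 * (k * (C * s₂) ^ 2 + v * C ^ 2) * (t₁ ^ 2 + t₂ ^ 2) *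
            frob (Q * Qᵀ - D'.B₁ * D'.B₁ᵀ) / (c₃ * (c * t₂)) ^ 2) := by
  have hc := h.c_pos
  have hc₃ := h.c₃_pos
  have hC := h.C_pos
  have hs₂ := h.s₂_pos
  have ht₂ := h'.s₂_pos
  set S := L₁ * L₁ᵀ + L₂ * L₂ᵀ with hS
  set S' := R₁ * R₁ᵀ + R₂ * R₂ᵀ with hS'
  set τ := frob (S' * (D'.B₁ * D'.B₁ᵀ)) with hτ
  set τ₀ := (c₃ * (c * t₂)) ^ 2 with hτ₀
  have hτ₀pos : 0 < τ₀ := by positivity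
  have hτle : τ₀ ≤ τ := h'.le_frob_mul_B₁ hq hr' hk' hkw
  have hτpos : 0 < τ := hτ₀pos.trans_le hτle
  have hW' : W = kronRow S S' := funext hW
  rw [sum_mul_kronecker_mul_transpose D'.B₁_orth D.B₁_orth] at hG
  rw [sum_mul_kronecker_mul_transpose hQ hB] at hK
  set T := stack fun i => W i * ((D'.B₁ * D'.B₁ᵀ) ⊗ₖ (D.B₁ * D.B₁ᵀ)) with hT
  set T' := stack fun i => W' i * ((Q * Qᵀ) ⊗ₖ (B * Bᵀ)) with hT'
  have hSE : (S * (D.B₁ * D.B₁ᵀ))ᵀ = D.B₁ * (D.B₁ᵀ * (L₂ * L₂ᵀ)) := by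
    rw [hS, mul_B₁, Matrix.transpose_mul, D.B₁_orth.isProj.1, Matrix.transpose_mul,
      Matrix.transpose_transpose, Matrix.mul_assoc]
  -- This is the identity `T Tᵀ = τ L₂ L₂' B₁ B₁' L₂ L₂'`, written as a quadratic form.
  have hTx : ∀ x, (Tᵀ *ᵥ x) ⬝ᵥ (Tᵀ *ᵥ x) =
      τ * (((D.B₁ᵀ * (L₂ * L₂ᵀ)) *ᵥ x) ⬝ᵥ ((D.B₁ᵀ * (L₂ * L₂ᵀ)) *ᵥ x)) := by
    intro x
    rw [hT, dotProduct_stack_transpose, hW']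
    simp only [kronRow_mul]
    rw [sum_kronRow_transpose_mulVec, hSE, ← Matrix.mulVec_mulVec, D.B₁_orth.dotProduct_mulVec]
  have hTx' : ∀ x, (Tᵀ *ᵥ x) ⬝ᵥ (Tᵀ *ᵥ x) ≤
      τ * (((L₂ * L₂ᵀ) *ᵥ x) ⬝ᵥ ((L₂ * L₂ᵀ) *ᵥ x)) := by
    intro x
    rw [hTx, ← Matrix.mulVec_mulVec]
    have := D.B₁_orth.sqNormLe_transpose ((L₂ * L₂ᵀ) *ᵥ x)
    rw [one_mul] at this
    exact mul_le_mul_of_nonneg_left this hτpos.le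
  have hquad : ∀ x, x ⬝ᵥ ((T * Tᵀ) *ᵥ x) = (Tᵀ *ᵥ x) ⬝ᵥ (Tᵀ *ᵥ x) := by
    intro x; rw [mulVec_dotProduct_self, Matrix.transpose_transpose]
  have hkp : k ≤ p := by omega
  obtain ⟨hG1, ev, hanti, hev⟩ := hG
  -- Test space for the lower bound, and constraints for the upper bound of the later eigenvalues,
  -- are both given by the first `k` left singular vectors of `L₂`.
  have hhi : ∀ a : Fin p, a.val < k → τ * (c₃ * (c * s₂)) ^ 2 ≤ ev a := by
    intro a ha
    refine le_eigenvalue hG1 hanti hev (D.A₂_orth.firstCols k) (fun x => ?_) a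
      (by rwa [card_firstCols hkv])
    rw [hquad, hTx, Matrix.mulVec_mulVec, mul_assoc]
    exact mul_le_mul_of_nonneg_left (h.sqNormGe_B₁_L₂L₂_firstCols hp hr x) hτpos.le
  have hlo : ∀ a : Fin p, k ≤ a.val → ev a ≤ τ * C ^ 2 := by
    intro a ha
    refine eigenvalue_le hG1 hanti hev (V := firstCols k D.A₂) (fun x hx => ?_) a
      (by rwa [card_firstCols hkv])
    rw [hquad, mul_assoc]
    exact (hTx' x).trans (mul_le_mul_of_nonneg_left (h.L₂L₂_mulVec_le x hx) hτpos.le)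
  set E := firstCols k G * (firstCols k G)ᵀ with hE
  set E' := firstCols k K * (firstCols k K)ᵀ with hE'
  have hEp : IsProj E := (hG1.firstCols k).isProj
  have hE'p : IsProj E' := (hK.1.firstCols k).isProj
  have hEtr : E.trace = k := by rw [(hG1.firstCols k).trace_proj, card_firstCols hkp]
  have hE'tr : E'.trace = k := by rw [(hK.1.firstCols k).trace_proj, card_firstCols hkp]
  -- Half of the upper eigenvalue bound: by `hs` the remaining eigenvalues stay below the other
  -- half.
  set g := τ * (c₃ * (c * s₂)) ^ 2 / 2 with hg
  have hgpos : 0 < g := by positivity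
  have hgap : g / 2 * frob (E' - E) ≤ (T * Tᵀ * (E - E')).trace := by
    refine le_trans ?_ (trace_mul_proj_le hG1 hev hkp hhi hlo hE'p hE'tr)
    refine mul_le_mul_of_nonneg_right ?_ (frob_nonneg _)
    have := mul_le_mul_of_nonneg_left hs hτpos.le
    rw [hg]; linarith
  have hbd : frob ((E' - E) * T) ≤ 2 * (C / (c₃ * c)) ^ 2 * g * frob (E' - E) := by
    have hTle : SqNormLe Tᵀ (2 * (C / (c₃ * c)) ^ 2 * g) := by
      intro x
      have e : 2 * (C / (c₃ * c)) ^ 2 * g = τ * (C * s₂) ^ 2 := by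
        rw [hg]; field_simp
      rw [e, mul_assoc]
      exact (hTx' x).trans (mul_le_mul_of_nonneg_left (h.sqNormLe_L₂L₂ x) hτpos.le)
    exact hTle.frob_mul_le' _
  have hmain := frob_proj_sub_le hEp hE'p hgpos (c := 2 * (C / (c₃ * c)) ^ 2) (by positivity)
    (hK.trace_le hkp hk hEp hEtr) hgap hbd
  have hsub : frob (T' - T) ≤ 2 * ∑ i, frob (W' i - W i) +
      4 * (frob (S * (B * Bᵀ - D.B₁ * D.B₁ᵀ)) * frob (S' * (Q * Qᵀ))) +
        4 * (frob (S * (D.B₁ * D.B₁ᵀ)) * frob (S' * (Q * Qᵀ - D'.B₁ * D'.B₁ᵀ))) := by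
    rw [hT, hT', stack_sub, frob_stack, hW']
    exact sum_frob_mul_kronecker_sub_le hB.isProj hQ.isProj W'
  set x₁ := frob (B * Bᵀ - D.B₁ * D.B₁ᵀ) with hx₁
  set x₂ := frob (Q * Qᵀ - D'.B₁ * D'.B₁ᵀ) with hx₂
  set e₀ := ∑ i, frob (W' i - W i) with he₀
  have hx₁0 : 0 ≤ x₁ := frob_nonneg _
  have hx₂0 : 0 ≤ x₂ := frob_nonneg _
  have he₀0 : 0 ≤ e₀ := Finset.sum_nonneg fun _ _ => frob_nonneg _
  set a := s₁ ^ 2 + s₂ ^ 2 with ha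
  set b := t₁ ^ 2 + t₂ ^ 2 with hb
  have ha0 : 0 ≤ a := by positivity
  have hb0 : 0 ≤ b := by positivity
  have h1 : frob (S * (B * Bᵀ - D.B₁ * D.B₁ᵀ)) ≤ 2 * C ^ 2 * a * x₁ := h.frob_mul_le _
  have h2 : frob (S' * (Q * Qᵀ - D'.B₁ * D'.B₁ᵀ)) ≤ 2 * C ^ 2 * b * x₂ := h'.frob_mul_le _
  -- The estimated `Q` need not be close to `Q₁`, so its contribution is split into `τ` plus an
  -- error.
  have h3 : frob (S' * (Q * Qᵀ)) ≤ 2 * τ + 2 * (2 * C ^ 2 * b * x₂) := by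
    have e : S' * (Q * Qᵀ) = S' * (D'.B₁ * D'.B₁ᵀ) + S' * (Q * Qᵀ - D'.B₁ * D'.B₁ᵀ) := by
      rw [← Matrix.mul_add]; congr 1; abel
    have := frob_add_le (S' * (D'.B₁ * D'.B₁ᵀ)) (S' * (Q * Qᵀ - D'.B₁ * D'.B₁ᵀ))
    rw [e]; linarith
  set ww := (k : ℝ) * (C * s₂) ^ 2 + v * C ^ 2 with hww
  have hww0 : 0 ≤ ww := by positivity
  have h4 : frob (S * (D.B₁ * D.B₁ᵀ)) ≤ ww := h.frob_mul_B₁_le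
  have h5 : frob (T' - T) ≤ 2 * e₀ + 4 * (2 * C ^ 2 * a * x₁ * (2 * τ + 2 * (2 * C ^ 2 * b * x₂))) +
      4 * (ww * (2 * C ^ 2 * b * x₂)) := by
    refine hsub.trans ?_
    have := mul_le_mul h1 h3 (frob_nonneg _) (by positivity)
    have := mul_le_mul h4 h2 (frob_nonneg _) hww0
    linarith
  -- Every term is written as a multiple of `τ`, using `τ₀ ≤ τ` where `τ` is absent, so that `τ`
  -- cancels against the gap. No upper bound for `τ` is then needed.
  have hdiv : ∀ y : ℝ, 0 ≤ y → y ≤ τ * (y / τ₀) := by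
    intro y hy
    rw [mul_div_assoc', le_div_iff₀ hτ₀pos, mul_comm]
    exact mul_le_mul_of_nonneg_right hτle hy
  have h6 : 2 * e₀ + 4 * (2 * C ^ 2 * a * x₁ * (2 * τ + 2 * (2 * C ^ 2 * b * x₂))) +
      4 * (ww * (2 * C ^ 2 * b * x₂)) ≤ τ * (2 * e₀ / τ₀ + 16 * C ^ 2 * a * x₁
        + 32 * C ^ 4 * a * b * x₁ * x₂ / τ₀ + 8 * C ^ 2 * ww * b * x₂ / τ₀) := by
    have i1 := hdiv (2 * e₀) (by positivity)
    have i2 := hdiv (32 * C ^ 4 * a * b * x₁ * x₂) (by positivity)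
    have i3 := hdiv (8 * C ^ 2 * ww * b * x₂) (by positivity)
    linarith
  have h7 := hmain.trans (mul_le_mul_of_nonneg_left (h5.trans h6)
    (by positivity : 0 ≤ 22 * (2 * (C / (c₃ * c)) ^ 2) + 3))
  refine le_of_mul_le_mul_left ?_ hτpos
  rw [hg] at h7
  linarith

end LoadingBounds

/-! ### Second moments of the matrix factor model -/

section Moments

variable {Ω : Type*} [MeasurableSpace Ω] {P : Measure Ω} {p q : ℕ}

/-- The covariances with `vec(Y_t)` are those of lag zero, so the projected analysis is governed by
the lag-zero term of the same error. -/
lemma sum_frob_sampleColVecCov_sub (X : ℤ → Ω → Matrix (Fin p) (Fin q) ℝ) (n : ℕ) (ω : Ω) :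
    ∑ i, frob (sampleColVecCov n (fun t => X t ω) i - colVecCov P X i) = lagErr P X n 0 ω := by
  unfold lagErr
  refine Finset.sum_congr rfl fun i _ => ?_
  simp only [frob, Fintype.sum_prod_type]
  rw [Finset.sum_comm]
  refine Finset.sum_congr rfl fun j _ => Finset.sum_congr rfl fun a _ =>
    Finset.sum_congr rfl fun b _ => ?_
  simp [sampleColVecCov, colVecCov, sampleLagCov, lagCov, Matrix.vec]

namespace Model

variable {r₁ v₁ r₂ v₂ : ℕ} (M : Model P r₁ v₁ r₂ v₂)

lemma colVecCov_Y [IsProbabilityMeasure P] (i : Fin (r₂ + v₂)) : colVecCov P M.Y i =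
    kronRow (M.L₁ * M.L₁ᵀ + M.L₂ * M.L₂ᵀ) (M.R₁ * M.R₁ᵀ + M.R₂ * M.R₂ᵀ) i := by
  ext a x
  exact M.Y_cov_zero 0 a i x.2 x.1

lemma colVecCov_Yt [IsProbabilityMeasure P] (i : Fin (r₁ + v₁)) : colVecCov P M.Yt i =
    kronRow (M.R₁ * M.R₁ᵀ + M.R₂ * M.R₂ᵀ) (M.L₁ * M.L₁ᵀ + M.L₂ * M.L₂ᵀ) i := by
  ext a x
  exact (M.Y_cov_zero 0 i a x.1 x.2).trans (mul_comm _ _)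

lemma lagCov_Y [IsProbabilityMeasure P] {k : ℕ} (hk : 1 ≤ k) (i j : Fin (r₂ + v₂)) :
    lagCov P M.Y k i j = M.L₁ * lagCoeff M.R₁ (lagCov P M.F k) i j * M.L₁ᵀ := by
  ext a b
  have h : (0 : ℤ) ≠ -(k : ℤ) := by omega
  refine (M.Y_cov_lag h a i b j).trans ?_
  simp only [Matrix.mul_apply, Matrix.transpose_apply, lagCoeff, Matrix.of_apply,
    Matrix.kroneckerMap_apply, Fintype.sum_prod_type, Finset.sum_mul, Finset.mul_sum, lagCov]
  calc _ = ∑ e, ∑ f, ∑ c, ∑ d, M.L₁ a e * M.R₁ i c * (M.L₁ b f * M.R₁ j d) *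
        cov[fun ω => M.F 0 ω e c, fun ω => M.F (-(k : ℤ)) ω f d; P] :=
        Finset.sum_congr rfl fun e _ => Finset.sum_comm
    _ = ∑ f, ∑ e, ∑ c, ∑ d, M.L₁ a e * M.R₁ i c * (M.L₁ b f * M.R₁ j d) *
        cov[fun ω => M.F 0 ω e c, fun ω => M.F (-(k : ℤ)) ω f d; P] := Finset.sum_comm
    _ = _ := Finset.sum_congr rfl fun f _ => Finset.sum_congr rfl fun e _ =>
        Finset.sum_congr rfl fun c _ => Finset.sum_congr rfl fun d _ => by ring

lemma lagCov_Yt [IsProbabilityMeasure P] {k : ℕ} (hk : 1 ≤ k) (i j : Fin (r₁ + v₁)) :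
    lagCov P M.Yt k i j = M.R₁ * lagCoeff M.L₁ (lagCov P M.Ft k) i j * M.R₁ᵀ := by
  ext a b
  have h : (0 : ℤ) ≠ -(k : ℤ) := by omega
  refine (M.Y_cov_lag h i a j b).trans ?_
  simp only [Matrix.mul_apply, Matrix.transpose_apply, lagCoeff, Matrix.of_apply,
    Matrix.kroneckerMap_apply, Fintype.sum_prod_type, Finset.sum_mul, Finset.mul_sum, lagCov, Ft]
  calc _ = ∑ c, ∑ e, ∑ f, ∑ d, M.L₁ i e * M.R₁ a c * (M.L₁ j f * M.R₁ b d) *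
        cov[fun ω => M.F 0 ω e c, fun ω => M.F (-(k : ℤ)) ω f d; P] := Finset.sum_comm
    _ = ∑ c, ∑ e, ∑ d, ∑ f, M.L₁ i e * M.R₁ a c * (M.L₁ j f * M.R₁ b d) *
        cov[fun ω => M.F 0 ω e c, fun ω => M.F (-(k : ℤ)) ω f d; P] :=
        Finset.sum_congr rfl fun c _ => Finset.sum_congr rfl fun e _ => Finset.sum_comm
    _ = ∑ c, ∑ d, ∑ e, ∑ f, M.L₁ i e * M.R₁ a c * (M.L₁ j f * M.R₁ b d) *
        cov[fun ω => M.F 0 ω e c, fun ω => M.F (-(k : ℤ)) ω f d; P] :=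
        Finset.sum_congr rfl fun c _ => Finset.sum_comm
    _ = ∑ d, ∑ c, ∑ e, ∑ f, M.L₁ i e * M.R₁ a c * (M.L₁ j f * M.R₁ b d) *
        cov[fun ω => M.F 0 ω e c, fun ω => M.F (-(k : ℤ)) ω f d; P] := Finset.sum_comm
    _ = _ := Finset.sum_congr rfl fun d _ => Finset.sum_congr rfl fun c _ =>
        Finset.sum_congr rfl fun e _ => Finset.sum_congr rfl fun f _ => by ring

/-- Cauchy–Schwarz for unit variances, from nonnegativity of the variances of sum and difference. -/
lemma abs_cov_F_le [IsProbabilityMeasure P] (t s : ℤ) (i j i' j') :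
    |cov[fun ω => M.F t ω i j, fun ω => M.F s ω i' j'; P]| ≤ 1 := by
  have hX := M.F_sq t i j
  have hY := M.F_sq s i' j'
  have h1 := variance_nonneg ((fun ω => M.F t ω i j) + fun ω => M.F s ω i' j') P
  have h2 := variance_nonneg ((fun ω => M.F t ω i j) - fun ω => M.F s ω i' j') P
  rw [variance_add hX hY, ← covariance_self hX.aemeasurable, ← covariance_self hY.aemeasurable,
    M.F_cov, M.F_cov] at h1
  rw [variance_sub hX hY, ← covariance_self hX.aemeasurable, ← covariance_self hY.aemeasurable,
    M.F_cov, M.F_cov] at h2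
  simp only [and_self, if_true] at h1 h2
  rw [abs_le]
  constructor <;> linarith

end Model

end Moments

/-! ### Bounds for the loadings from the conditions on their strength -/

/-- For `x i ≠ 0`, `L x` is `x i` times the difference of column `i` and a combination of the other
columns with coefficients `-(x k / x i)`. -/
lemma colGap_mul_sq_le {p r : ℕ} (L : Matrix (Fin p) (Fin r) ℝ) (x : Fin r → ℝ) (i : Fin r) :
    colGap L i * x i ^ 2 ≤ (L *ᵥ x) ⬝ᵥ (L *ᵥ x) := by
  rcases eq_or_ne (x i) 0 with h0 | h0
  · rw [h0]; simpa using dotProduct_self_nonneg' (L *ᵥ x)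
  have hbd : BddBelow (Set.range fun θ : Fin r → ℝ =>
      ∑ a, (L a i - ∑ k ∈ Finset.univ.erase i, θ k * L a k) ^ 2) :=
    ⟨0, by rintro _ ⟨θ, rfl⟩; exact Finset.sum_nonneg fun _ _ => sq_nonneg _⟩
  have h1 : colGap L i ≤ _ := ciInf_le hbd fun k => -(x k / x i)
  refine (mul_le_mul_of_nonneg_right h1 (sq_nonneg _)).trans (le_of_eq ?_)
  rw [dotProduct_self_eq_sum_sq, Finset.sum_mul]
  refine Finset.sum_congr rfl fun a _ => ?_
  rw [← mul_pow]
  congr 1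
  rw [Matrix.mulVec, dotProduct, ← Finset.add_sum_erase _ _ (Finset.mem_univ i), sub_mul,
    Finset.sum_mul, sub_eq_add_neg, ← Finset.sum_neg_distrib]
  congr 1
  refine Finset.sum_congr rfl fun k _ => ?_
  field_simp

lemma sqNormGe_of_colGap {p r : ℕ} {L : Matrix (Fin p) (Fin r) ℝ} {c : ℝ} (hr : 1 ≤ r)
    (h : ∀ i, c ≤ colGap L i) : SqNormGe L (c / r) := by
  intro x
  have hr' : (0 : ℝ) < r := by exact_mod_cast hr
  have h1 : c * (x ⬝ᵥ x) ≤ r * ((L *ᵥ x) ⬝ᵥ (L *ᵥ x)) := by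
    rw [dotProduct_self_eq_sum_sq x, Finset.mul_sum]
    calc _ ≤ ∑ _i : Fin r, (L *ᵥ x) ⬝ᵥ (L *ᵥ x) := Finset.sum_le_sum fun i _ =>
          (mul_le_mul_of_nonneg_right (h i) (sq_nonneg _)).trans (colGap_mul_sq_le L x i)
      _ = _ := by simp
  rw [div_mul_eq_mul_div, div_le_iff₀ hr']
  linarith

lemma sqNormLe_of_col {p r : ℕ} {L : Matrix (Fin p) (Fin r) ℝ} {c : ℝ}
    (h : ∀ i, ∑ a, L a i ^ 2 ≤ c) : SqNormLe L (r * c) := by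
  refine (sqNormLe_frob L).mono ?_
  rw [frob, Finset.sum_comm]
  calc _ ≤ ∑ _i : Fin r, c := Finset.sum_le_sum fun i _ => h i
    _ = _ := by simp

/-- Lets the row and the column side share one set of constants. -/
lemma LoadingBounds.mono {p r v k : ℕ} {L₁ : Matrix (Fin p) (Fin r) ℝ}
    {L₂ : Matrix (Fin p) (Fin v) ℝ} {D : Decomposition L₁ L₂} {c C c₃ s₁ s₂ c' C' c₃' : ℝ}
    (h : LoadingBounds D k c C c₃ s₁ s₂) (hc' : 0 < c') (hc : c' ≤ c) (hC : C ≤ C')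
    (hc₃' : 0 < c₃') (hc₃ : c₃' ≤ c₃) : LoadingBounds D k c' C' c₃' s₁ s₂ where
  c_pos := hc'
  one_le_C := h.one_le_C.trans hC
  c₃_pos := hc₃'
  s₁_pos := h.s₁_pos
  one_le_s₂ := h.one_le_s₂
  lower x := (mul_le_mul_of_nonneg_right (mul_le_mul_of_nonneg_right hc h.s₁_pos.le)
    (dotProduct_self_nonneg' x)).trans (h.lower x)
  upper := h.upper.mono (mul_le_mul_of_nonneg_right hC h.s₁_pos.le)
  d_lower j hj := (mul_le_mul_of_nonneg_right hc h.s₂_pos.le).trans (h.d_lower j hj)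
  d_upper j hj := (h.d_upper j hj).trans (mul_le_mul_of_nonneg_right hC h.s₂_pos.le)
  d_upper' j hj := (h.d_upper' j hj).trans hC
  sep := by
    obtain ⟨Ξ, hΞ, hx⟩ := h.sep
    exact ⟨Ξ, hΞ, fun x => (mul_le_mul_of_nonneg_right (pow_le_pow_left₀ hc₃'.le hc₃ 2)
      (dotProduct_self_nonneg' x)).trans (hx x)⟩

lemma exists_loadingBounds {r k : ℕ} {v : ℕ → ℕ} (hr : 1 ≤ r)
    {L₁ : ∀ n, Matrix (Fin (r + v n)) (Fin r) ℝ} {L₂ : ∀ n, Matrix (Fin (r + v n)) (Fin (v n)) ℝ}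
    (D : ∀ n, Decomposition (L₁ n) (L₂ n)) {δ₁ δ₂ c₃ : ℝ} (hδ₂ : δ₂ ≤ 1)
    (h₁ : FactorStrength (fun n => r + v n) L₁ δ₁)
    (h₂ : NoiseStrength (fun n => r + v n) v k (fun n => (D n).d) δ₂) (hc₃ : 0 < c₃)
    (hsep : ∀ n, WellProjected ((D n).starBasis k) (D n).A₁ c₃) :
    ∃ c C : ℝ, ∀ n, LoadingBounds (D n) k c C c₃ (((r + v n : ℕ) : ℝ) ^ (1 - δ₁))
      (((r + v n : ℕ) : ℝ) ^ (1 - δ₂)) := by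
  obtain ⟨⟨_, C₁, -, hC₁⟩, c₁, _, hc₁, hgap⟩ := h₁
  obtain ⟨⟨c₂, C₂, hc₂, hd⟩, _, C₃, -, hd'⟩ := h₂
  have hr' : (0 : ℝ) < r := by exact_mod_cast hr
  -- The `1/r` comes from summing the column gaps, `r C₁` from bounding the operator norm by the
  -- Frobenius norm, and the squares from passing from singular values to squared ones.
  refine ⟨min (c₁ / r) (c₂ ^ 2), max 1 (max (r * C₁) (max (C₂ ^ 2) (C₃ ^ 2))), fun n => ?_⟩
  have hp : (1 : ℝ) ≤ ((r + v n : ℕ) : ℝ) := by exact_mod_cast hr.trans (Nat.le_add_right _ _)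
  have hp0 : (0 : ℝ) < ((r + v n : ℕ) : ℝ) := lt_of_lt_of_le one_pos hp
  have hsq : (((r + v n : ℕ) : ℝ) ^ ((1 - δ₂) / 2)) ^ 2 = ((r + v n : ℕ) : ℝ) ^ (1 - δ₂) := by
    rw [← Real.rpow_natCast, ← Real.rpow_mul hp0.le]; congr 1; push_cast; ring
  have hs₁ := Real.rpow_pos_of_pos hp0 (1 - δ₁)
  have hs₂ := Real.rpow_pos_of_pos hp0 (1 - δ₂)
  have hs := Real.rpow_pos_of_pos hp0 ((1 - δ₂) / 2)
  refine ⟨by positivity, le_max_left _ _, hc₃, hs₁, Real.one_le_rpow hp (by linarith), ?_, ?_,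
    fun j hj => ?_, fun j hj => ?_, fun j hj => ?_, hsep n⟩
  · intro x
    refine le_trans ?_ (sqNormGe_of_colGap hr (fun i => (hgap n i).1) x)
    refine mul_le_mul_of_nonneg_right ?_ (dotProduct_self_nonneg' x)
    rw [mul_div_right_comm]
    exact mul_le_mul_of_nonneg_right (min_le_left _ _) hs₁.le
  · refine (sqNormLe_of_col fun i => (hC₁ n i).2).mono ?_
    rw [← mul_assoc]
    exact mul_le_mul_of_nonneg_right ((le_max_left _ _).trans (le_max_right _ _)) hs₁.le
  · refine le_trans (mul_le_mul_of_nonneg_right (min_le_right _ _) hs₂.le) ?_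
    rw [← hsq, ← mul_pow]
    exact pow_le_pow_left₀ (by positivity) (hd n ⟨j, hj⟩).1 2
  · refine (pow_le_pow_left₀ ((D n).d_nonneg j) (hd n ⟨j, hj⟩).2 2).trans ?_
    rw [mul_pow, hsq]
    exact mul_le_mul_of_nonneg_right ((le_max_left _ _).trans
      ((le_max_right _ _).trans (le_max_right _ _))) hs₂.le
  · refine (pow_le_pow_left₀ ((D n).d_nonneg j) (hd' n ⟨j, hj⟩).2 2).trans ?_
    rw [mul_one]
    exact (le_max_right _ _).trans ((le_max_right _ _).trans (le_max_right _ _))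

/-! ### Tightness of the errors of the sample autocovariances -/

/-- Markov's inequality is applied to the integrable variables `T`, since the error itself is
quadratic in them. Where `∑ T < l/n`, also `T² ≤ l²/n`, so the quadratic part stays of order `1/n`.
-/
lemma Model.measure_sum_lagErr_le {Ω : Type*} [MeasurableSpace Ω] {P : Measure Ω}
    [IsProbabilityMeasure P] {r₁ v₁ r₂ v₂ : ℕ}
    (M : Model P r₁ v₁ r₂ v₂) (DL : Decomposition M.L₁ M.L₂) (DR : Decomposition M.R₁ M.R₂)
    {γ K S : ℝ} (hγ : 2 < γ) (hK : 1 ≤ K)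
    (hα : Summable fun j : ℕ => mixingCoeff P M.Y M.F (j + 1) ^ (1 - 2 / γ))
    (hS : ∑' j : ℕ, mixingCoeff P M.Y M.F (j + 1) ^ (1 - 2 / γ) ≤ S)
    (hmom : ∀ t m l, MomentBound P (fun ω => M.rot DL DR t ω m l) (2 * γ) K)
    {U U' N : ℝ} (hU0 : 0 ≤ U) (hU0' : 0 ≤ U') (hU : SqNormLe M.L₁ U) (hU' : SqNormLe M.R₁ U')
    (hN : 0 < N) (hwN : (∑ m, DL.weight U m) * (∑ m, DR.weight U' m) ≤ N)
    {k₀ n : ℕ} (hkn : k₀ ≤ n) (hn : 0 < n) {l : ℝ} (hl : 0 < l) :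
    P {ω | (k₀ + 1) * (4 * (l + 3 * l ^ 2)) * N ^ 2 / n <
        ∑ k ∈ Finset.range (k₀ + 1), lagErr P M.Y n k ω} ≤
      ENNReal.ofReal ((k₀ + 1) * (4 * (2 * ((4 + 6 * K + K ^ 2) * (k₀ + 1 + S)) +
        k₀ ^ 2 * (1 + K) ^ 2)) / l) := by
  have hn' : (1 : ℝ) ≤ n := by exact_mod_cast hn
  have hn0 : (0 : ℝ) < n := lt_of_lt_of_le one_pos hn'
  set B := 4 * (2 * ((4 + 6 * K + K ^ 2) * (k₀ + 1 + S)) + (k₀ : ℝ) ^ 2 * (1 + K) ^ 2) with hB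
  have hex : ∀ k : Fin (k₀ + 1), ∃ T : Ω → ℝ, (∀ ω, 0 ≤ T ω) ∧ Integrable T P ∧
      ∫ ω, T ω ∂P ≤ B / n ∧ ∀ ω, lagErr P M.Y n k ω ≤ scaledError N (T ω) := by
    intro k
    have hk : (k : ℕ) ≤ k₀ := by omega
    obtain ⟨T, h1, h2, h3, h4⟩ := M.exists_lagErr_bound DL DR hγ hK hα hS hmom hU0 hU0' hU hU' hN
      hwN (hk.trans hkn) hn
    refine ⟨T, h1, h2, h3.trans ?_, h4⟩
    have hk' : ((k : ℕ) : ℝ) ≤ k₀ := by exact_mod_cast hk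
    rw [hB]
    gcongr
  choose T hT0 hTi hT1 hT2 using hex
  have hmarkov := mul_meas_ge_le_integral_of_nonneg (μ := P) (f := fun ω => ∑ k, T k ω)
    (ae_of_all _ fun ω => Finset.sum_nonneg fun k _ => hT0 k ω)
    (integrable_finsetSum _ fun k _ => hTi k) (l / n)
  have hint : ∫ ω, ∑ k, T k ω ∂P ≤ (k₀ + 1) * (B / n) := by
    rw [integral_finsetSum _ fun k _ => hTi k]
    refine (Finset.sum_le_sum fun k _ => hT1 k).trans (le_of_eq ?_)
    simp
  have hsub : {ω | (k₀ + 1) * (4 * (l + 3 * l ^ 2)) * N ^ 2 / n <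
        ∑ k ∈ Finset.range (k₀ + 1), lagErr P M.Y n k ω} ⊆ {ω | l / n ≤ ∑ k, T k ω} := by
    intro ω hω
    by_contra hlt
    have hlt' : ∑ k, T k ω < l / n := not_le.mp hlt
    refine absurd (Set.mem_ofPred_eq ▸ hω) (not_lt.mpr ?_)
    have hk : ∀ k : Fin (k₀ + 1), lagErr P M.Y n k ω ≤ 4 * (l + 3 * l ^ 2) * N ^ 2 / n := by
      intro k
      have h1 : T k ω ≤ l / n :=
        (Finset.single_le_sum (fun i _ => hT0 i ω) (Finset.mem_univ k)).trans hlt'.le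
      have h2 : (l / n) ^ 2 ≤ l ^ 2 / n := by
        rw [div_pow]
        exact div_le_div_of_nonneg_left (sq_nonneg l) hn0 (le_self_pow₀ hn' two_ne_zero)
      have h3 : T k ω + 3 * T k ω ^ 2 ≤ l / n + 3 * (l ^ 2 / n) := by
        have := pow_le_pow_left₀ (hT0 k ω) h1 2
        linarith
      calc _ ≤ 4 * N ^ 2 * (T k ω + 3 * T k ω ^ 2) := hT2 k ω
        _ ≤ 4 * N ^ 2 * (l / n + 3 * (l ^ 2 / n)) := by gcongr
        _ = _ := by ring
    rw [Finset.sum_range]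
    refine (Finset.sum_le_sum fun k _ => hk k).trans (le_of_eq ?_)
    simp; ring
  refine (measure_mono hsub).trans ?_
  rw [← ENNReal.ofReal_toReal (measure_ne_top P _)]
  refine ENNReal.ofReal_le_ofReal ?_
  rw [le_div_iff₀ hl]
  have h1 := hmarkov.trans hint
  rw [div_mul_eq_mul_div, ← mul_div_assoc, div_le_div_iff_of_pos_right hn0] at h1
  rw [mul_comm]
  exact h1

/-- At most `r + k` directions have strength up to order `p`, and at most `p` have bounded strength,
so the total weight is linear in `p`. -/
lemma LoadingBounds.sum_weight_le_card {p r v k : ℕ} {L₁ : Matrix (Fin p) (Fin r) ℝ}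
    {L₂ : Matrix (Fin p) (Fin v) ℝ} {D : Decomposition L₁ L₂} {c C c₃ s₁ s₂ : ℝ}
    (h : LoadingBounds D k c C c₃ s₁ s₂) (h₁ : s₁ ≤ p) (h₂ : s₂ ≤ p) (hv : v ≤ p) :
    ∑ m, D.weight (C * s₁) m ≤ 2 * C * (r + k + 1) * p := by
  have hC := h.C_pos
  have hv' : (v : ℝ) ≤ p := by exact_mod_cast hv
  refine h.sum_weight_le.trans ?_
  calc 2 * r * (C * s₁) + 2 * (k * (C * s₂) + v * C)
      ≤ 2 * r * (C * p) + 2 * (k * (C * p) + p * C) := by gcongr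
    _ = _ := by ring

/-- The squared errors of the sample autocovariances are of order `(p₁ p₂)² / n`. -/
lemma exists_sum_lagErr_tight {r₁ r₂ k₁ k₂ k₀ : ℕ} {v₁ v₂ : ℕ → ℕ} {Ω : ℕ → Type*}
    [∀ n, MeasurableSpace (Ω n)] {P : ∀ n, Measure (Ω n)} [∀ n, IsProbabilityMeasure (P n)]
    (M : ∀ n, Model (P n) r₁ (v₁ n) r₂ (v₂ n))
    (DL : ∀ n, Decomposition (M n).L₁ (M n).L₂) (DR : ∀ n, Decomposition (M n).R₁ (M n).R₂)
    {γ S K c C c₃ : ℝ} (hγ : 2 < γ) {s₁ s₂ t₁ t₂ : ℕ → ℝ}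
    (hα : ∀ n, Summable fun j : ℕ => mixingCoeff (P n) (M n).Y (M n).F (j + 1) ^ (1 - 2 / γ))
    (hS : ∀ n, ∑' j : ℕ, mixingCoeff (P n) (M n).Y (M n).F (j + 1) ^ (1 - 2 / γ) ≤ S)
    (hK : 1 ≤ K)
    (hmom : ∀ n t m l, MomentBound (P n) (fun ω => (M n).rot (DL n) (DR n) t ω m l) (2 * γ) K)
    (hL : ∀ n, LoadingBounds (DL n) k₁ c C c₃ (s₁ n) (s₂ n))
    (hR : ∀ n, LoadingBounds (DR n) k₂ c C c₃ (t₁ n) (t₂ n))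
    (hs₁ : ∀ n, s₁ n ≤ (r₁ + v₁ n : ℕ)) (hs₂ : ∀ n, s₂ n ≤ (r₁ + v₁ n : ℕ))
    (ht₁ : ∀ n, t₁ n ≤ (r₂ + v₂ n : ℕ)) (ht₂ : ∀ n, t₂ n ≤ (r₂ + v₂ n : ℕ)) {ε : ℝ} (hε : 0 < ε) :
    ∃ κ : ℝ, 1 ≤ κ ∧ ∀ᶠ n in atTop,
      P n {ω | κ * (((r₁ + v₁ n : ℕ) : ℝ) * ((r₂ + v₂ n : ℕ) : ℝ)) ^ 2 / n <
        ∑ k ∈ Finset.range (k₀ + 1), lagErr (P n) (M n).Y n k ω} ≤ ENNReal.ofReal ε := by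
  set B := ((k₀ : ℝ) + 1) * (4 * (2 * ((4 + 6 * K + K ^ 2) * (k₀ + 1 + S)) +
    (k₀ : ℝ) ^ 2 * (1 + K) ^ 2)) with hB
  -- Chosen so that Markov's bound `B / l` is at most `ε`.
  set l := max 1 (B / ε) with hl
  have hl1 : 1 ≤ l := le_max_left _ _
  have hl0 : 0 < l := lt_of_lt_of_le one_pos hl1
  have hBl : B / l ≤ ε := by
    rw [div_le_iff₀ hl0]
    have := le_max_right 1 (B / ε)
    rw [div_le_iff₀ hε] at this
    linarith
  have hC1 : 1 ≤ C := (hL 0).one_le_C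
  have hC := (hL 0).C_pos
  set N₀ := 2 * C * ((r₁ : ℝ) + k₁ + 1) * (2 * C * (r₂ + k₂ + 1)) with hN₀
  have hge : ∀ a b : ℕ, 1 ≤ 2 * C * ((a : ℝ) + b + 1) := by
    intro a b
    have : 1 ≤ (a : ℝ) + b + 1 := by
      have : (0 : ℝ) ≤ (a : ℝ) + b := by positivity
      linarith
    nlinarith
  have hN₀1 : 1 ≤ N₀ := one_le_mul_of_one_le_of_one_le (hge _ _) (hge _ _)
  refine ⟨(k₀ + 1) * (4 * (l + 3 * l ^ 2)) * N₀ ^ 2, ?_, ?_⟩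
  · have h1 : (1 : ℝ) ≤ (k₀ : ℝ) + 1 := by
      have : (0 : ℝ) ≤ k₀ := by positivity
      linarith
    have h2 : 1 ≤ 4 * (l + 3 * l ^ 2) := by nlinarith
    exact one_le_mul_of_one_le_of_one_le (one_le_mul_of_one_le_of_one_le h1 h2)
      (one_le_pow₀ hN₀1)
  filter_upwards [eventually_ge_atTop (max k₀ 1)] with n hn
  have hwL := (hL n).sum_weight_le_card (hs₁ n) (hs₂ n) (Nat.le_add_left _ _)
  have hwR := (hR n).sum_weight_le_card (ht₁ n) (ht₂ n) (Nat.le_add_left _ _)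
  have hUL := mul_nonneg (hL n).C_pos.le (hL n).s₁_pos.le
  have hUR := mul_nonneg (hR n).C_pos.le (hR n).s₁_pos.le
  have hp₁ : (0 : ℝ) < (r₁ + v₁ n : ℕ) := (hL n).s₁_pos.trans_le (hs₁ n)
  have hp₂ : (0 : ℝ) < (r₂ + v₂ n : ℕ) := (hR n).s₁_pos.trans_le (ht₁ n)
  have hw : (∑ m, (DL n).weight (C * s₁ n) m) * (∑ m, (DR n).weight (C * t₁ n) m) ≤
      N₀ * (((r₁ + v₁ n : ℕ) : ℝ) * ((r₂ + v₂ n : ℕ) : ℝ)) := by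
    refine (mul_le_mul hwL hwR (Finset.sum_nonneg fun m _ => (DR n).weight_nonneg hUR m)
      ((Finset.sum_nonneg fun m _ => (DL n).weight_nonneg hUL m).trans hwL)).trans (le_of_eq ?_)
    rw [hN₀]; ring
  have h := (M n).measure_sum_lagErr_le (DL n) (DR n) hγ hK (hα n) (hS n) (hmom n) hUL hUR
    (hL n).upper (hR n).upper (by positivity) hw ((le_max_left _ _).trans hn)
    (lt_of_lt_of_le one_pos ((le_max_right _ _).trans hn)) hl0
  refine le_trans (le_of_eq ?_) (h.trans (ENNReal.ofReal_le_ofReal hBl))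
  congr 1
  ext ω
  simp only [Set.mem_ofPred_eq, mul_pow N₀, mul_assoc]

/-! ### Rates -/

/-- Here `a`, `b` are the dimensions, `Aδ`, `Aσ`, `Bδ`, `Bσ` stand for their powers `2δ₁`, `2δ₂`,
and `ν` for `1/n`. The relations `s² A = a²` express all strengths by `s₂`, `t₂`, which then cancel.
Only the last error term needs the factor `a`, because of its `v` weak noise directions. -/
lemma projected_error_le {a b s₁ s₂ t₁ t₂ Aδ Aσ Bδ Bσ ν q c₅ C k v κ X e x₁ x₂ y : ℝ}
    (ha : 1 ≤ a) (hs₂0 : 0 < s₂) (ht₂0 : 0 < t₂)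
    (hs₁ : s₁ ^ 2 * Aδ = a ^ 2) (hs₂ : s₂ ^ 2 * Aσ = a ^ 2)
    (ht₁ : t₁ ^ 2 * Bδ = b ^ 2) (ht₂ : t₂ ^ 2 * Bσ = b ^ 2) (hAδ : 1 ≤ Aδ) (hAδ' : Aδ ≤ a ^ 2)
    (hAσ : 1 ≤ Aσ) (hBδ : 1 ≤ Bδ) (hBσ : 1 ≤ Bσ) (hν : 0 ≤ ν) (hρ : Aδ * Bδ * ν ≤ 1)
    (hq : 0 < q) (hc₅ : 0 ≤ c₅) (hk : 0 ≤ k) (hv : v ≤ a) (hκ : 0 ≤ κ) (hX : 0 ≤ X)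
    (he : e ≤ κ * (a * b) ^ 2 * ν) (_ : 0 ≤ x₁) (hx₁ : x₁ ≤ X * (Aδ * Bδ * ν))
    (hx₂0 : 0 ≤ x₂) (hx₂ : x₂ ≤ X * (Aδ * Bδ * ν))
    (h : (q * s₂) ^ 2 / 2 * y ≤ c₅ * (2 * e / (q * t₂) ^ 2 + 16 * C ^ 2 * (s₁ ^ 2 + s₂ ^ 2) * x₁
      + 32 * C ^ 4 * (s₁ ^ 2 + s₂ ^ 2) * (t₁ ^ 2 + t₂ ^ 2) * x₁ * x₂ / (q * t₂) ^ 2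
      + 8 * C ^ 2 * (k * (C * s₂) ^ 2 + v * C ^ 2) * (t₁ ^ 2 + t₂ ^ 2) * x₂ / (q * t₂) ^ 2)) :
    y ≤ 2 / q ^ 2 * c₅ * (2 * κ / q ^ 2 + 16 * C ^ 2 * X + 32 * C ^ 4 * X ^ 2 / q ^ 2
      + 8 * C ^ 4 * (k + 1) * X / q ^ 2) * (a * ((Aσ + Aδ) * (Bσ + Bδ) * ν)) := by
  have hAδ0 : 0 < Aδ := by linarith
  have hBδ0 : 0 < Bδ := by linarith
  have hAσ0 : 0 < Aσ := by linarith
  have hBσ0 : 0 < Bσ := by linarith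
  have es₁ : s₁ ^ 2 = s₂ ^ 2 * Aσ / Aδ := by rw [eq_div_iff hAδ0.ne', hs₁, hs₂]
  have et₁ : t₁ ^ 2 = t₂ ^ 2 * Bσ / Bδ := by rw [eq_div_iff hBδ0.ne', ht₁, ht₂]
  have hA : s₁ ^ 2 + s₂ ^ 2 = s₂ ^ 2 * (Aσ + Aδ) / Aδ := by rw [es₁]; field_simp
  have hB : t₁ ^ 2 + t₂ ^ 2 = t₂ ^ 2 * (Bσ + Bδ) / Bδ := by rw [et₁]; field_simp
  set Y := (Aσ + Aδ) * (Bσ + Bδ) * ν with hY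
  have hY0 : 0 ≤ Y := by positivity
  have hYa : Y ≤ a * Y := le_mul_of_one_le_left hY0 ha
  -- The product of the two projection errors is of second order; one factor is replaced by `X`
  -- using `hρ`.
  have hx₁x₂ : x₁ * x₂ ≤ X ^ 2 * (Aδ * Bδ * ν) := by
    have h0 : 0 ≤ Aδ * Bδ * ν := by positivity
    calc x₁ * x₂ ≤ X * (Aδ * Bδ * ν) * (X * 1) :=
          mul_le_mul hx₁ (hx₂.trans (mul_le_mul_of_nonneg_left hρ hX)) hx₂0 (by positivity)
      _ = _ := by ring
  have i1 : 2 * e / (q * t₂) ^ 2 ≤ s₂ ^ 2 * (2 * κ / q ^ 2 * (a * Y)) := by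
    calc 2 * e / (q * t₂) ^ 2 ≤ 2 * (κ * (a * b) ^ 2 * ν) / (q * t₂) ^ 2 := by gcongr
      _ = s₂ ^ 2 * (2 * κ / q ^ 2 * (Aσ * Bσ * ν)) := by
          rw [mul_pow a, ← hs₂, ← ht₂]; field_simp
      _ ≤ s₂ ^ 2 * (2 * κ / q ^ 2 * (a * Y)) := by
          refine mul_le_mul_of_nonneg_left (mul_le_mul_of_nonneg_left (le_trans ?_ hYa)
            (by positivity)) (sq_nonneg _)
          rw [hY]; gcongr <;> linarith
  have i2 : 16 * C ^ 2 * (s₁ ^ 2 + s₂ ^ 2) * x₁ ≤ s₂ ^ 2 * (16 * C ^ 2 * X * (a * Y)) := by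
    calc 16 * C ^ 2 * (s₁ ^ 2 + s₂ ^ 2) * x₁
        ≤ 16 * C ^ 2 * (s₁ ^ 2 + s₂ ^ 2) * (X * (Aδ * Bδ * ν)) := by gcongr
      _ = s₂ ^ 2 * (16 * C ^ 2 * X * ((Aσ + Aδ) * Bδ * ν)) := by rw [hA]; field_simp
      _ ≤ s₂ ^ 2 * (16 * C ^ 2 * X * (a * Y)) := by
          refine mul_le_mul_of_nonneg_left (mul_le_mul_of_nonneg_left (le_trans ?_ hYa)
            (by positivity)) (sq_nonneg _)
          rw [hY]; gcongr; linarith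
  have i3 : 32 * C ^ 4 * (s₁ ^ 2 + s₂ ^ 2) * (t₁ ^ 2 + t₂ ^ 2) * x₁ * x₂ / (q * t₂) ^ 2
      ≤ s₂ ^ 2 * (32 * C ^ 4 * X ^ 2 / q ^ 2 * (a * Y)) := by
    calc _ = 32 * C ^ 4 * (s₁ ^ 2 + s₂ ^ 2) * (t₁ ^ 2 + t₂ ^ 2) * (x₁ * x₂) / (q * t₂) ^ 2 := by
          ring
      _ ≤ 32 * C ^ 4 * (s₁ ^ 2 + s₂ ^ 2) * (t₁ ^ 2 + t₂ ^ 2) * (X ^ 2 * (Aδ * Bδ * ν)) /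
            (q * t₂) ^ 2 := by gcongr
      _ = s₂ ^ 2 * (32 * C ^ 4 * X ^ 2 / q ^ 2 * Y) := by rw [hA, hB, hY]; field_simp
      _ ≤ _ := by gcongr
  have i4 : 8 * C ^ 2 * (k * (C * s₂) ^ 2 + v * C ^ 2) * (t₁ ^ 2 + t₂ ^ 2) * x₂ / (q * t₂) ^ 2
      ≤ s₂ ^ 2 * (8 * C ^ 4 * (k + 1) * X / q ^ 2 * (a * Y)) := by
    -- For the weak noise part, `Aδ ≤ a² = s₂² Aσ` brings out the factor `s₂²`.
    have j1 : (k * s₂ ^ 2 + a) * Aδ ≤ s₂ ^ 2 * ((k + 1) * (a * (Aσ + Aδ))) := by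
      have j2 : k * Aδ ≤ k * (a * (Aσ + Aδ)) := by
        gcongr
        calc Aδ ≤ Aσ + Aδ := by linarith
          _ ≤ _ := le_mul_of_one_le_left (by positivity) ha
      have j3 : a * Aδ ≤ s₂ ^ 2 * (a * (Aσ + Aδ)) := by
        calc a * Aδ ≤ a * a ^ 2 := by gcongr
          _ = s₂ ^ 2 * (a * Aσ) := by rw [← hs₂]; ring
          _ ≤ _ := by gcongr; linarith
      have := mul_le_mul_of_nonneg_left j2 (sq_nonneg s₂)
      linarith
    calc _ ≤ 8 * C ^ 2 * (k * (C * s₂) ^ 2 + a * C ^ 2) * (t₁ ^ 2 + t₂ ^ 2) *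
            (X * (Aδ * Bδ * ν)) / (q * t₂) ^ 2 := by gcongr
      _ = 8 * C ^ 4 * X / q ^ 2 * (((k * s₂ ^ 2 + a) * Aδ) * ((Bσ + Bδ) * ν)) := by
          rw [hB]; field_simp
      _ ≤ 8 * C ^ 4 * X / q ^ 2 * ((s₂ ^ 2 * ((k + 1) * (a * (Aσ + Aδ)))) * ((Bσ + Bδ) * ν)) := by
          gcongr
      _ = _ := by rw [hY]; ring
  have h2 := h.trans (mul_le_mul_of_nonneg_left (add_le_add (add_le_add (add_le_add i1 i2) i3) i4)
    hc₅)
  have hpos : 0 < (q * s₂) ^ 2 / 2 := by positivity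
  refine le_of_mul_le_mul_left (h2.trans (le_of_eq ?_)) hpos
  field_simp

/-- Comparison of the mixed powers with the two terms of the rate. -/
lemma rpow_products_le {a b δ σ : ℝ} (ha : 1 ≤ a) (hb : 1 ≤ b) (hδ : 0 ≤ δ) (hσ : 0 ≤ σ) :
    (a ^ (2 * σ) + a ^ (2 * δ)) * (b ^ (2 * σ) + b ^ (2 * δ)) ≤
      3 * ((a ^ σ * b ^ (3 * σ / 2)) ^ 2 + (a ^ δ * b ^ (δ + σ)) ^ 2) := by
  have ha0 : 0 < a := by linarith
  have hb0 : 0 < b := by linarith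
  have e : ∀ x : ℝ, 0 < x → ∀ s : ℝ, (x ^ s) ^ 2 = x ^ (2 * s) := by
    intro x hx s
    rw [← Real.rpow_natCast, ← Real.rpow_mul hx.le, mul_comm]; norm_num
  rw [mul_pow, mul_pow, e a ha0, e a ha0, e b hb0, e b hb0]
  have hm : ∀ {x y z w : ℝ}, x ≤ y → z ≤ w → a ^ x * b ^ z ≤ a ^ y * b ^ w := fun h1 h2 =>
    mul_le_mul (Real.rpow_le_rpow_of_exponent_le ha h1) (Real.rpow_le_rpow_of_exponent_le hb h2)
      (by positivity) (by positivity)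
  have p1 : 0 ≤ a ^ (2 * σ) * b ^ (2 * (3 * σ / 2)) := by positivity
  have p2 : 0 ≤ a ^ (2 * δ) * b ^ (2 * (δ + σ)) := by positivity
  have h1 : a ^ (2 * σ) * b ^ (2 * σ) ≤ a ^ (2 * σ) * b ^ (2 * (3 * σ / 2)) :=
    hm le_rfl (by linarith)
  have h2 : a ^ (2 * δ) * b ^ (2 * σ) ≤ a ^ (2 * δ) * b ^ (2 * (δ + σ)) := hm le_rfl (by linarith)
  have h3 : a ^ (2 * δ) * b ^ (2 * δ) ≤ a ^ (2 * δ) * b ^ (2 * (δ + σ)) := hm le_rfl (by linarith)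
  -- The only product not dominated by a single term for all exponents: the first term of the rate
  -- wins if `δ ≤ σ`, the second if `σ ≤ δ`.
  have h4 : a ^ (2 * σ) * b ^ (2 * δ) ≤
      a ^ (2 * σ) * b ^ (2 * (3 * σ / 2)) + a ^ (2 * δ) * b ^ (2 * (δ + σ)) := by
    rcases le_total δ σ with h | h
    · have : a ^ (2 * σ) * b ^ (2 * δ) ≤ a ^ (2 * σ) * b ^ (2 * (3 * σ / 2)) :=
        hm le_rfl (by linarith)
      linarith
    · have : a ^ (2 * σ) * b ^ (2 * δ) ≤ a ^ (2 * δ) * b ^ (2 * (δ + σ)) :=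
        hm (by linarith) (by linarith)
      linarith
  linarith [add_mul (a ^ (2 * σ)) (a ^ (2 * δ)) (b ^ (2 * σ) + b ^ (2 * δ)),
    mul_add (a ^ (2 * σ)) (b ^ (2 * σ)) (b ^ (2 * δ)),
    mul_add (a ^ (2 * δ)) (b ^ (2 * σ)) (b ^ (2 * δ))]

/-! ### Errors of the estimated spaces on the event that the sample moments are accurate -/

section Side

variable {Ω : Type*} [MeasurableSpace Ω] {P : Measure Ω}
  {p r v k q s w k' : ℕ} {L₁ : Matrix (Fin p) (Fin r) ℝ} {L₂ : Matrix (Fin p) (Fin v) ℝ}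
  {R₁ : Matrix (Fin q) (Fin s) ℝ} {R₂ : Matrix (Fin q) (Fin w) ℝ}
  {D : Decomposition L₁ L₂} {D' : Decomposition R₁ R₂} {c C c₃ : ℝ}

/-- The constant in the bound for the estimated loading space of the factors. -/
def factorConst (c C c₀ : ℝ) (r s k₀ : ℕ) : ℝ :=
  (22 * (k₀ * (C ^ 2 * (r * s)) ^ 2 / (c₀ * c ^ 4)) + 3) / (c₀ * c ^ 4)

lemma factorConst_nonneg {c C c₀ : ℝ} (hc₀ : 0 < c₀) (r s k₀ : ℕ) :
    0 ≤ factorConst c C c₀ r s k₀ := by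
  unfold factorConst; positivity

/-- The constant in the bound for the estimated space of the projected analysis. -/
def projectedConst (c C c₃ κ X : ℝ) (k : ℕ) : ℝ :=
  2 / (c₃ * c) ^ 2 * (22 * (2 * (C / (c₃ * c)) ^ 2) + 3) *
    (2 * κ / (c₃ * c) ^ 2 + 16 * C ^ 2 * X + 32 * C ^ 4 * X ^ 2 / (c₃ * c) ^ 2
      + 8 * C ^ 4 * (k + 1) * X / (c₃ * c) ^ 2)

lemma projectedConst_nonneg {c C c₃ κ X : ℝ} (hκ : 0 ≤ κ) (hX : 0 ≤ X) (k : ℕ) :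
    0 ≤ projectedConst c C c₃ κ X k := by
  unfold projectedConst; positivity

lemma frob_factorSpace_le_sum_lagErr {s₁ s₂ t₁ t₂ c₀ : ℝ} (hL : LoadingBounds D k c C c₃ s₁ s₂)
    (hR : LoadingBounds D' k' c C c₃ t₁ t₂) (hp : p = r + v) (hr : 1 ≤ r) (hs : 1 ≤ s) {k₀ : ℕ}
    (hk₀ : 1 ≤ k₀) (hc₀ : 0 < c₀) {X : ℤ → Ω → Matrix (Fin p) (Fin q) ℝ}
    {F : ℤ → Ω → Matrix (Fin r) (Fin s) ℝ}
    (hlag : ∀ l, 1 ≤ l → ∀ i j, lagCov P X l i j = L₁ * lagCoeff R₁ (lagCov P F l) i j * L₁ᵀ)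
    (hF : ∀ l i j a b, |lagCov P F l i j a b| ≤ 1)
    (hdyn : ∀ x : Fin r → ℝ, c₀ * (x ⬝ᵥ x) ≤ x ⬝ᵥ (dynCov P F k₀ *ᵥ x)) {n : ℕ} {ω : Ω}
    {H : Matrix (Fin p) (Fin p) ℝ}
    (hH : IsOrderedEigenbasis (sampleDynCov n (fun t => X t ω) k₀) H) :
    frob (firstCols r H * (firstCols r H)ᵀ - D.A₁ * D.A₁ᵀ) ≤ factorConst c C c₀ r s k₀ *
      ((∑ l ∈ Finset.range (k₀ + 1), lagErr P X n l ω) / (s₁ * t₁) ^ 2) := by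
  have hc := hL.c_pos
  have hC := hL.C_pos
  have hs₁ := hL.s₁_pos
  have ht₁ := hR.s₁_pos
  have : Nonempty (Finset.Icc 1 k₀) := ⟨⟨1, by simp [hk₀]⟩⟩
  have hd : ∀ x : Fin r → ℝ, c₀ * (x ⬝ᵥ x) ≤ x ⬝ᵥ ((∑ l : Finset.Icc 1 k₀, ∑ i, ∑ j,
      lagCov P F l i j * (lagCov P F l i j)ᵀ) *ᵥ x) := by
    intro x
    rw [Finset.sum_coe_sort (Finset.Icc 1 k₀)
      fun l => ∑ i, ∑ j, lagCov P F l i j * (lagCov P F l i j)ᵀ]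
    exact hdyn x
  have hH' : IsOrderedEigenbasis (∑ l : Finset.Icc 1 k₀, ∑ i, ∑ j,
      sampleLagCov n (fun t => X t ω) l i j * (sampleLagCov n (fun t => X t ω) l i j)ᵀ) H := by
    rw [Finset.sum_coe_sort (Finset.Icc 1 k₀) fun l => ∑ i, ∑ j,
      sampleLagCov n (fun t => X t ω) l i j * (sampleLagCov n (fun t => X t ω) l i j)ᵀ]
    exact hH
  have h := frob_factorSpace_le D (mul_pos hc hs₁) hL.lower (mul_pos hC hs₁) hL.upper
    (mul_pos hc ht₁) hR.lower (mul_pos hC ht₁) hR.upper hc₀ hr hs (by omega)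
    (Γ := fun l : Finset.Icc 1 k₀ => lagCov P X l) (Φ := fun l => lagCov P F l)
    (Γ' := fun l => sampleLagCov n (fun t => X t ω) l)
    (fun l i j => hlag l (Finset.mem_Icc.mp l.2).1 i j) (fun l i j a b => hF l i j a b) hd hH'
  rw [Finset.sum_coe_sort (Finset.Icc 1 k₀) fun l => ∑ i, ∑ j,
    frob (sampleLagCov n (fun t => X t ω) l i j - lagCov P X l i j)] at h
  -- Lag zero is added so that the factor spaces and the projected analysis are bounded by the same
  -- sum.
  have hle : ∑ l ∈ Finset.Icc 1 k₀, lagErr P X n l ω ≤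
      ∑ l ∈ Finset.range (k₀ + 1), lagErr P X n l ω :=
    Finset.sum_le_sum_of_subset_of_nonneg
      (fun l hl => Finset.mem_range.mpr (by have := (Finset.mem_Icc.mp hl).2; omega))
      fun l _ _ => lagErr_nonneg P X n l ω
  have hcard : Fintype.card (Finset.Icc 1 k₀) = k₀ := by simp
  rw [hcard] at h
  have hpos : 0 < c₀ * (c * s₁) ^ 2 * (c * t₁) ^ 2 := by positivity
  refine le_of_mul_le_mul_left (h.trans ?_) hpos
  refine (mul_le_mul_of_nonneg_left hle (by positivity)).trans (le_of_eq ?_)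
  unfold factorConst
  field_simp

/-- Both projections are replaced by their complements, which only changes the sign of the
difference. -/
lemma frob_lastCols_sub (hp : p = r + v) {H : Matrix (Fin p) (Fin p) ℝ} (hH : HalfOrthonormal H) :
    frob (lastCols r H * (lastCols r H)ᵀ - D.B₁ * D.B₁ᵀ) =
      frob (firstCols r H * (firstCols r H)ᵀ - D.A₁ * D.A₁ᵀ) := by
  rw [hH.lastCols_proj, ← D.proj_add_A hp, frob_sub_comm]
  congr 1
  abel

lemma rpow_one_sub_sq_mul {a : ℝ} (ha : 0 < a) (δ : ℝ) :
    (a ^ (1 - δ)) ^ 2 * a ^ (2 * δ) = a ^ 2 := by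
  rw [← Real.rpow_natCast, ← Real.rpow_mul ha.le, ← Real.rpow_add ha, ← Real.rpow_natCast]
  congr 1
  push_cast; ring

lemma rpow_sq {a : ℝ} (ha : 0 < a) (δ : ℝ) : (a ^ δ) ^ 2 = a ^ (2 * δ) := by
  rw [← Real.rpow_natCast, ← Real.rpow_mul ha.le, mul_comm]; norm_num

lemma frob_factorSpace_le_rate {δ₁ s₂ t₂ c₀ : ℝ}
    (hL : LoadingBounds D k c C c₃ ((p : ℝ) ^ (1 - δ₁)) s₂)
    (hR : LoadingBounds D' k' c C c₃ ((q : ℝ) ^ (1 - δ₁)) t₂) (hp : p = r + v) (hq : q = s + w)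
    (hr : 1 ≤ r) (hs : 1 ≤ s) {k₀ : ℕ}
    (hk₀ : 1 ≤ k₀) (hc₀ : 0 < c₀) {X : ℤ → Ω → Matrix (Fin p) (Fin q) ℝ}
    {F : ℤ → Ω → Matrix (Fin r) (Fin s) ℝ}
    (hlag : ∀ l, 1 ≤ l → ∀ i j, lagCov P X l i j = L₁ * lagCoeff R₁ (lagCov P F l) i j * L₁ᵀ)
    (hF : ∀ l i j a b, |lagCov P F l i j a b| ≤ 1)
    (hdyn : ∀ x : Fin r → ℝ, c₀ * (x ⬝ᵥ x) ≤ x ⬝ᵥ (dynCov P F k₀ *ᵥ x)) {n : ℕ} {ω : Ω}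
    {H : Matrix (Fin p) (Fin p) ℝ}
    (hH : IsOrderedEigenbasis (sampleDynCov n (fun t => X t ω) k₀) H) {κ : ℝ}
    (he : ∑ l ∈ Finset.range (k₀ + 1), lagErr P X n l ω ≤ κ * ((p : ℝ) * q) ^ 2 / n) :
    frob (firstCols r H * (firstCols r H)ᵀ - D.A₁ * D.A₁ᵀ) ≤
      factorConst c C c₀ r s k₀ * κ * (((p : ℝ) ^ δ₁ * (q : ℝ) ^ δ₁) ^ 2 / n) := by
  have hp0 : (0 : ℝ) < p := by exact_mod_cast (show 0 < p by omega)
  have hq0 : (0 : ℝ) < q := by exact_mod_cast (show 0 < q by omega)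
  refine (frob_factorSpace_le_sum_lagErr hL hR hp hr hs hk₀ hc₀ hlag hF hdyn hH).trans ?_
  rw [mul_assoc]
  refine mul_le_mul_of_nonneg_left ?_ (factorConst_nonneg hc₀ r s k₀)
  rw [div_le_iff₀ (by have := hL.s₁_pos; have := hR.s₁_pos; positivity)]
  refine he.trans (le_of_eq ?_)
  have h1 := rpow_one_sub_sq_mul hp0 δ₁
  have h2 := rpow_one_sub_sq_mul hq0 δ₁
  rw [← rpow_sq hp0] at h1
  rw [← rpow_sq hq0] at h2
  rw [mul_pow (p : ℝ) q, ← h1, ← h2]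
  ring

lemma frob_projectedSpace_le {δ₁ δ₂ : ℝ} (hδ₁ : 0 ≤ δ₁) (hδ₁' : δ₁ ≤ 1) (hδ₂ : 0 ≤ δ₂)
    (hL : LoadingBounds D k c C c₃ ((p : ℝ) ^ (1 - δ₁)) ((p : ℝ) ^ (1 - δ₂)))
    (hR : LoadingBounds D' k' c C c₃ ((q : ℝ) ^ (1 - δ₁)) ((q : ℝ) ^ (1 - δ₂)))
    (hp : p = r + v) (hr : 1 ≤ r) (hk : 1 ≤ k) (hkv : k ≤ v)
    (hq : q = s + w) (hs : 1 ≤ s) (hk' : 1 ≤ k') (hkw : k' ≤ w)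
    (hgap : 2 * C ^ 2 ≤ (c₃ * (c * (p : ℝ) ^ (1 - δ₂))) ^ 2)
    {X : ℤ → Ω → Matrix (Fin p) (Fin q) ℝ}
    (hcol : ∀ i, colVecCov P X i = kronRow (L₁ * L₁ᵀ + L₂ * L₂ᵀ) (R₁ * R₁ᵀ + R₂ * R₂ᵀ) i)
    {n : ℕ} {ω : Ω} {H G K : Matrix (Fin p) (Fin p) ℝ} {H' : Matrix (Fin q) (Fin q) ℝ}
    (hH : HalfOrthonormal H) (hH' : HalfOrthonormal H')
    (hG : IsOrderedEigenbasis (projCov P X D'.B₁ D.B₁) G)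
    (hK : IsOrderedEigenbasis
      (sampleProjCov n (fun t => X t ω) (lastCols s H') (lastCols r H)) K)
    {κ X₀ : ℝ} (hκ : 0 ≤ κ) (hX₀ : 0 ≤ X₀)
    (he : lagErr P X n 0 ω ≤ κ * ((p : ℝ) * q) ^ 2 / n)
    (hx₁ : frob (firstCols r H * (firstCols r H)ᵀ - D.A₁ * D.A₁ᵀ) ≤
      X₀ * (((p : ℝ) ^ δ₁ * (q : ℝ) ^ δ₁) ^ 2 / n))
    (hx₂ : frob (firstCols s H' * (firstCols s H')ᵀ - D'.A₁ * D'.A₁ᵀ) ≤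
      X₀ * (((p : ℝ) ^ δ₁ * (q : ℝ) ^ δ₁) ^ 2 / n))
    (hρ : ((p : ℝ) ^ δ₁ * (q : ℝ) ^ δ₁) ^ 2 / n ≤ 1) :
    frob (firstCols k K * (firstCols k K)ᵀ - firstCols k G * (firstCols k G)ᵀ) ≤
      projectedConst c C c₃ κ X₀ k * (p * (3 * ((((p : ℝ) ^ δ₂ * (q : ℝ) ^ (3 * δ₂ / 2)) ^ 2 / n +
        ((p : ℝ) ^ δ₁ * (q : ℝ) ^ (δ₁ + δ₂)) ^ 2 / n)))) := by
  have hp1 : (1 : ℝ) ≤ p := by exact_mod_cast (show 1 ≤ p by omega)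
  have hq1 : (1 : ℝ) ≤ q := by exact_mod_cast (show 1 ≤ q by omega)
  have hp0 : (0 : ℝ) < p := by linarith
  have hq0 : (0 : ℝ) < q := by linarith
  have hvp : (v : ℝ) ≤ p := by exact_mod_cast (show v ≤ p by omega)
  have h := hL.frob_projected_le hp hr hk hkv hR hq hs hk' hkw hgap (hH'.lastCols s)
    (hH.lastCols r) hcol hG hK
  rw [frob_lastCols_sub hp hH, frob_lastCols_sub hq hH', sum_frob_sampleColVecCov_sub] at h
  simp only [← mul_assoc c₃ c] at h
  have hρeq : ((p : ℝ) ^ δ₁ * (q : ℝ) ^ δ₁) ^ 2 / n =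
      (p : ℝ) ^ (2 * δ₁) * (q : ℝ) ^ (2 * δ₁) * (1 / n) := by
    rw [mul_pow, rpow_sq hp0, rpow_sq hq0]; ring
  rw [hρeq] at hx₁ hx₂ hρ
  have hn : (0 : ℝ) ≤ 1 / n := by positivity
  have hbound := projected_error_le hp1 hL.s₂_pos hR.s₂_pos (rpow_one_sub_sq_mul hp0 δ₁)
    (rpow_one_sub_sq_mul hp0 δ₂) (rpow_one_sub_sq_mul hq0 δ₁) (rpow_one_sub_sq_mul hq0 δ₂)
    (Real.one_le_rpow hp1 (by linarith))
    (by rw [← Real.rpow_natCast]; exact Real.rpow_le_rpow_of_exponent_le hp1 (by push_cast; linarith))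
    (Real.one_le_rpow hp1 (by linarith)) (Real.one_le_rpow hq1 (by linarith))
    (Real.one_le_rpow hq1 (by linarith)) hn hρ (mul_pos hL.c₃_pos hL.c_pos) (by positivity)
    (Nat.cast_nonneg k) hvp hκ hX₀ (he.trans (le_of_eq (by ring))) (frob_nonneg _) hx₁
    (frob_nonneg _) hx₂ h
  refine hbound.trans ?_
  unfold projectedConst
  refine mul_le_mul_of_nonneg_left (mul_le_mul_of_nonneg_left ?_ hp0.le) (by positivity)
  refine (mul_le_mul_of_nonneg_right (rpow_products_le hp1 hq1 hδ₁ hδ₂) hn).trans (le_of_eq ?_)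
  ring

end Side

/-! ### Stochastic order -/

/-- Reduces stochastic order to a deterministic bound outside a rare event; its constant may depend
on the level `κ` of that event, hence on `ε`. -/
lemma IsBigOP.of_tight {Ω : ℕ → Type*} [∀ n, MeasurableSpace (Ω n)] {P : ∀ n, Measure (Ω n)}
    {bad : ℝ → ∀ n, Set (Ω n)}
    (hbad : ∀ ε : ℝ, 0 < ε → ∃ κ : ℝ, 1 ≤ κ ∧ ∀ᶠ n in atTop, P n (bad κ n) ≤ ENNReal.ofReal ε)
    {X : ∀ n, Ω n → ℝ} {ρ : ℕ → ℝ}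
    (hX : ∀ κ : ℝ, 1 ≤ κ → ∃ C : ℝ, ∀ᶠ n in atTop, ∀ ω, ω ∉ bad κ n → |X n ω| ≤ C * ρ n) :
    IsBigOP P X ρ := by
  intro ε hε
  obtain ⟨κ, hκ, h1⟩ := hbad ε hε
  obtain ⟨C, h2⟩ := hX κ hκ
  refine ⟨C, ?_⟩
  filter_upwards [h1, h2] with n h1 h2
  refine (measure_mono fun ω hω => ?_).trans h1
  by_contra hb
  exact absurd (h2 ω hb) (not_le.mpr hω)

lemma abs_spaceDist_le {m ι κ : Type*} [Fintype m] [Fintype ι] [Fintype κ] [DecidableEq ι]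
    [DecidableEq κ] {H : Matrix m ι ℝ} {K : Matrix m κ ℝ}
    (hH : HalfOrthonormal H) (hK : HalfOrthonormal K)
    (hcard : Fintype.card ι = Fintype.card κ) (h0 : 0 < Fintype.card ι) {A ρ : ℝ} (hA : 0 ≤ A)
    (hρ : 0 ≤ ρ) (h : frob (H * Hᵀ - K * Kᵀ) ≤ 2 * Fintype.card ι * (A * ρ ^ 2)) :
    |spaceDist H K| ≤ √A * ρ := by
  have h0' : (0 : ℝ) < Fintype.card ι := by exact_mod_cast h0
  rw [spaceDist_eq hH hK hcard h0, abs_of_nonneg (Real.sqrt_nonneg _)]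
  refine Real.sqrt_le_iff.mpr ⟨by positivity, ?_⟩
  rw [mul_pow, Real.sq_sqrt hA, div_le_iff₀ (by positivity)]
  linarith

lemma abs_spaceDist_le_of_frob_le {m ι κ : Type*} [Fintype m] [Fintype ι] [Fintype κ]
    [DecidableEq ι] [DecidableEq κ] {H : Matrix m ι ℝ} {K : Matrix m κ ℝ}
    (hH : HalfOrthonormal H) (hK : HalfOrthonormal K)
    (hcard : Fintype.card ι = Fintype.card κ) (h0 : 0 < Fintype.card ι) {A ρ : ℝ} (hA : 0 ≤ A)
    (hρ : 0 ≤ ρ) (h : frob (H * Hᵀ - K * Kᵀ) ≤ A * ρ ^ 2) :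
    |spaceDist H K| ≤ √A * ρ := by
  have h1 : (1 : ℝ) ≤ 2 * Fintype.card ι := by
    have : (1 : ℝ) ≤ Fintype.card ι := by exact_mod_cast h0
    linarith
  exact abs_spaceDist_le hH hK hcard h0 hA hρ
    (h.trans (le_mul_of_one_le_left (by positivity) h1))

/-- The distance is normalized by `p - k` columns, while the projections differ by as much as those
of rank `k`. This normalization removes the factor `p` of the hypothesis. -/
lemma abs_spaceDist_lastCols_le {p k : ℕ} (hkp : k < p) {G K : Matrix (Fin p) (Fin p) ℝ}
    (hG : HalfOrthonormal G) (hK : HalfOrthonormal K) {A ρ₁ ρ₂ : ℝ} (hA : 0 ≤ A) (h₁ : 0 ≤ ρ₁)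
    (h₂ : 0 ≤ ρ₂)
    (h : frob (firstCols k K * (firstCols k K)ᵀ - firstCols k G * (firstCols k G)ᵀ) ≤
      A * (p * (3 * (ρ₁ ^ 2 + ρ₂ ^ 2)))) :
    |spaceDist (lastCols k K) (lastCols k G)| ≤ √(2 * A * (k + 1)) * (ρ₁ + ρ₂) := by
  have hcard := card_lastCols hkp.le
  refine abs_spaceDist_le (hK.lastCols k) (hG.lastCols k) rfl (by rw [hcard]; omega)
    (by positivity) (by positivity) ?_
  rw [hK.lastCols_proj, hG.lastCols_proj, sub_sub_sub_cancel_left, frob_sub_comm]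
  refine h.trans ?_
  rw [hcard]
  -- With `p = k + m + 1` the inequality reads `k + m + 1 ≤ (k + 1)(m + 1)`.
  have h3 : (p : ℝ) ≤ (k + 1) * (p - k : ℕ) := by
    have : p ≤ (k + 1) * (p - k) := by
      obtain ⟨m, rfl⟩ := Nat.exists_eq_add_of_lt hkp
      have e : k + m + 1 - k = m + 1 := by omega
      rw [e]; nlinarith [Nat.zero_le (k * m)]
    exact_mod_cast this
  have h4 : ρ₁ ^ 2 + ρ₂ ^ 2 ≤ (ρ₁ + ρ₂) ^ 2 := by nlinarith [mul_nonneg h₁ h₂]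
  calc A * (p * (3 * (ρ₁ ^ 2 + ρ₂ ^ 2)))
      ≤ A * ((k + 1) * (p - k : ℕ) * (4 * (ρ₁ + ρ₂) ^ 2)) := by gcongr; norm_num
    _ = _ := by ring

/-- For `δ < 1` the strong noise eventually dominates the weak one; this supplies the eigenvalue gap
of the projected analysis. -/
lemma eventually_le_sq_rpow {p : ℕ → ℕ} (hp : Tendsto p atTop atTop) {δ c c₃ : ℝ} (hδ : δ < 1)
    (hc : 0 < c) (hc₃ : 0 < c₃) (B : ℝ) :
    ∀ᶠ n in atTop, B ≤ (c₃ * (c * (p n : ℝ) ^ (1 - δ))) ^ 2 := by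
  have h1 : Tendsto (fun n => (p n : ℝ) ^ (1 - δ)) atTop atTop :=
    (tendsto_rpow_atTop (by linarith)).comp (tendsto_natCast_atTop_atTop.comp hp)
  have h2 := (tendsto_pow_atTop (two_ne_zero)).comp
    (Tendsto.const_mul_atTop hc₃ (Tendsto.const_mul_atTop hc h1))
  exact h2.eventually_ge_atTop B

lemma rate_nonneg (p₁ p₂ : ℕ → ℕ) (a b : ℝ) (n : ℕ) : 0 ≤ rate p₁ p₂ a b n := by
  unfold rate; positivity

lemma rate_comm (p₁ p₂ : ℕ → ℕ) (a b : ℝ) (n : ℕ) : rate p₁ p₂ a b n = rate p₂ p₁ b a n := by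
  unfold rate; ring

lemma rate_sq (p₁ p₂ : ℕ → ℕ) (a b : ℝ) (n : ℕ) :
    rate p₁ p₂ a b n ^ 2 = ((p₁ n : ℝ) ^ a * (p₂ n : ℝ) ^ b) ^ 2 / n := by
  unfold rate
  rw [mul_pow, div_eq_mul_inv (_ ^ 2) (n : ℝ)]
  congr 1
  rw [← Real.rpow_natCast, ← Real.rpow_mul (Nat.cast_nonneg n),
    show (-(1 / 2) : ℝ) * ((2 : ℕ) : ℝ) = -1 by norm_num, Real.rpow_neg_one]

end MatrixFactor

end

/-! ### The convergence rates -/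

open MatrixFactor

theorem theorem2
    -- fixed numbers of factors, of strong noise directions, and of lags
    (r₁ r₂ k₁ k₂ k₀ : ℕ) (hr₁ : 1 ≤ r₁) (hr₂ : 1 ≤ r₂) (hk₁ : 1 ≤ k₁) (hk₂ : 1 ≤ k₂) (hk₀ : 1 ≤ k₀)
    -- dimensions, indexed by the sample size
    (v₁ v₂ p₁ p₂ : ℕ → ℕ) (hkv₁ : ∀ n, k₁ < v₁ n) (hkv₂ : ∀ n, k₂ < v₂ n)
    (hp₁ : p₁ = fun n => r₁ + v₁ n) (hp₂ : p₂ = fun n => r₂ + v₂ n)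
    (hp₁_lim : Tendsto p₁ atTop atTop) (hp₂_lim : Tendsto p₂ atTop atTop)
    (γ δ₁ δ₂ : ℝ) (hγ : 2 < γ) (hδ₁ : 0 ≤ δ₁) (hδ₁' : δ₁ < 1) (hδ₂ : 0 ≤ δ₂) (hδ₂' : δ₂ < 1)
    -- the model
    {Ω : ℕ → Type*} [∀ n, MeasurableSpace (Ω n)] (P : ∀ n, Measure (Ω n))
    [∀ n, IsProbabilityMeasure (P n)]
    (M : ∀ n, MatrixFactor.Model (P n) r₁ (v₁ n) r₂ (v₂ n))
    (DL : ∀ n, MatrixFactor.Decomposition (M n).L₁ (M n).L₂)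
    (DR : ∀ n, MatrixFactor.Decomposition (M n).R₁ (M n).R₂)
    -- the factors are serially dependent, in the row and in the column direction
    (hdyn : ∃ c : ℝ, 0 < c ∧ ∀ n,
      (∀ x : Fin r₁ → ℝ, c * (x ⬝ᵥ x) ≤ x ⬝ᵥ (MatrixFactor.dynCov (P n) (M n).F k₀ *ᵥ x)) ∧
      (∀ x : Fin r₂ → ℝ, c * (x ⬝ᵥ x) ≤ x ⬝ᵥ (MatrixFactor.dynCov (P n) (M n).Ft k₀ *ᵥ x)))
    -- mixing
    (hmix : ∃ C : ℝ, ∀ n,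
      Summable (fun k : ℕ =>
        MatrixFactor.mixingCoeff (P n) (M n).Y (M n).F (k + 1) ^ (1 - 2 / γ)) ∧
      ∑' k : ℕ, MatrixFactor.mixingCoeff (P n) (M n).Y (M n).F (k + 1) ^ (1 - 2 / γ) ≤ C)
    -- moments of the entries
    (hmom : ∃ C₁ C₂ : ℝ, ∀ n t,
      (∀ i j, MatrixFactor.MomentBound (P n) (fun ω => (M n).F t ω i j) (2 * γ) C₁) ∧
      (∀ x, MatrixFactor.MomentBound (P n) (fun ω => (M n).z t ω x) (2 * γ) C₂))
    -- strength of the factors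
    (hL₁ : MatrixFactor.FactorStrength (fun n => r₁ + v₁ n) (fun n => (M n).L₁) δ₁)
    (hR₁ : MatrixFactor.FactorStrength (fun n => r₂ + v₂ n) (fun n => (M n).R₁) δ₁)
    -- strength of the noise
    (hL₂ : MatrixFactor.NoiseStrength (fun n => r₁ + v₁ n) v₁ k₁ (fun n => (DL n).d) δ₂)
    (hR₂ : MatrixFactor.NoiseStrength (fun n => r₂ + v₂ n) v₂ k₂ (fun n => (DR n).d) δ₂)
    -- moments of normalized linear combinations of the noise
    (hproj : ∃ C : ℝ, ∀ n t,
      MatrixFactor.ProjMomentBound (P n) ((M n).Z₂₂ t) (2 * γ) C ∧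
      MatrixFactor.ProjMomentBound (P n) ((M n).Z₁₂ t) (2 * γ) C ∧
      MatrixFactor.ProjMomentBound (P n) ((M n).Z₂₁ t) (2 * γ) C)
    -- the strong noise directions are separated from the factor loading spaces
    (hsep : ∃ C₃ C₄ : ℝ, 0 < C₃ ∧ 0 < C₄ ∧ ∀ n,
      MatrixFactor.WellProjected ((DL n).starBasis k₁) (DL n).A₁ C₃ ∧
      MatrixFactor.WellProjected ((DR n).starBasis k₂) (DR n).A₁ C₄)
    -- growth of the dimensions
    (hrate : Tendsto (MatrixFactor.rate p₁ p₂ δ₁ δ₁) atTop (𝓝 0))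
    -- ordered eigenvectors of the population matrices of the projected noise
    (G₁ : ∀ n, Matrix (Fin (r₁ + v₁ n)) (Fin (r₁ + v₁ n)) ℝ)
    (G₂ : ∀ n, Matrix (Fin (r₂ + v₂ n)) (Fin (r₂ + v₂ n)) ℝ)
    (hG₁ : ∀ n, MatrixFactor.IsOrderedEigenbasis
      (MatrixFactor.projCov (P n) (M n).Y (DR n).B₁ (DL n).B₁) (G₁ n))
    (hG₂ : ∀ n, MatrixFactor.IsOrderedEigenbasis
      (MatrixFactor.projCov (P n) (M n).Yt (DL n).B₁ (DR n).B₁) (G₂ n))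
    -- ordered eigenvectors of the sample matrices, built from the observations 1, ..., n
    (H₁ : ∀ n, Ω n → Matrix (Fin (r₁ + v₁ n)) (Fin (r₁ + v₁ n)) ℝ)
    (H₂ : ∀ n, Ω n → Matrix (Fin (r₂ + v₂ n)) (Fin (r₂ + v₂ n)) ℝ)
    (hH₁ : ∀ n ω, MatrixFactor.IsOrderedEigenbasis
      (MatrixFactor.sampleDynCov n (fun t => (M n).Y t ω) k₀) (H₁ n ω))
    (hH₂ : ∀ n ω, MatrixFactor.IsOrderedEigenbasis
      (MatrixFactor.sampleDynCov n (fun t => (M n).Yt t ω) k₀) (H₂ n ω))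
    -- ordered eigenvectors of the sample matrices of the projected noise
    (K₁ : ∀ n, Ω n → Matrix (Fin (r₁ + v₁ n)) (Fin (r₁ + v₁ n)) ℝ)
    (K₂ : ∀ n, Ω n → Matrix (Fin (r₂ + v₂ n)) (Fin (r₂ + v₂ n)) ℝ)
    (hK₁ : ∀ n ω, MatrixFactor.IsOrderedEigenbasis
      (MatrixFactor.sampleProjCov n (fun t => (M n).Y t ω)
        (MatrixFactor.lastCols r₂ (H₂ n ω)) (MatrixFactor.lastCols r₁ (H₁ n ω))) (K₁ n ω))
    (hK₂ : ∀ n ω, MatrixFactor.IsOrderedEigenbasis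
      (MatrixFactor.sampleProjCov n (fun t => (M n).Yt t ω)
        (MatrixFactor.lastCols r₁ (H₁ n ω)) (MatrixFactor.lastCols r₂ (H₂ n ω))) (K₂ n ω)) :
    -- the loading spaces of the factors and their complements
    MatrixFactor.IsBigOP P
      (fun n ω => MatrixFactor.spaceDist (MatrixFactor.firstCols r₁ (H₁ n ω)) (DL n).A₁)
      (MatrixFactor.rate p₁ p₂ δ₁ δ₁) ∧
    MatrixFactor.IsBigOP P
      (fun n ω => MatrixFactor.spaceDist (MatrixFactor.firstCols r₂ (H₂ n ω)) (DR n).A₁)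
      (MatrixFactor.rate p₁ p₂ δ₁ δ₁) ∧
    MatrixFactor.IsBigOP P
      (fun n ω => MatrixFactor.spaceDist (MatrixFactor.lastCols r₁ (H₁ n ω)) (DL n).B₁)
      (MatrixFactor.rate p₁ p₂ δ₁ δ₁) ∧
    MatrixFactor.IsBigOP P
      (fun n ω => MatrixFactor.spaceDist (MatrixFactor.lastCols r₂ (H₂ n ω)) (DR n).B₁)
      (MatrixFactor.rate p₁ p₂ δ₁ δ₁) ∧
    -- the spaces of the projected principal component analysis
    MatrixFactor.IsBigOP P
      (fun n ω => MatrixFactor.spaceDist (MatrixFactor.lastCols k₁ (K₁ n ω))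
        (MatrixFactor.lastCols k₁ (G₁ n)))
      (fun n => MatrixFactor.rate p₁ p₂ δ₂ (3 * δ₂ / 2) n +
        MatrixFactor.rate p₁ p₂ δ₁ (δ₁ + δ₂) n) ∧
    MatrixFactor.IsBigOP P
      (fun n ω => MatrixFactor.spaceDist (MatrixFactor.lastCols k₂ (K₂ n ω))
        (MatrixFactor.lastCols k₂ (G₂ n)))
      (fun n => MatrixFactor.rate p₁ p₂ (3 * δ₂ / 2) δ₂ n +
        MatrixFactor.rate p₁ p₂ (δ₁ + δ₂) δ₁ n) := by
  subst hp₁ hp₂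
  obtain ⟨c₀, hc₀, hdyn⟩ := hdyn
  obtain ⟨S, hS⟩ := hmix
  obtain ⟨C₁, _, hmom⟩ := hmom
  obtain ⟨C₅, hproj⟩ := hproj
  obtain ⟨C₃, C₄, hC₃, hC₄, hsep⟩ := hsep
  obtain ⟨cL, CL, hLB⟩ := exists_loadingBounds hr₁ DL hδ₂'.le hL₁ hL₂ hC₃ fun n => (hsep n).1
  obtain ⟨cR, CR, hRB⟩ := exists_loadingBounds hr₂ DR hδ₂'.le hR₁ hR₂ hC₄ fun n => (hsep n).2
  have hc : 0 < min cL cR := lt_min (hLB 0).c_pos (hRB 0).c_pos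
  have hc₃ : 0 < min C₃ C₄ := lt_min hC₃ hC₄
  replace hLB := fun n => (hLB n).mono hc (min_le_left _ _) (le_max_left CL CR) hc₃ (min_le_left _ _)
  replace hRB := fun n =>
    (hRB n).mono hc (min_le_right _ _) (le_max_right CL CR) hc₃ (min_le_right _ _)
  set c := min cL cR
  set C := max CL CR
  set c₃ := min C₃ C₄
  have hle : ∀ {m : ℕ}, 1 ≤ m → ∀ {δ : ℝ}, 0 ≤ δ → (m : ℝ) ^ (1 - δ) ≤ m := by
    intro m hm δ hδ
    have h1 : (1 : ℝ) ≤ m := by exact_mod_cast hm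
    calc (m : ℝ) ^ (1 - δ) ≤ (m : ℝ) ^ (1 : ℝ) :=
          Real.rpow_le_rpow_of_exponent_le h1 (by linarith)
      _ = m := Real.rpow_one _
  have hp₁1 : ∀ n, 1 ≤ r₁ + v₁ n := fun n => by omega
  have hp₂1 : ∀ n, 1 ≤ r₂ + v₂ n := fun n => by omega
  have hrot : ∀ n t m l, MomentBound (P n) (fun ω => (M n).rot (DL n) (DR n) t ω m l) (2 * γ)
      (max 1 (max C₁ C₅)) := by
    have h1 : C₁ ≤ max 1 (max C₁ C₅) := (le_max_left _ _).trans (le_max_right _ _)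
    have h5 : C₅ ≤ max 1 (max C₁ C₅) := (le_max_right _ _).trans (le_max_right _ _)
    intro n t m l
    exact Model.rot_momentBound (M n) (DL n) (DR n)
      (fun i j => ⟨((hmom n t).1 i j).1, ((hmom n t).1 i j).2.trans h1⟩)
      (fun a b h U V e1 e2 e3 => ⟨((hproj n t).1 a b h U V e1 e2 e3).1,
        ((hproj n t).1 a b h U V e1 e2 e3).2.trans h5⟩)
      (fun a b h U V e1 e2 e3 => ⟨((hproj n t).2.1 a b h U V e1 e2 e3).1,
        ((hproj n t).2.1 a b h U V e1 e2 e3).2.trans h5⟩)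
      (fun a b h U V e1 e2 e3 => ⟨((hproj n t).2.2 a b h U V e1 e2 e3).1,
        ((hproj n t).2.2 a b h U V e1 e2 e3).2.trans h5⟩) m l
  have htight := fun (ε : ℝ) (hε : 0 < ε) => exists_sum_lagErr_tight (k₀ := k₀) M DL DR hγ
    (fun n => (hS n).1) (fun n => (hS n).2) (le_max_left 1 (max C₁ C₅)) hrot hLB hRB
    (fun n => hle (hp₁1 n) hδ₁) (fun n => hle (hp₁1 n) hδ₂)
    (fun n => hle (hp₂1 n) hδ₁) (fun n => hle (hp₂1 n) hδ₂) hε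
  have hsumt : ∀ n ω, ∑ l ∈ Finset.range (k₀ + 1), lagErr (P n) (M n).Yt n l ω =
      ∑ l ∈ Finset.range (k₀ + 1), lagErr (P n) (M n).Y n l ω := fun n ω =>
    Finset.sum_congr rfl fun l _ => lagErr_transpose (P n) (M n).Y n l ω
  have hzero : ∀ n ω, lagErr (P n) (M n).Y n 0 ω ≤
      ∑ l ∈ Finset.range (k₀ + 1), lagErr (P n) (M n).Y n l ω := fun n ω =>
    Finset.single_le_sum (f := fun l => lagErr (P n) (M n).Y n l ω)
      (fun l _ => lagErr_nonneg _ _ _ _ _) (Finset.mem_range.mpr (Nat.succ_pos _))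
  -- The sum of the row and the column constant, so that one bound holds for both factor spaces.
  set X : ℝ → ℝ := fun κ => (factorConst c C c₀ r₁ r₂ k₀ + factorConst c C c₀ r₂ r₁ k₀) * κ with hX
  have hfc₁ := factorConst_nonneg (c := c) (C := C) hc₀ r₁ r₂ k₀
  have hfc₂ := factorConst_nonneg (c := c) (C := C) hc₀ r₂ r₁ k₀
  have hX0 : ∀ κ, 1 ≤ κ → 0 ≤ X κ := fun κ hκ =>
    mul_nonneg (add_nonneg hfc₁ hfc₂) (by linarith)
  set ρ := rate (fun n => r₁ + v₁ n) (fun n => r₂ + v₂ n) δ₁ δ₁ with hρ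
  have hρ0 : ∀ n, 0 ≤ ρ n := fun n => rate_nonneg _ _ _ _ _
  have hρsq : ∀ n, ρ n ^ 2 = ((((r₁ + v₁ n : ℕ) : ℝ)) ^ δ₁ * (((r₂ + v₂ n : ℕ) : ℝ)) ^ δ₁) ^ 2 / n :=
    fun n => rate_sq _ _ _ _ _
  -- The only exceptional event; all six distances are bounded deterministically outside it.
  set bad : ℝ → ∀ n, Set (Ω n) := fun κ n =>
    {ω | κ * (((r₁ + v₁ n : ℕ) : ℝ) * ((r₂ + v₂ n : ℕ) : ℝ)) ^ 2 / n <
      ∑ k ∈ Finset.range (k₀ + 1), lagErr (P n) (M n).Y n k ω} with hbad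
  have hgood : ∀ {κ : ℝ} {n : ℕ} {ω : Ω n}, ω ∉ bad κ n →
      ∑ k ∈ Finset.range (k₀ + 1), lagErr (P n) (M n).Y n k ω ≤
        κ * (((r₁ + v₁ n : ℕ) : ℝ) * ((r₂ + v₂ n : ℕ) : ℝ)) ^ 2 / n := fun h => not_lt.mp h
  have hfL : ∀ κ : ℝ, 1 ≤ κ → ∀ n, ∀ ω, ω ∉ bad κ n →
      frob (firstCols r₁ (H₁ n ω) * (firstCols r₁ (H₁ n ω))ᵀ - (DL n).A₁ * (DL n).A₁ᵀ) ≤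
        X κ * ρ n ^ 2 := by
    intro κ hκ n ω hω
    refine (frob_factorSpace_le_rate (hLB n) (hRB n) rfl rfl hr₁ hr₂ hk₀ hc₀
      (fun l hl i j => (M n).lagCov_Y hl i j) (fun l i j a b => (M n).abs_cov_F_le _ _ _ _ _ _)
      (hdyn n).1 (hH₁ n ω) (hgood hω)).trans ?_
    rw [← hρsq]
    refine mul_le_mul_of_nonneg_right ?_ (sq_nonneg _)
    exact mul_le_mul_of_nonneg_right (by linarith) (by linarith)
  have hfR : ∀ κ : ℝ, 1 ≤ κ → ∀ n, ∀ ω, ω ∉ bad κ n →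
      frob (firstCols r₂ (H₂ n ω) * (firstCols r₂ (H₂ n ω))ᵀ - (DR n).A₁ * (DR n).A₁ᵀ) ≤
        X κ * ρ n ^ 2 := by
    intro κ hκ n ω hω
    refine (frob_factorSpace_le_rate (hRB n) (hLB n) rfl rfl hr₂ hr₁ hk₀ hc₀
      (fun l hl i j => (M n).lagCov_Yt hl i j) (fun l i j a b => (M n).abs_cov_F_le _ _ _ _ _ _)
      (hdyn n).2 (hH₂ n ω) (κ := κ) ?_).trans ?_
    · rw [hsumt, mul_comm ((r₂ + v₂ n : ℕ) : ℝ)]; exact hgood hω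
    rw [mul_comm (((r₂ + v₂ n : ℕ) : ℝ) ^ δ₁), ← hρsq]
    refine mul_le_mul_of_nonneg_right ?_ (sq_nonneg _)
    exact mul_le_mul_of_nonneg_right (by linarith) (by linarith)
  -- The growth condition enters only here; it controls the product of the two projection errors in
  -- the projected analysis.
  have hρ1 : ∀ᶠ n in atTop, ρ n ^ 2 ≤ 1 := by
    filter_upwards [hrate.eventually (eventually_le_nhds one_pos)] with n hn
    exact pow_le_one₀ (hρ0 n) hn
  refine ⟨?_, ?_, ?_, ?_, ?_, ?_⟩
  · refine IsBigOP.of_tight htight fun κ hκ => ⟨√(X κ), Eventually.of_forall fun n ω hω => ?_⟩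
    have hcard := card_firstCols (Nat.le_add_right r₁ (v₁ n))
    exact abs_spaceDist_le_of_frob_le ((hH₁ n ω).1.firstCols r₁) (DL n).A₁_orth
      (by rw [hcard, Fintype.card_fin]) (by rw [hcard]; omega) (hX0 κ hκ) (hρ0 n) (hfL κ hκ n ω hω)
  · refine IsBigOP.of_tight htight fun κ hκ => ⟨√(X κ), Eventually.of_forall fun n ω hω => ?_⟩
    have hcard := card_firstCols (Nat.le_add_right r₂ (v₂ n))
    exact abs_spaceDist_le_of_frob_le ((hH₂ n ω).1.firstCols r₂) (DR n).A₁_orth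
      (by rw [hcard, Fintype.card_fin]) (by rw [hcard]; omega) (hX0 κ hκ) (hρ0 n) (hfR κ hκ n ω hω)
  · refine IsBigOP.of_tight htight fun κ hκ => ⟨√(X κ), Eventually.of_forall fun n ω hω => ?_⟩
    have hcard := card_lastCols (Nat.le_add_right r₁ (v₁ n))
    have hv := hkv₁ n
    exact abs_spaceDist_le_of_frob_le ((hH₁ n ω).1.lastCols r₁) (DL n).B₁_orth
      (by rw [hcard, Fintype.card_fin]; omega) (by rw [hcard]; omega) (hX0 κ hκ) (hρ0 n)
      ((frob_lastCols_sub rfl (hH₁ n ω).1).trans_le (hfL κ hκ n ω hω))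
  · refine IsBigOP.of_tight htight fun κ hκ => ⟨√(X κ), Eventually.of_forall fun n ω hω => ?_⟩
    have hcard := card_lastCols (Nat.le_add_right r₂ (v₂ n))
    have hv := hkv₂ n
    exact abs_spaceDist_le_of_frob_le ((hH₂ n ω).1.lastCols r₂) (DR n).B₁_orth
      (by rw [hcard, Fintype.card_fin]; omega) (by rw [hcard]; omega) (hX0 κ hκ) (hρ0 n)
      ((frob_lastCols_sub rfl (hH₂ n ω).1).trans_le (hfR κ hκ n ω hω))
  · refine IsBigOP.of_tight htight fun κ hκ =>
      ⟨√(2 * projectedConst c C c₃ κ (X κ) k₁ * (k₁ + 1)), ?_⟩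
    -- The eigenvalue gap and `ρ ≤ 1` hold only for large `n`, unlike the bounds for the factor
    -- spaces, which hold for every `n`.
    filter_upwards [hρ1, eventually_le_sq_rpow hp₁_lim hδ₂' hc hc₃ (2 * C ^ 2)] with n hn hgap ω hω
    have hv := hkv₁ n
    have hκ0 : 0 ≤ κ := by linarith
    refine abs_spaceDist_lastCols_le (by omega) (hG₁ n).1 (hK₁ n ω).1
      (projectedConst_nonneg hκ0 (hX0 κ hκ) k₁) (rate_nonneg _ _ _ _ _) (rate_nonneg _ _ _ _ _) ?_
    rw [rate_sq, rate_sq]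
    refine frob_projectedSpace_le hδ₁ hδ₁'.le hδ₂ (hLB n) (hRB n) rfl hr₁ hk₁ hv.le rfl hr₂ hk₂
      (hkv₂ n).le hgap (M n).colVecCov_Y (hH₁ n ω).1 (hH₂ n ω).1 (hG₁ n) (hK₁ n ω) hκ0 (hX0 κ hκ)
      ((hzero n ω).trans (hgood hω)) ?_ ?_ ?_
    · rw [← hρsq]; exact hfL κ hκ n ω hω
    · rw [← hρsq]; exact hfR κ hκ n ω hω
    · rw [← hρsq]; exact hn
  · refine IsBigOP.of_tight htight fun κ hκ =>
      ⟨√(2 * projectedConst c C c₃ κ (X κ) k₂ * (k₂ + 1)), ?_⟩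
    filter_upwards [hρ1, eventually_le_sq_rpow hp₂_lim hδ₂' hc hc₃ (2 * C ^ 2)] with n hn hgap ω hω
    have hv := hkv₂ n
    have hκ0 : 0 ≤ κ := by linarith
    -- The column analysis is the row analysis with the dimensions interchanged, so the exponents
    -- are swapped first.
    rw [rate_comm _ _ (3 * δ₂ / 2), rate_comm _ _ (δ₁ + δ₂)]
    refine abs_spaceDist_lastCols_le (by omega) (hG₂ n).1 (hK₂ n ω).1
      (projectedConst_nonneg hκ0 (hX0 κ hκ) k₂) (rate_nonneg _ _ _ _ _) (rate_nonneg _ _ _ _ _) ?_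
    rw [rate_sq, rate_sq]
    have hswap : (((r₂ + v₂ n : ℕ) : ℝ) ^ δ₁ * ((r₁ + v₁ n : ℕ) : ℝ) ^ δ₁) ^ 2 / n = ρ n ^ 2 := by
      rw [hρsq, mul_comm (((r₂ + v₂ n : ℕ) : ℝ) ^ δ₁)]
    refine frob_projectedSpace_le hδ₁ hδ₁'.le hδ₂ (hRB n) (hLB n) rfl hr₂ hk₂ hv.le rfl hr₁ hk₁
      (hkv₁ n).le hgap (M n).colVecCov_Yt (hH₂ n ω).1 (hH₁ n ω).1 (hG₂ n) (hK₂ n ω) hκ0 (hX0 κ hκ)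
      ?_ ?_ ?_ ?_
    · have h0 : lagErr (P n) (M n).Yt n 0 ω = lagErr (P n) (M n).Y n 0 ω :=
        lagErr_transpose (P n) (M n).Y n 0 ω
      rw [h0, mul_comm ((r₂ + v₂ n : ℕ) : ℝ)]
      exact (hzero n ω).trans (hgood hω)
    · rw [hswap]; exact hfR κ hκ n ω hω
    · rw [hswap]; exact hfL κ hκ n ω hω
    · rw [hswap]; exact hn
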